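/- Let $n\ge 0$ and let $\Sigma$ be a nonempty smooth $n$-manifold without boundary (Hausdorff, second countable, not necessarily connected), properly and smoothly immersed in $\mathbb R^{n+1}$ (hence complete in the induced metric) and two-sided, with a chosen smooth unit normal field $N$. Write $x$ for the position vector and $x^T$ for its tangential part, $A(X,Y)=\langle\nabla_XN,Y\rangle$ for the second fundamental form, $H=\operatorname{div}N=\operatorname{tr}A$ for the mean curvature, $d\mathcal A$ for the area measure of the induced metric on $\Sigma$ and $d\mathcal A_\mu=e^{-|x|^2/4}\,d\mathcal A$. Let $$Lu=\Delta u-\tfrac12\nabla_{x^T}u+|A|^2u+\tfrac12u,\qquad Q(u,v)=-\int_\Sigma u\,Lv\,d\mathcal A_\mu ,$$ where $\Delta$ and $\nabla$ are those of the induced metric, and let $\mathcal F=\{u\in C_0^\infty(\Sigma):\int_\Sigma u\,d\mathcal A_\mu=0\}$. Call $\Sigma$ stable if $Q(u,u)\ge 0$ for all $u\in\mathcal F$, and let $\operatorname{Ind}Q\in\{0,1,2,\dots,\infty\}$ be the maximal dimension of a linear subspace $W\subset\mathcal F$ on which $Q$ is negative definite. (1) The conditions "$\mathcal A_\mu(\Sigma)<\infty$,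 $H=\tfrac12\langle x,N\rangle+C$ on $\Sigma$ for some constant $C$, and $\Sigma$ is stable" hold together if and only if $\Sigma$ is a hyperplane, that is, the immersion maps $\Sigma$ bijectively onto an affine hyperplane of $\mathbb R^{n+1}$. (2) Suppose $\mathcal A_\mu(\Sigma)<\infty$ and $H=\tfrac12\langle x,N\rangle+C$ for some constant $C$. If $\Sigma$ is connected, then $\operatorname{Ind}Q\ne1$. If $\Sigma$ is not assumed connected, then $\operatorname{Ind}Q=1$ is possible only if $\Sigma$ is the disjoint union of two hyperplanes, that is, $\Sigma=U\sqcup U'$ with $U,U'$ open and each mapped bijectively onto an affine hyperplane. -/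

import Mathlib

open scoped Manifold ContDiff

/-- The Euclidean space `ℝᵐ`. -/
abbrev Euc (m : ℕ) : Type := EuclideanSpace ℝ (Fin m)

noncomputable section

namespace GaussIsop

/-! ### Local geometry of a parametrized hypersurface

`X : ℝⁿ → ℝⁿ⁺¹` is a local parametrization, `ν : ℝⁿ → ℝⁿ⁺¹` a unit normal along it and
`f : ℝⁿ → ℝ` a function on the hypersurface, all written in the coordinates `y ∈ ℝⁿ`. -/

namespace Coord

/-- The partial derivative `∂ᵢ f (y)`. -/
def pd {n : ℕ} {V : Type*} [NormedAddCommGroup V] [NormedSpace ℝ V]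
    (i : Fin n) (f : Euc n → V) (y : Euc n) : V :=
  fderiv ℝ f y (EuclideanSpace.single i 1)

/-- The induced metric `gᵢⱼ = ⟨∂ᵢX, ∂ⱼX⟩`. -/
def metric {n : ℕ} (X : Euc n → Euc (n + 1)) (y : Euc n) : Matrix (Fin n) (Fin n) ℝ :=
  Matrix.of fun i j => inner ℝ (pd i X y) (pd j X y)

/-- The area density `√(det g)`. -/
def density {n : ℕ} (X : Euc n → Euc (n + 1)) (y : Euc n) : ℝ :=
  Real.sqrt (metric X y).det

/-- The second fundamental form `Aᵢⱼ = ⟨∂ᵢν, ∂ⱼX⟩`. -/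
def secondForm {n : ℕ} (X ν : Euc n → Euc (n + 1)) (y : Euc n) : Matrix (Fin n) (Fin n) ℝ :=
  Matrix.of fun i j => inner ℝ (pd i ν y) (pd j X y)

/-- The mean curvature `H = div ν = gⁱʲ Aᵢⱼ`. -/
def meanCurv {n : ℕ} (X ν : Euc n → Euc (n + 1)) (y : Euc n) : ℝ :=
  ((metric X y)⁻¹ * secondForm X ν y).trace

/-- `|A|² = gⁱᵏ gʲˡ Aᵢⱼ Aₖₗ`. -/
def normSqA {n : ℕ} (X ν : Euc n → Euc (n + 1)) (y : Euc n) : ℝ :=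
  ((metric X y)⁻¹ * secondForm X ν y * (metric X y)⁻¹ * (secondForm X ν y).transpose).trace

/-- The `i`-th component `gⁱʲ ∂ⱼf` of the gradient of `f`. -/
def gradComp {n : ℕ} (X : Euc n → Euc (n + 1)) (f : Euc n → ℝ) (i : Fin n) (y : Euc n) : ℝ :=
  ∑ j, (metric X y)⁻¹ i j * pd j f y

/-- The Laplace-Beltrami operator `Δf = (det g)^(-1/2) ∂ᵢ((det g)^(1/2) gⁱʲ ∂ⱼf)`. -/
def laplacian {n : ℕ} (X : Euc n → Euc (n + 1)) (f : Euc n → ℝ) (y : Euc n) : ℝ :=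
  (density X y)⁻¹ * ∑ i, pd i (fun z => density X z * gradComp X f i z) y

/-- The derivative of `f` along the tangential part of the position vector,
`∇_{xᵀ} f = ⟨x, ∇f⟩ = gⁱʲ ∂ⱼf ⟨X, ∂ᵢX⟩`. -/
def posDeriv {n : ℕ} (X : Euc n → Euc (n + 1)) (f : Euc n → ℝ) (y : Euc n) : ℝ :=
  ∑ i, gradComp X f i y * inner ℝ (X y) (pd i X y)

end Coord

section Hypersurface

variable {n : ℕ} {M : Type*} [TopologicalSpace M] [ChartedSpace (Euc n) M]

/-- `F : M → ℝⁿ⁺¹` is a smooth proper immersion of the `n`-manifold `M` (without boundary), and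
`N` is a smooth unit normal field along `F`. -/
structure IsTwoSidedProperImmersion (F N : M → Euc (n + 1)) : Prop where
  smooth : ContMDiff (𝓡 n) (𝓡 (n + 1)) ∞ F
  immersion : ∀ p : M, Function.Injective (mfderiv (𝓡 n) (𝓡 (n + 1)) F p)
  proper : IsProperMap F
  smooth_normal : ContMDiff (𝓡 n) (𝓡 (n + 1)) ∞ N
  unit_normal : ∀ p : M, ‖N p‖ = 1
  orthogonal : ∀ (p : M) (w : TangentSpace (𝓡 n) p),
    inner (E := Euc (n + 1)) ℝ (mfderiv (𝓡 n) (𝓡 (n + 1)) F p w) (N p) = 0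

/-- A function on `M` read in the preferred chart at `p`. -/
def inChart {V : Type*} (f : M → V) (p : M) : Euc n → V :=
  f ∘ (extChartAt (𝓡 n) p).symm

/-- The mean curvature of `F` with respect to `N`. -/
def meanCurvature (F N : M → Euc (n + 1)) (p : M) : ℝ :=
  Coord.meanCurv (inChart F p) (inChart N p) (extChartAt (𝓡 n) p p)

/-- The squared norm of the second fundamental form. -/
def normSqSecondForm (F N : M → Euc (n + 1)) (p : M) : ℝ :=
  Coord.normSqA (inChart F p) (inChart N p) (extChartAt (𝓡 n) p p)

/-- The Laplacian of the metric on `M` induced by `F`. -/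
def laplacian (F : M → Euc (n + 1)) (u : M → ℝ) (p : M) : ℝ :=
  Coord.laplacian (inChart F p) (inChart u p) (extChartAt (𝓡 n) p p)

/-- `∇_{xᵀ} u`. -/
def posDeriv (F : M → Euc (n + 1)) (u : M → ℝ) (p : M) : ℝ :=
  Coord.posDeriv (inChart F p) (inChart u p) (extChartAt (𝓡 n) p p)

/-- The Jacobi operator `L u = Δu - ½ ∇_{xᵀ} u + |A|² u + ½ u`. -/
def jacobi (F N : M → Euc (n + 1)) (u : M → ℝ) (p : M) : ℝ :=
  laplacian F u p - (1 / 2) * posDeriv F u p + normSqSecondForm F N p * u p + (1 / 2) * u p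

/-- The curvature condition `H = ⟨x, N⟩ / 2 + C`. -/
def CurvatureCondition (F N : M → Euc (n + 1)) (C : ℝ) : Prop :=
  ∀ p : M, meanCurvature F N p = inner ℝ (F p) (N p) / 2 + C

/-- Smooth functions with compact support. -/
def IsTest (u : M → ℝ) : Prop :=
  ContMDiff (𝓡 n) 𝓘(ℝ, ℝ) ∞ u ∧ HasCompactSupport u

variable [MeasurableSpace M]

/-- The area measure `√(det g) dy` of the domain of the preferred chart at `p`, as a measure
on `M` that vanishes outside this domain. -/
def chartArea (F : M → Euc (n + 1)) (p : M) : MeasureTheory.Measure M :=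
  MeasureTheory.Measure.map (extChartAt (𝓡 n) p).symm
    ((MeasureTheory.volume.restrict (extChartAt (𝓡 n) p).target).withDensity
      fun y => ENNReal.ofReal (Coord.density (inChart F p) y))

/-- The area measure of the metric induced by `F`. The measures `chartArea F p` agree on the
overlaps of the chart domains, so their supremum in the lattice of measures is the measure on `M`
that restricts to `chartArea F p` on the domain of each chart. -/
def area (F : M → Euc (n + 1)) : MeasureTheory.Measure M :=
  ⨆ p : M, chartArea F p

/-- The Gaussian area measure `e^{-|x|²/4} dA`. -/
def gaussArea (F : M → Euc (n + 1)) : MeasureTheory.Measure M :=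
  (area F).withDensity fun p => ENNReal.ofReal (Real.exp (-‖F p‖ ^ 2 / 4))

/-- The quadratic form `Q(u, v) = - ∫ u L v e^{-|x|²/4} dA`. -/
def Q (F N : M → Euc (n + 1)) (u v : M → ℝ) : ℝ :=
  -∫ p, u p * jacobi F N v p ∂(gaussArea F)

/-- `u` represents a compactly supported variation preserving the Gaussian volume. -/
def IsVolumePreserving (F : M → Euc (n + 1)) (u : M → ℝ) : Prop :=
  IsTest (n := n) u ∧ ∫ p, u p ∂(gaussArea F) = 0

/-- Stability for variations preserving the Gaussian volume. -/
def IsStable (F N : M → Euc (n + 1)) : Prop :=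
  ∀ u : M → ℝ, IsVolumePreserving F u → 0 ≤ Q F N u u

/-- `W` consists of volume preserving variations and `Q` is negative definite on `W`. -/
def IsNegative (F N : M → Euc (n + 1)) (W : Submodule ℝ (M → ℝ)) : Prop :=
  (∀ u ∈ W, IsVolumePreserving F u) ∧ ∀ u ∈ W, u ≠ 0 → Q F N u u < 0

/-- `Ind Q`: the maximal dimension of a space of volume preserving variations on which `Q` is
negative definite. -/
def index (F N : M → Euc (n + 1)) : ℕ∞ :=
  ⨆ (W : Submodule ℝ (M → ℝ)) (_ : IsNegative F N W), Cardinal.toENat (Module.rank ℝ W)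

end Hypersurface

/-- `F` maps `U` bijectively onto an affine hyperplane `{x | ⟨v, x⟩ = c}`, `v ≠ 0`. -/
def IsHyperplaneOn {n : ℕ} {M : Type*} (F : M → Euc (n + 1)) (U : Set M) : Prop :=
  Set.InjOn F U ∧ ∃ (v : Euc (n + 1)) (c : ℝ), v ≠ 0 ∧ F '' U = {x | inner ℝ v x = c}

end GaussIsop

end

/-! The instability comes from translations and from locally constant functions. For a fixed vector
e put f = ⟨N, e⟩. Differentiating H = ½⟨x, N⟩ + C and using equality of mixed partials (Codazzi in a
flat ambient space) gives Δf - ½∇_{xᵀ}f = -|A|²f, so Lf = ½f. For locally constant c and u = f + c,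
a formal integration by parts, applied on each component, kills ∫ c|A|²f and leaves Q(u,u) = -½∫u² -
∫c²|A|² ≤ -½∫u². Thus Q is formally negative definite on every finite-dimensional space of functions
⟨N, e⟩ + c. Truncation makes this rigorous (`Q_cutoff_le`): the weighted area is finite, properness
of F supplies compactly supported cutoffs, and the curvature terms are absorbed pointwise, so that
no integrability of |A|² is needed. The condition ∫u = 0 costs at most one dimension. Hence k
independent functions of this kind force k ≤ Ind Q + 1 (`card_le_index_add_one`).

The classification is then a count of independent functions. If Ind Q = 0, every such function is a
multiple of 1, so Σ is connected and N is constant. If Ind Q = 1 and Σ is disconnected, the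
indicators of two complementary clopen pieces already exhaust the two available dimensions, so each
piece is connected with constant normal. If Σ is connected and N is not constant, the image of N is
a connected subset of the sphere with more than one point; it cannot lie on a line, so 1 and two
components of N are independent and Ind Q is at least 2.

A connected piece with constant normal has constant height. Its projection to the hyperplane is a
proper local homeomorphism onto a simply connected space, hence a bijection
(`isHyperplaneOn_of_normal_eq`).

Conversely, on a hyperplane A = 0 and the weighted area is a multiple of e^{-|y|²/4}dy, so stability
is exactly the Gaussian Poincaré inequality ½∫f² ≤ ∫|∇f|² for functions of mean zero
(`gaussian_poincare`). It is proved by rotating the product of two copies of the measure. In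
particular a hyperplane has index 0, which excludes the remaining connected case of index 1. -/

noncomputable section

namespace GaussIsop

/-! ### Partial derivatives and the moving frame of a parametrized hypersurface. -/

namespace Coord

variable {n : ℕ}

section PartialDerivatives

variable {V : Type*} [NormedAddCommGroup V] [NormedSpace ℝ V]

lemma fderiv_apply_eq_sum_pd (f : Euc n → V) (y w : Euc n) :
    fderiv ℝ f y w = ∑ i, w i • pd i f y := by
  have hw : w = ∑ i, w i • EuclideanSpace.single i (1 : ℝ) := by
    ext k
    simp [Finset.sum_apply, Pi.single_apply]
  conv_lhs => rw [hw]
  simp [pd, map_sum]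

lemma pd_congr {f g : Euc n → V} {y : Euc n} (h : f =ᶠ[nhds y] g) (i : Fin n) :
    pd i f y = pd i g y := by
  rw [pd, pd, h.fderiv_eq]

lemma contDiffAt_pd {f : Euc n → V} {y : Euc n} (hf : ContDiffAt ℝ ∞ f y) (i : Fin n) :
    ContDiffAt ℝ ∞ (pd i f) y :=
  (hf.fderiv_right (m := ∞) (by simp)).clm_apply contDiffAt_const

lemma pd_pd_eq {f : Euc n → V} {y : Euc n} (hf : ContDiffAt ℝ ∞ f y) (i j : Fin n) :
    pd i (pd j f) y =
      fderiv ℝ (fderiv ℝ f) y (EuclideanSpace.single i 1) (EuclideanSpace.single j 1) := by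
  have hd : DifferentiableAt ℝ (fderiv ℝ f) y :=
    (hf.fderiv_right (m := ∞) (by simp)).differentiableAt (by simp)
  unfold pd
  rw [fderiv_clm_apply hd (by fun_prop)]
  simp

lemma pd_comm {f : Euc n → V} {y : Euc n} (hf : ContDiffAt ℝ ∞ f y) (i j : Fin n) :
    pd i (pd j f) y = pd j (pd i f) y := by
  rw [pd_pd_eq hf, pd_pd_eq hf]
  exact (hf.isSymmSndFDerivAt (by simpa using WithTop.coe_le_coe.mpr (le_top : (2 : ℕ∞) ≤ ⊤))).eq _ _

lemma pd_const (c : V) (i : Fin n) (y : Euc n) : pd i (fun _ => c) y = 0 := by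
  simp [pd]

lemma pd_add {f g : Euc n → V} {y : Euc n} (hf : DifferentiableAt ℝ f y)
    (hg : DifferentiableAt ℝ g y) (i : Fin n) :
    pd i (fun z => f z + g z) y = pd i f y + pd i g y := by
  rw [pd, fderiv_fun_add hf hg]; rfl

lemma pd_sum {ι : Type*} (s : Finset ι) {f : ι → Euc n → V} {y : Euc n}
    (hf : ∀ k ∈ s, DifferentiableAt ℝ (f k) y) (i : Fin n) :
    pd i (fun z => ∑ k ∈ s, f k z) y = ∑ k ∈ s, pd i (f k) y := by
  rw [pd, fderiv_fun_sum hf]; simp [pd]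

lemma pd_smul {c : Euc n → ℝ} {f : Euc n → V} {y : Euc n} (hc : DifferentiableAt ℝ c y)
    (hf : DifferentiableAt ℝ f y) (i : Fin n) :
    pd i (fun z => c z • f z) y = c y • pd i f y + pd i c y • f y := by
  rw [pd, fderiv_fun_smul hc hf]; simp [pd]

lemma pd_mul {f g : Euc n → ℝ} {y : Euc n} (hf : DifferentiableAt ℝ f y)
    (hg : DifferentiableAt ℝ g y) (i : Fin n) :
    pd i (fun z => f z * g z) y = pd i f y * g y + f y * pd i g y := by
  rw [pd, fderiv_fun_mul hf hg]; simp [pd]; ring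

lemma pd_inner {m : ℕ} {f g : Euc n → Euc m} {y : Euc n} (hf : DifferentiableAt ℝ f y)
    (hg : DifferentiableAt ℝ g y) (i : Fin n) :
    pd i (fun z => inner ℝ (f z) (g z)) y =
      inner ℝ (pd i f y) (g y) + inner ℝ (f y) (pd i g y) := by
  rw [pd, fderiv_inner_apply ℝ hf hg]; simp [pd]; ring

lemma pd_apply {m : ℕ} {f : Euc n → Euc m} {y : Euc n} (hf : DifferentiableAt ℝ f y)
    (i : Fin n) (a : Fin m) : pd i (fun z => f z a) y = pd i f y a := by
  have h := ((EuclideanSpace.proj a : Euc m →L[ℝ] ℝ).hasFDerivAt.comp y hf.hasFDerivAt).fderiv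
  have h2 : (fun z => f z a) = (EuclideanSpace.proj a : Euc m →L[ℝ] ℝ) ∘ f := rfl
  rw [pd, h2, h]; rfl

end PartialDerivatives

/-- `X` parametrizes a smooth hypersurface over the open set `Ω`, with unit normal `ν`. -/
structure IsHypersurfaceOn (X ν : Euc n → Euc (n + 1)) (Ω : Set (Euc n)) : Prop where
  isOpen : IsOpen Ω
  smooth : ContDiffOn ℝ ∞ X Ω
  smooth_normal : ContDiffOn ℝ ∞ ν Ω
  injective : ∀ y ∈ Ω, Function.Injective (fderiv ℝ X y)
  unit : ∀ y ∈ Ω, ‖ν y‖ = 1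
  orthogonal : ∀ y ∈ Ω, ∀ w, inner ℝ (fderiv ℝ X y w) (ν y) = 0

/-- The frame `gⁱʲ ∂ⱼX` dual to `∂ᵢX`. -/
def dualFrame (X : Euc n → Euc (n + 1)) (i : Fin n) (y : Euc n) : Euc (n + 1) :=
  ∑ j, (metric X y)⁻¹ i j • pd j X y

/-- The gradient of `f`, as a vector of the ambient space. -/
def grad (X : Euc n → Euc (n + 1)) (f : Euc n → ℝ) (y : Euc n) : Euc (n + 1) :=
  ∑ i, gradComp X f i y • pd i X y

lemma metric_isSymm (X : Euc n → Euc (n + 1)) (y : Euc n) (i j : Fin n) :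
    metric X y i j = metric X y j i := by
  simp [metric, real_inner_comm]

lemma metric_inv_symm (X : Euc n → Euc (n + 1)) (y : Euc n) (i j : Fin n) :
    (metric X y)⁻¹ i j = (metric X y)⁻¹ j i := by
  have h : (metric X y).transpose = metric X y := by
    ext i j; exact metric_isSymm X y j i
  conv_lhs => rw [← h, ← Matrix.transpose_nonsing_inv]
  rfl

lemma grad_eq_sum_dualFrame (X : Euc n → Euc (n + 1)) (f : Euc n → ℝ) (y : Euc n) :
    grad X f y = ∑ j, pd j f y • dualFrame X j y := by
  simp only [grad, gradComp, dualFrame, Finset.sum_smul, Finset.smul_sum, smul_smul]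
  rw [Finset.sum_comm]
  refine Finset.sum_congr rfl fun j _ => Finset.sum_congr rfl fun i _ => ?_
  rw [metric_inv_symm, mul_comm]

section Pointwise

variable {X : Euc n → Euc (n + 1)} {y : Euc n}

lemma linearIndependent_pd (h : Function.Injective (fderiv ℝ X y)) :
    LinearIndependent ℝ (fun i => pd i X y) := by
  have h1 : LinearIndependent ℝ (fun i : Fin n => EuclideanSpace.single i (1 : ℝ)) := by
    have := (EuclideanSpace.basisFun (Fin n) ℝ).toBasis.linearIndependent
    have hb : (fun i : Fin n => EuclideanSpace.single i (1 : ℝ)) =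
        (EuclideanSpace.basisFun (Fin n) ℝ) := by ext1 i; simp
    rw [hb]; simpa using this
  exact h1.map' (fderiv ℝ X y).toLinearMap (LinearMap.ker_eq_bot.mpr h)

lemma metric_posDef (h : Function.Injective (fderiv ℝ X y)) : (metric X y).PosDef :=
  Matrix.posDef_gram_of_linearIndependent (linearIndependent_pd h)

lemma metric_det_pos (h : Function.Injective (fderiv ℝ X y)) : 0 < (metric X y).det :=
  (metric_posDef h).det_pos

lemma density_pos (h : Function.Injective (fderiv ℝ X y)) : 0 < density X y :=
  Real.sqrt_pos.mpr (metric_det_pos h)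

lemma inv_mul_metric (h : Function.Injective (fderiv ℝ X y)) :
    (metric X y)⁻¹ * metric X y = 1 :=
  Matrix.nonsing_inv_mul _ (metric_det_pos h).ne'.isUnit

lemma inner_dualFrame_pd (h : Function.Injective (fderiv ℝ X y)) (i k : Fin n) :
    inner ℝ (dualFrame X i y) (pd k X y) = if i = k then 1 else 0 := by
  have := congrFun (congrFun (inv_mul_metric h) i) k
  rw [Matrix.mul_apply, Matrix.one_apply] at this
  rw [← this, dualFrame, sum_inner]
  simp [metric, real_inner_smul_left]

lemma inner_grad_pd (h : Function.Injective (fderiv ℝ X y)) (f : Euc n → ℝ) (k : Fin n) :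
    inner ℝ (grad X f y) (pd k X y) = pd k f y := by
  simp [grad_eq_sum_dualFrame, sum_inner, real_inner_smul_left, inner_dualFrame_pd h]

lemma inner_grad_fderiv (h : Function.Injective (fderiv ℝ X y)) (f : Euc n → ℝ) (w : Euc n) :
    inner ℝ (grad X f y) (fderiv ℝ X y w) = fderiv ℝ f y w := by
  simp [fderiv_apply_eq_sum_pd, inner_sum, real_inner_smul_right, inner_grad_pd h]

variable {e : Euc (n + 1)}

lemma inner_dualFrame_normal (ho : ∀ w, inner ℝ (fderiv ℝ X y w) e = 0) (i : Fin n) :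
    inner ℝ (dualFrame X i y) e = 0 := by
  have : ∀ j, inner ℝ (pd j X y) e = 0 := fun j => ho _
  simp [dualFrame, sum_inner, real_inner_smul_left, this]

lemma inner_grad_normal (ho : ∀ w, inner ℝ (fderiv ℝ X y w) e = 0) (f : Euc n → ℝ) :
    inner ℝ (grad X f y) e = 0 := by
  simp [grad_eq_sum_dualFrame, sum_inner, real_inner_smul_left, inner_dualFrame_normal ho]

end Pointwise

/-- The range of L has codimension one, so its orthogonal complement is the line through e. The
vector z lies on this line and is orthogonal to e. -/
lemma eq_zero_of_orthogonal {L : Euc n →L[ℝ] Euc (n + 1)} (hL : Function.Injective L)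
    {e : Euc (n + 1)} (he : ‖e‖ = 1) (ho : ∀ w, inner ℝ (L w) e = 0)
    {z : Euc (n + 1)} (hz : ∀ w, inner ℝ z (L w) = 0) (hze : inner ℝ z e = 0) : z = 0 := by
  set S := LinearMap.range L.toLinearMap
  have hS : Module.finrank ℝ S = n := by
    rw [LinearMap.finrank_range_of_inj hL]; simp
  have h1 : Module.finrank ℝ Sᗮ = 1 := by
    have := S.finrank_add_finrank_orthogonal
    rw [hS] at this
    simp at this; omega
  have heS : e ∈ Sᗮ := by
    rw [Submodule.mem_orthogonal]
    rintro _ ⟨w, rfl⟩; exact ho w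
  have hzS : z ∈ Sᗮ := by
    rw [Submodule.mem_orthogonal]
    rintro _ ⟨w, rfl⟩; rw [real_inner_comm]; exact hz w
  have he0 : (⟨e, heS⟩ : Sᗮ) ≠ 0 := by
    intro h
    have : e = 0 := congrArg Subtype.val h
    simp [this] at he
  obtain ⟨c, hc⟩ := (finrank_eq_one_iff_of_nonzero' _ he0).mp h1 ⟨z, hzS⟩
  have hc' : c • e = z := congrArg Subtype.val hc
  rw [← hc', real_inner_smul_left, real_inner_self_eq_norm_sq, he] at hze
  have : c = 0 := by simpa using hze
  rw [← hc', this, zero_smul]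

namespace IsHypersurfaceOn

variable {X ν : Euc n → Euc (n + 1)} {Ω : Set (Euc n)} {y : Euc n}

lemma contDiffAt (h : IsHypersurfaceOn X ν Ω) (hy : y ∈ Ω) : ContDiffAt ℝ ∞ X y :=
  h.smooth.contDiffAt (h.isOpen.mem_nhds hy)

lemma contDiffAt_normal (h : IsHypersurfaceOn X ν Ω) (hy : y ∈ Ω) : ContDiffAt ℝ ∞ ν y :=
  h.smooth_normal.contDiffAt (h.isOpen.mem_nhds hy)

/-- A vector is determined by its products with `∂ᵢX` and `ν`. -/
lemma ext_inner (h : IsHypersurfaceOn X ν Ω) (hy : y ∈ Ω) {z w : Euc (n + 1)}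
    (hX : ∀ i, inner ℝ z (pd i X y) = inner ℝ w (pd i X y))
    (hν : inner ℝ z (ν y) = inner ℝ w (ν y)) : z = w := by
  refine sub_eq_zero.mp (eq_zero_of_orthogonal (h.injective y hy) (h.unit y hy)
    (h.orthogonal y hy) (fun v => ?_) ?_)
  · rw [fderiv_apply_eq_sum_pd, inner_sum]
    refine Finset.sum_eq_zero fun i _ => ?_
    rw [real_inner_smul_right, inner_sub_left, hX, sub_self, mul_zero]
  · rw [inner_sub_left, hν, sub_self]

lemma expand_dualFrame (h : IsHypersurfaceOn X ν Ω) (hy : y ∈ Ω) (z : Euc (n + 1)) :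
    z = ∑ i, inner ℝ z (pd i X y) • dualFrame X i y + inner ℝ z (ν y) • ν y := by
  have hp : ∀ j, inner ℝ (ν y) (pd j X y) = 0 := fun j => by
    rw [real_inner_comm]; exact h.orthogonal y hy _
  refine h.ext_inner hy (fun k => ?_) ?_
  · rw [inner_add_left, sum_inner]
    simp [real_inner_smul_left, inner_dualFrame_pd (h.injective y hy), hp]
  · rw [inner_add_left, sum_inner]
    simp [real_inner_smul_left, inner_dualFrame_normal (h.orthogonal y hy), h.unit y hy]

lemma inner_eq_sum (h : IsHypersurfaceOn X ν Ω) (hy : y ∈ Ω) (z w : Euc (n + 1)) :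
    inner ℝ z w = ∑ i, inner ℝ z (pd i X y) * inner ℝ (dualFrame X i y) w +
      inner ℝ z (ν y) * inner ℝ (ν y) w := by
  conv_lhs => rw [h.expand_dualFrame hy z]
  simp [inner_add_left, sum_inner, real_inner_smul_left]

lemma inner_pd_normal (h : IsHypersurfaceOn X ν Ω) (hy : y ∈ Ω) (i : Fin n) :
    inner ℝ (pd i X y) (ν y) = 0 := h.orthogonal y hy _

lemma pd_normal_inner (h : IsHypersurfaceOn X ν Ω) (hy : y ∈ Ω) (i : Fin n) :
    inner ℝ (pd i ν y) (ν y) = 0 := by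
  have hd := (h.contDiffAt_normal hy).differentiableAt (by simp)
  have h1 : pd i (fun z => inner ℝ (ν z) (ν z)) y = 0 := by
    rw [pd_congr (g := fun _ => (1 : ℝ)), pd_const]
    filter_upwards [h.isOpen.mem_nhds hy] with z hz
    rw [real_inner_self_eq_norm_sq, h.unit z hz]; norm_num
  rw [pd_inner hd hd, real_inner_comm (pd i ν y)] at h1
  linarith

/-- Differentiate ⟨ν, ∂ⱼX⟩ = 0. The right-hand side makes the symmetry of the second fundamental
form a case of equality of mixed partials of X. -/
lemma pd_normal_inner_pd (h : IsHypersurfaceOn X ν Ω) (hy : y ∈ Ω) (i j : Fin n) :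
    inner ℝ (pd i ν y) (pd j X y) = - inner ℝ (ν y) (pd i (pd j X) y) := by
  have hd := (h.contDiffAt_normal hy).differentiableAt (by simp)
  have h1 : pd i (fun z => inner ℝ (ν z) (pd j X z)) y = 0 := by
    rw [pd_congr (g := fun _ => (0 : ℝ)), pd_const]
    filter_upwards [h.isOpen.mem_nhds hy] with z hz
    rw [real_inner_comm, h.inner_pd_normal hz]
  rw [pd_inner hd ((contDiffAt_pd (h.contDiffAt hy) j).differentiableAt (by simp))] at h1
  linarith

lemma secondForm_symm (h : IsHypersurfaceOn X ν Ω) (hy : y ∈ Ω) (i j : Fin n) :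
    inner ℝ (pd i ν y) (pd j X y) = inner ℝ (pd j ν y) (pd i X y) := by
  rw [h.pd_normal_inner_pd hy, h.pd_normal_inner_pd hy, pd_comm (h.contDiffAt hy)]

end IsHypersurfaceOn

end Coord

/-! ### Derivatives of the area density and the dual frame; the Laplacian as a divergence. -/

namespace Coord

variable {n : ℕ}

section Determinant

variable {m : Euc n → Matrix (Fin n) (Fin n) ℝ} {y : Euc n}

lemma contDiffAt_det (hm : ∀ i j, ContDiffAt ℝ ∞ (fun z => m z i j) y) :
    ContDiffAt ℝ ∞ (fun z => (m z).det) y := by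
  simp only [Matrix.det_apply']
  exact ContDiffAt.sum fun σ _ => contDiffAt_const.mul (contDiffAt_prod fun i _ => hm _ _)

lemma contDiffAt_inv_apply (hm : ∀ i j, ContDiffAt ℝ ∞ (fun z => m z i j) y)
    (h0 : (m y).det ≠ 0) (i j : Fin n) : ContDiffAt ℝ ∞ (fun z => (m z)⁻¹ i j) y := by
  simp only [Matrix.inv_def, Matrix.smul_apply, smul_eq_mul, Ring.inverse_eq_inv',
    Matrix.adjugate_apply]
  refine (((contDiffAt_det hm).inv h0)).mul (contDiffAt_det fun k l => ?_)
  by_cases hk : k = j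
  · subst hk; simpa using contDiffAt_const
  · simpa [Matrix.updateRow_ne hk] using hm k l

/-- Jacobi's formula for the derivative of a determinant. -/
lemma pd_det (hm : ∀ i j, DifferentiableAt ℝ (fun z => m z i j) y) (h0 : (m y).det ≠ 0)
    (i : Fin n) : pd i (fun z => (m z).det) y =
      (m y).det * ∑ j, ∑ k, (m y)⁻¹ j k * pd i (fun z => m z k j) y := by
  have hprod : ∀ σ : Equiv.Perm (Fin n), HasFDerivAt (fun z => ∏ k, m z (σ k) k)
      (∑ k, (∏ j ∈ Finset.univ.erase k, m y (σ j) j) • fderiv ℝ (fun z => m z (σ k) k) y) y :=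
    fun σ => HasFDerivAt.finsetProd fun k _ => (hm _ _).hasFDerivAt
  have hdet : HasFDerivAt (fun z => (m z).det) (∑ σ : Equiv.Perm (Fin n),
      ((Equiv.Perm.sign σ : ℤ) : ℝ) • ∑ k, (∏ j ∈ Finset.univ.erase k, m y (σ j) j) •
        fderiv ℝ (fun z => m z (σ k) k) y) y := by
    simp only [Matrix.det_apply']
    exact HasFDerivAt.fun_sum fun σ _ => (hprod σ).const_mul _
  -- The derivative of a determinant is the sum, over the columns, of the determinants with that one
  -- column differentiated. Cramer's rule then expresses each of them through the adjugate.
  have hcol : ∀ k, ((m y).updateCol k fun l => pd i (fun z => m z l k) y).det =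
      ∑ σ : Equiv.Perm (Fin n), ((Equiv.Perm.sign σ : ℤ) : ℝ) *
        ((∏ j ∈ Finset.univ.erase k, m y (σ j) j) * pd i (fun z => m z (σ k) k) y) := by
    intro k
    rw [Matrix.det_apply']
    refine Finset.sum_congr rfl fun σ _ => ?_
    rw [← Finset.prod_erase_mul _ _ (Finset.mem_univ k)]
    congr 2
    · refine Finset.prod_congr rfl fun j hj => ?_
      rw [Matrix.updateCol_ne (Finset.ne_of_mem_erase hj)]
    · simp
  have h1 : pd i (fun z => (m z).det) y =
      ∑ k, ((m y).updateCol k fun l => pd i (fun z => m z l k) y).det := by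
    rw [pd, hdet.fderiv]
    simp only [hcol, sum_apply, smul_apply, smul_eq_mul,
      Finset.mul_sum]
    rw [Finset.sum_comm]
    rfl
  rw [h1, Finset.mul_sum]
  refine Finset.sum_congr rfl fun k _ => ?_
  rw [← Matrix.cramer_apply, Matrix.cramer_eq_adjugate_mulVec, Matrix.mulVec, dotProduct,
    Finset.mul_sum]
  refine Finset.sum_congr rfl fun l _ => ?_
  rw [Matrix.inv_def, Matrix.smul_apply, smul_eq_mul, Ring.inverse_eq_inv']
  field_simp

end Determinant

namespace IsHypersurfaceOn

variable {X ν : Euc n → Euc (n + 1)} {Ω : Set (Euc n)} {y : Euc n}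

lemma contDiffAt_metric (h : IsHypersurfaceOn X ν Ω) (hy : y ∈ Ω) (i j : Fin n) :
    ContDiffAt ℝ ∞ (fun z => metric X z i j) y :=
  (contDiffAt_pd (h.contDiffAt hy) i).inner ℝ (contDiffAt_pd (h.contDiffAt hy) j)

lemma contDiffAt_metric_inv (h : IsHypersurfaceOn X ν Ω) (hy : y ∈ Ω) (i j : Fin n) :
    ContDiffAt ℝ ∞ (fun z => (metric X z)⁻¹ i j) y :=
  contDiffAt_inv_apply (h.contDiffAt_metric hy) (metric_det_pos (h.injective y hy)).ne' i j

lemma contDiffAt_density (h : IsHypersurfaceOn X ν Ω) (hy : y ∈ Ω) :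
    ContDiffAt ℝ ∞ (density X) y :=
  (contDiffAt_det (h.contDiffAt_metric hy)).sqrt (metric_det_pos (h.injective y hy)).ne'

lemma contDiffAt_dualFrame (h : IsHypersurfaceOn X ν Ω) (hy : y ∈ Ω) (i : Fin n) :
    ContDiffAt ℝ ∞ (dualFrame X i) y :=
  ContDiffAt.sum fun j _ =>
    (h.contDiffAt_metric_inv hy i j).smul (contDiffAt_pd (h.contDiffAt hy) j)

lemma contDiffAt_gradComp (h : IsHypersurfaceOn X ν Ω) (hy : y ∈ Ω) {f : Euc n → ℝ}
    (hf : ContDiffAt ℝ ∞ f y) (i : Fin n) : ContDiffAt ℝ ∞ (gradComp X f i) y :=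
  ContDiffAt.sum fun j _ => (h.contDiffAt_metric_inv hy i j).mul (contDiffAt_pd hf j)

lemma contDiffAt_grad (h : IsHypersurfaceOn X ν Ω) (hy : y ∈ Ω) {f : Euc n → ℝ}
    (hf : ContDiffAt ℝ ∞ f y) : ContDiffAt ℝ ∞ (grad X f) y :=
  ContDiffAt.sum fun i _ => (h.contDiffAt_gradComp hy hf i).smul (contDiffAt_pd (h.contDiffAt hy) i)

/-- Jacobi's formula gives ∂ᵢ√g = ½√g gʲᵏ∂ᵢgⱼₖ. The two terms of the product rule for ∂ᵢgⱼₖ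
contribute equally because the inverse metric is symmetric. -/
lemma pd_density (h : IsHypersurfaceOn X ν Ω) (hy : y ∈ Ω) (i : Fin n) :
    pd i (density X) y =
      density X y * ∑ j, inner ℝ (dualFrame X j y) (pd i (pd j X) y) := by
  have hpos := metric_det_pos (h.injective y hy)
  have hdp : ∀ j, DifferentiableAt ℝ (pd j X) y := fun j =>
    (contDiffAt_pd (h.contDiffAt hy) j).differentiableAt (by simp)
  have hd : DifferentiableAt ℝ (fun z => (metric X z).det) y :=
    (contDiffAt_det (h.contDiffAt_metric hy)).differentiableAt (by simp)
  have h1 : pd i (density X) y =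
      (1 / (2 * density X y)) * pd i (fun z => (metric X z).det) y := by
    have : density X = fun z => Real.sqrt (metric X z).det := rfl
    rw [pd, this, fderiv_sqrt hd hpos.ne']
    simp [pd]
  have hm : ∀ j k, pd i (fun z => metric X z k j) y =
      inner ℝ (pd i (pd k X) y) (pd j X y) + inner ℝ (pd k X y) (pd i (pd j X) y) :=
    fun j k => pd_inner (hdp k) (hdp j) i
  have h2 : ∑ j, ∑ k, (metric X y)⁻¹ j k * pd i (fun z => metric X z k j) y =
      2 * ∑ j, inner ℝ (dualFrame X j y) (pd i (pd j X) y) := by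
    simp only [hm, mul_add, Finset.sum_add_distrib]
    have e2 : ∑ j, ∑ k, (metric X y)⁻¹ j k * inner ℝ (pd k X y) (pd i (pd j X) y) =
        ∑ j, inner ℝ (dualFrame X j y) (pd i (pd j X) y) := by
      simp [dualFrame, sum_inner, real_inner_smul_left]
    have e1 : ∑ j, ∑ k, (metric X y)⁻¹ j k * inner ℝ (pd i (pd k X) y) (pd j X y) =
        ∑ j, inner ℝ (dualFrame X j y) (pd i (pd j X) y) := by
      rw [← e2, Finset.sum_comm]
      refine Finset.sum_congr rfl fun j _ => Finset.sum_congr rfl fun k _ => ?_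
      rw [metric_inv_symm, real_inner_comm]
    rw [e1, e2]; ring
  have hdet : (metric X y).det = density X y ^ 2 := (Real.sq_sqrt hpos.le).symm
  have hden := (density_pos (h.injective y hy)).ne'
  rw [h1, pd_det (fun j k => (h.contDiffAt_metric hy j k).differentiableAt (by simp)) hpos.ne', h2,
    hdet]
  field_simp

/-- Differentiating the relations between the dual frame and ∂ₖX and ν yields all components of the
derivative, which `expand_dualFrame` reassembles. The inverse metric itself is never differentiated
explicitly. -/
lemma pd_dualFrame (h : IsHypersurfaceOn X ν Ω) (hy : y ∈ Ω) (i j : Fin n) :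
    pd i (dualFrame X j) y =
      -(∑ k, inner ℝ (dualFrame X j y) (pd i (pd k X) y) • dualFrame X k y) -
        inner ℝ (dualFrame X j y) (pd i ν y) • ν y := by
  have hE : DifferentiableAt ℝ (dualFrame X j) y :=
    (h.contDiffAt_dualFrame hy j).differentiableAt (by simp)
  have hdp : ∀ j, DifferentiableAt ℝ (pd j X) y := fun j =>
    (contDiffAt_pd (h.contDiffAt hy) j).differentiableAt (by simp)
  have hν : DifferentiableAt ℝ ν y := (h.contDiffAt_normal hy).differentiableAt (by simp)
  have h1 : ∀ k, inner ℝ (pd i (dualFrame X j) y) (pd k X y) =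
      -inner ℝ (dualFrame X j y) (pd i (pd k X) y) := by
    intro k
    have h0 : pd i (fun z => inner ℝ (dualFrame X j z) (pd k X z)) y = 0 := by
      rw [pd_congr (g := fun _ => (if j = k then 1 else 0 : ℝ)), pd_const]
      filter_upwards [h.isOpen.mem_nhds hy] with z hz using inner_dualFrame_pd (h.injective z hz) j k
    rw [pd_inner hE (hdp k)] at h0
    linarith
  have h2 : inner ℝ (pd i (dualFrame X j) y) (ν y) = -inner ℝ (dualFrame X j y) (pd i ν y) := by
    have h0 : pd i (fun z => inner ℝ (dualFrame X j z) (ν z)) y = 0 := by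
      rw [pd_congr (g := fun _ => (0 : ℝ)), pd_const]
      filter_upwards [h.isOpen.mem_nhds hy] with z hz
        using inner_dualFrame_normal (h.orthogonal z hz) j
    rw [pd_inner hE hν] at h0
    linarith
  rw [h.expand_dualFrame hy (pd i (dualFrame X j) y), h2]
  simp only [h1, neg_smul, Finset.sum_neg_distrib, sub_eq_add_neg]

lemma gradComp_eq_inner (h : IsHypersurfaceOn X ν Ω) (hy : y ∈ Ω) (f : Euc n → ℝ) (i : Fin n) :
    gradComp X f i y = inner ℝ (dualFrame X i y) (grad X f y) := by
  simp only [gradComp, dualFrame, sum_inner, real_inner_smul_left]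
  refine Finset.sum_congr rfl fun j _ => ?_
  rw [real_inner_comm, inner_grad_pd (h.injective y hy)]

/-- The Laplacian is the divergence of the gradient. -/
lemma laplacian_eq_sum (h : IsHypersurfaceOn X ν Ω) (hy : y ∈ Ω) {f : Euc n → ℝ}
    (hf : ContDiffAt ℝ ∞ f y) :
    laplacian X f y = ∑ i, inner ℝ (dualFrame X i y) (pd i (grad X f) y) := by
  have hE : ∀ j, DifferentiableAt ℝ (dualFrame X j) y := fun j =>
    (h.contDiffAt_dualFrame hy j).differentiableAt (by simp)
  have hZ : DifferentiableAt ℝ (grad X f) y := (h.contDiffAt_grad hy hf).differentiableAt (by simp)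
  have hD : DifferentiableAt ℝ (density X) y := (h.contDiffAt_density hy).differentiableAt (by simp)
  have hZν : inner ℝ (ν y) (grad X f y) = 0 := by
    rw [real_inner_comm]; exact inner_grad_normal (h.orthogonal y hy) f
  have hden := (density_pos (h.injective y hy)).ne'
  have h1 : ∀ i, pd i (fun z => density X z * gradComp X f i z) y =
      density X y * ((∑ j, inner ℝ (dualFrame X j y) (pd i (pd j X) y)) *
          inner ℝ (dualFrame X i y) (grad X f y) -
        (∑ k, inner ℝ (dualFrame X i y) (pd k (pd i X) y) *
          inner ℝ (dualFrame X k y) (grad X f y)) +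
        inner ℝ (dualFrame X i y) (pd i (grad X f) y)) := by
    intro i
    have e1 : (fun z => density X z * gradComp X f i z) =ᶠ[nhds y]
        fun z => density X z * inner ℝ (dualFrame X i z) (grad X f z) := by
      filter_upwards [h.isOpen.mem_nhds hy] with z hz
      rw [h.gradComp_eq_inner hz]
    rw [pd_congr e1, pd_mul hD ((hE i).inner ℝ hZ), pd_inner (hE i) hZ, h.pd_density hy,
      h.pd_dualFrame hy, inner_sub_left, inner_neg_left, sum_inner]
    simp only [real_inner_smul_left, hZν, pd_comm (h.contDiffAt hy) i]
    ring
  rw [laplacian, Finset.sum_congr rfl fun i _ => h1 i, ← Finset.mul_sum, inv_mul_cancel_left₀ hden,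
    Finset.sum_add_distrib, Finset.sum_sub_distrib]
  -- The second derivatives of X coming from the density and from the dual frame cancel after
  -- renaming indices.
  have : ∑ i, (∑ j, inner ℝ (dualFrame X j y) (pd i (pd j X) y)) *
      inner ℝ (dualFrame X i y) (grad X f y) = ∑ i, ∑ k,
      inner ℝ (dualFrame X i y) (pd k (pd i X) y) * inner ℝ (dualFrame X k y) (grad X f y) := by
    simp only [Finset.sum_mul]
    rw [Finset.sum_comm]
  rw [this]; ring

end IsHypersurfaceOn

end Coord

/-! ### Curvature, and the drift Laplacian of the components of the normal. -/

namespace Coord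

variable {n : ℕ}

lemma posDeriv_eq_inner (X : Euc n → Euc (n + 1)) (f : Euc n → ℝ) (y : Euc n) :
    posDeriv X f y = inner ℝ (X y) (grad X f y) := by
  simp [posDeriv, grad, inner_sum, real_inner_smul_right]

/-- The divergence of an ambient vector field in terms of the gradients of its coordinates. -/
lemma sum_grad_apply (X : Euc n → Euc (n + 1)) {Z : Euc n → Euc (n + 1)} {y : Euc n}
    (hZ : DifferentiableAt ℝ Z y) :
    ∑ a, grad X (fun z => Z z a) y a = ∑ i, inner ℝ (dualFrame X i y) (pd i Z y) := by
  simp only [grad_eq_sum_dualFrame, pd_apply hZ, PiLp.inner_apply, WithLp.ofLp_sum,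
    Finset.sum_apply, WithLp.ofLp_smul, Pi.smul_apply, smul_eq_mul, RCLike.inner_apply,
    conj_trivial]
  rw [Finset.sum_comm]

lemma meanCurv_eq_sum (X ν : Euc n → Euc (n + 1)) (y : Euc n) :
    meanCurv X ν y = ∑ i, inner ℝ (dualFrame X i y) (pd i ν y) := by
  simp only [meanCurv, Matrix.trace, Matrix.diag, Matrix.mul_apply, secondForm, Matrix.of_apply,
    dualFrame, sum_inner, real_inner_smul_left]
  rw [Finset.sum_comm]
  refine Finset.sum_congr rfl fun j _ => Finset.sum_congr rfl fun i _ => ?_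
  rw [metric_inv_symm, real_inner_comm]

namespace IsHypersurfaceOn

variable {X ν : Euc n → Euc (n + 1)} {Ω : Set (Euc n)} {y : Euc n}

lemma inv_metric_mul_secondForm (h : IsHypersurfaceOn X ν Ω) (hy : y ∈ Ω) (i j : Fin n) :
    ((metric X y)⁻¹ * secondForm X ν y) i j = inner ℝ (dualFrame X i y) (pd j ν y) := by
  simp only [Matrix.mul_apply, secondForm, Matrix.of_apply, dualFrame, sum_inner,
    real_inner_smul_left]
  refine Finset.sum_congr rfl fun k _ => ?_
  rw [h.secondForm_symm hy, real_inner_comm]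

lemma normSqA_eq_sum (h : IsHypersurfaceOn X ν Ω) (hy : y ∈ Ω) :
    normSqA X ν y = ∑ i, ∑ j,
      inner ℝ (dualFrame X i y) (pd j ν y) * inner ℝ (dualFrame X j y) (pd i ν y) := by
  have hs : (secondForm X ν y).transpose = secondForm X ν y := by
    ext i j
    exact h.secondForm_symm hy j i
  rw [normSqA, hs, Matrix.mul_assoc, Matrix.trace]
  refine Finset.sum_congr rfl fun i _ => ?_
  rw [Matrix.diag, Matrix.mul_apply]
  refine Finset.sum_congr rfl fun j _ => ?_
  rw [h.inv_metric_mul_secondForm hy, h.inv_metric_mul_secondForm hy]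

lemma pd_inner_normal (h : IsHypersurfaceOn X ν Ω) (hy : y ∈ Ω) (e : Euc (n + 1)) (i : Fin n) :
    pd i (fun z => inner ℝ (ν z) e) y = inner ℝ (pd i ν y) e := by
  rw [pd_inner ((h.contDiffAt_normal hy).differentiableAt (by simp)) (by fun_prop), pd_const]
  simp

/-- The gradient of `⟨ν, e⟩` is the shape operator applied to the tangential part of `e`. -/
lemma grad_inner_normal (h : IsHypersurfaceOn X ν Ω) (hy : y ∈ Ω) (e : Euc (n + 1)) :
    grad X (fun z => inner ℝ (ν z) e) y = ∑ j, inner ℝ (dualFrame X j y) e • pd j ν y := by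
  refine h.ext_inner hy (fun i => ?_) ?_
  · rw [inner_grad_pd (h.injective y hy), h.pd_inner_normal hy, h.inner_eq_sum hy (pd i ν y) e,
      h.pd_normal_inner hy, sum_inner, zero_mul, add_zero]
    refine Finset.sum_congr rfl fun j _ => ?_
    rw [real_inner_smul_left, h.secondForm_symm hy i j, mul_comm]
  · rw [inner_grad_normal (h.orthogonal y hy), sum_inner]
    simp [real_inner_smul_left, h.pd_normal_inner hy]

/-- The gradient of the a-th component of ν is the shape operator applied to the tangential part of
the a-th basis vector; summing the squares over an orthonormal basis of the ambient space gives its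
squared norm. This form is visibly nonnegative and leads to a chart-free expression. -/
lemma normSqA_eq_sum_norm_sq (h : IsHypersurfaceOn X ν Ω) (hy : y ∈ Ω) :
    normSqA X ν y = ∑ a, ‖grad X (fun z => ν z a) y‖ ^ 2 := by
  have hν : DifferentiableAt ℝ ν y := (h.contDiffAt_normal hy).differentiableAt (by simp)
  have hg : ∀ a, grad X (fun z => ν z a) y = ∑ j, dualFrame X j y a • pd j ν y := by
    intro a
    have := h.grad_inner_normal hy (EuclideanSpace.single a 1)
    simpa [EuclideanSpace.inner_single_right] using this
  have h1 : ∀ a, ‖grad X (fun z => ν z a) y‖ ^ 2 = ∑ i, ∑ j,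
      (pd i ν y a * dualFrame X j y a) * inner ℝ (dualFrame X i y) (pd j ν y) := by
    intro a
    rw [← real_inner_self_eq_norm_sq]
    nth_rewrite 2 [hg a]
    rw [grad_eq_sum_dualFrame, sum_inner]
    refine Finset.sum_congr rfl fun i _ => ?_
    rw [inner_sum]
    refine Finset.sum_congr rfl fun j _ => ?_
    rw [real_inner_smul_left, real_inner_smul_right, pd_apply hν]
    ring
  simp only [h.normSqA_eq_sum hy, h1]
  conv_rhs => rw [Finset.sum_comm]
  refine Finset.sum_congr rfl fun i _ => ?_
  rw [Finset.sum_comm]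
  refine Finset.sum_congr rfl fun j _ => ?_
  rw [← Finset.sum_mul, mul_comm]
  congr 1

lemma pd_meanCurv (h : IsHypersurfaceOn X ν Ω) (hy : y ∈ Ω) (j : Fin n) :
    pd j (meanCurv X ν) y = ∑ i, (inner ℝ (dualFrame X i y) (pd j (pd i ν) y) -
      ∑ k, inner ℝ (dualFrame X i y) (pd j (pd k X) y) *
        inner ℝ (dualFrame X k y) (pd i ν y)) := by
  have hE : ∀ j, DifferentiableAt ℝ (dualFrame X j) y := fun j =>
    (h.contDiffAt_dualFrame hy j).differentiableAt (by simp)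
  have hpν : ∀ j, DifferentiableAt ℝ (pd j ν) y := fun j =>
    (contDiffAt_pd (h.contDiffAt_normal hy) j).differentiableAt (by simp)
  have h0 : ∀ i, inner ℝ (ν y) (pd i ν y) = 0 := fun i => by
    rw [real_inner_comm]; exact h.pd_normal_inner hy i
  rw [show meanCurv X ν = fun z => ∑ i, inner ℝ (dualFrame X i z) (pd i ν z) from
    funext (meanCurv_eq_sum X ν), pd_sum _ fun i _ => (hE i).inner ℝ (hpν i)]
  refine Finset.sum_congr rfl fun i _ => ?_
  rw [pd_inner (hE i) (hpν i), h.pd_dualFrame hy, inner_sub_left, inner_neg_left, sum_inner]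
  simp only [real_inner_smul_left, h0]
  ring

/-- `Δ⟨ν, e⟩ = ⟨∇H, e⟩ - |A|² ⟨ν, e⟩`. -/
lemma laplacian_inner_normal (h : IsHypersurfaceOn X ν Ω) (hy : y ∈ Ω) (e : Euc (n + 1)) :
    laplacian X (fun z => inner ℝ (ν z) e) y =
      ∑ j, inner ℝ (dualFrame X j y) e * pd j (meanCurv X ν) y -
        normSqA X ν y * inner ℝ (ν y) e := by
  have hE : ∀ j, DifferentiableAt ℝ (dualFrame X j) y := fun j =>
    (h.contDiffAt_dualFrame hy j).differentiableAt (by simp)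
  have hpν : ∀ j, DifferentiableAt ℝ (pd j ν) y := fun j =>
    (contDiffAt_pd (h.contDiffAt_normal hy) j).differentiableAt (by simp)
  have hEe : ∀ j, DifferentiableAt ℝ (fun z => inner ℝ (dualFrame X j z) e) y := fun j =>
    (hE j).inner ℝ (by fun_prop)
  have hf : ContDiffAt ℝ ∞ (fun z => inner ℝ (ν z) e) y :=
    (h.contDiffAt_normal hy).inner ℝ contDiffAt_const
  have hZ : grad X (fun z => inner ℝ (ν z) e) =ᶠ[nhds y]
      fun z => ∑ j, inner ℝ (dualFrame X j z) e • pd j ν z := by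
    filter_upwards [h.isOpen.mem_nhds hy] with z hz using h.grad_inner_normal hz e
  have hpE : ∀ i j, pd i (fun z => inner ℝ (dualFrame X j z) e) y =
      -(∑ k, inner ℝ (dualFrame X j y) (pd i (pd k X) y) * inner ℝ (dualFrame X k y) e) -
        inner ℝ (dualFrame X j y) (pd i ν y) * inner ℝ (ν y) e := by
    intro i j
    rw [pd_inner (hE j) (by fun_prop), pd_const, h.pd_dualFrame hy, inner_sub_left,
      inner_neg_left, sum_inner]
    simp only [real_inner_smul_left, inner_zero_right, add_zero]
  have hpZ : ∀ i, inner ℝ (dualFrame X i y) (pd i (grad X fun z => inner ℝ (ν z) e) y) =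
      ∑ j, (inner ℝ (dualFrame X j y) e * inner ℝ (dualFrame X i y) (pd i (pd j ν) y) -
        (∑ k, inner ℝ (dualFrame X j y) (pd i (pd k X) y) * inner ℝ (dualFrame X k y) e *
          inner ℝ (dualFrame X i y) (pd j ν y)) -
        inner ℝ (dualFrame X j y) (pd i ν y) * inner ℝ (dualFrame X i y) (pd j ν y) *
          inner ℝ (ν y) e) := by
    intro i
    rw [pd_congr hZ, pd_sum _ fun j _ => (hEe j).fun_smul (hpν j), inner_sum]
    refine Finset.sum_congr rfl fun j _ => ?_
    rw [pd_smul (hEe j) (hpν j), inner_add_right, real_inner_smul_right, real_inner_smul_right,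
      hpE, sub_mul, neg_mul, Finset.sum_mul]
    ring
  rw [h.laplacian_eq_sum hy hf, h.normSqA_eq_sum hy]
  simp only [hpZ, h.pd_meanCurv hy, Finset.sum_sub_distrib, Finset.mul_sum, mul_sub, Finset.sum_mul]
  -- The Codazzi equation enters only as equality of mixed partials, of ν in `e1` and of X in `e2`.
  -- After these exchanges the terms are those of `pd_meanCurv`.
  have e1 : ∑ i, ∑ j, inner ℝ (dualFrame X j y) e * inner ℝ (dualFrame X i y) (pd i (pd j ν) y) =
      ∑ j, ∑ i, inner ℝ (dualFrame X j y) e * inner ℝ (dualFrame X i y) (pd j (pd i ν) y) := by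
    rw [Finset.sum_comm]
    refine Finset.sum_congr rfl fun j _ => Finset.sum_congr rfl fun i _ => ?_
    rw [pd_comm (h.contDiffAt_normal hy)]
  have e2 : ∑ i, ∑ j, ∑ k, inner ℝ (dualFrame X j y) (pd i (pd k X) y) *
        inner ℝ (dualFrame X k y) e * inner ℝ (dualFrame X i y) (pd j ν y) =
      ∑ k, ∑ j, ∑ i, inner ℝ (dualFrame X k y) e * (inner ℝ (dualFrame X j y) (pd k (pd i X) y) *
        inner ℝ (dualFrame X i y) (pd j ν y)) := by
    rw [Finset.sum_comm]
    simp only [Finset.sum_comm (s := Finset.univ (α := Fin n)) (f := fun i k =>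
      inner ℝ (dualFrame X _ y) (pd i (pd k X) y) *
        inner ℝ (dualFrame X k y) e * inner ℝ (dualFrame X i y) (pd _ ν y))]
    rw [Finset.sum_comm]
    refine Finset.sum_congr rfl fun k _ => Finset.sum_congr rfl fun j _ =>
      Finset.sum_congr rfl fun i _ => ?_
    rw [pd_comm (h.contDiffAt hy) i k]; ring
  have e3 : ∑ i, ∑ j, inner ℝ (dualFrame X j y) (pd i ν y) * inner ℝ (dualFrame X i y) (pd j ν y) *
        inner ℝ (ν y) e = ∑ i, ∑ j, inner ℝ (dualFrame X i y) (pd j ν y) *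
        inner ℝ (dualFrame X j y) (pd i ν y) * inner ℝ (ν y) e := by
    refine Finset.sum_congr rfl fun i _ => Finset.sum_congr rfl fun j _ => by ring
  rw [e1, e2, e3]

/-- On a hypersurface with `H = ⟨X, ν⟩ / 2 + C` the drift Laplacian of `⟨ν, e⟩` is
`- |A|² ⟨ν, e⟩`. -/
lemma driftLaplacian_inner_normal (h : IsHypersurfaceOn X ν Ω) (hy : y ∈ Ω) {C : ℝ}
    (hH : ∀ z ∈ Ω, meanCurv X ν z = inner ℝ (X z) (ν z) / 2 + C) (e : Euc (n + 1)) :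
    laplacian X (fun z => inner ℝ (ν z) e) y -
        (1 / 2) * posDeriv X (fun z => inner ℝ (ν z) e) y =
      - (normSqA X ν y * inner ℝ (ν y) e) := by
  have hX : DifferentiableAt ℝ X y := (h.contDiffAt hy).differentiableAt (by simp)
  have hν : DifferentiableAt ℝ ν y := (h.contDiffAt_normal hy).differentiableAt (by simp)
  have hp : ∀ j, pd j (meanCurv X ν) y = inner ℝ (X y) (pd j ν y) * (1 / 2) := by
    intro j
    have : meanCurv X ν =ᶠ[nhds y] fun z => inner ℝ (X z) (ν z) * (1 / 2) + C := by
      filter_upwards [h.isOpen.mem_nhds hy] with z hz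
      rw [hH z hz]; ring
    rw [pd_congr this, pd_add ((hX.inner ℝ hν).fun_mul (differentiableAt_const (1 / 2 : ℝ))) (differentiableAt_const C),
      pd_mul (hX.inner ℝ hν) (differentiableAt_const _), pd_inner hX hν, pd_const, pd_const,
      h.inner_pd_normal hy]
    ring
  -- Since ∂ⱼX is orthogonal to ν, ∂ⱼH = ½⟨X, ∂ⱼν⟩. Hence ⟨∇H, e⟩ equals the drift term and cancels
  -- against it.
  rw [h.laplacian_inner_normal hy, posDeriv_eq_inner, h.grad_inner_normal hy, inner_sum,
    Finset.mul_sum, sub_right_comm, ← Finset.sum_sub_distrib, Finset.sum_eq_zero, zero_sub]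
  intro j _
  rw [hp, real_inner_smul_right]; ring

end IsHypersurfaceOn

end Coord

/-! ### Gradient, divergence and curvature on the manifold, independently of charts. -/

section Gradient

variable {n : ℕ} {M : Type*} [TopologicalSpace M] [ChartedSpace (Euc n) M]

/-- The gradient of `u` for the metric induced by `F`, as a vector of the ambient space. -/
def gradient (F : M → Euc (n + 1)) (u : M → ℝ) (p : M) : Euc (n + 1) :=
  Coord.grad (inChart F p) (inChart u p) (extChartAt (𝓡 n) p p)

lemma inChart_self {V : Type*} (u : M → V) (p : M) :
    inChart u p (extChartAt (𝓡 n) p p) = u p := by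
  rw [inChart, Function.comp_apply, extChartAt_to_inv p]

variable [IsManifold (𝓡 n) ∞ M] {F N : M → Euc (n + 1)} {q : M} {y : Euc n}

lemma contDiffOn_inChart {V : Type*} [NormedAddCommGroup V] [NormedSpace ℝ V] {u : M → V}
    (hu : ContMDiff (𝓡 n) 𝓘(ℝ, V) ∞ u) (q : M) :
    ContDiffOn ℝ ∞ (inChart u q) (extChartAt (𝓡 n) q).target :=
  contMDiffOn_iff_contDiffOn.mp (hu.comp_contMDiffOn (contMDiffOn_extChartAt_symm q))

lemma contDiffAt_inChart {V : Type*} [NormedAddCommGroup V] [NormedSpace ℝ V] {u : M → V}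
    (hu : ContMDiff (𝓡 n) 𝓘(ℝ, V) ∞ u) (hy : y ∈ (extChartAt (𝓡 n) q).target) :
    ContDiffAt ℝ ∞ (inChart u q) y :=
  (contDiffOn_inChart hu q).contDiffAt ((isOpen_extChartAt_target q).mem_nhds hy)

/-- The derivative of the inverse of the chart at `q`. -/
def chartFrame (q : M) (y : Euc n) :
    Euc n →L[ℝ] TangentSpace (𝓡 n) ((extChartAt (𝓡 n) q).symm y) :=
  mfderiv 𝓘(ℝ, Euc n) (𝓡 n) (extChartAt (𝓡 n) q).symm y

lemma chartFrame_bijective (hy : y ∈ (extChartAt (𝓡 n) q).target) :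
    Function.Bijective (chartFrame q y) := by
  have h := isInvertible_mfderivWithin_extChartAt_symm (I := 𝓡 n) hy
  simp only [modelWithCornersSelf_coe, Set.range_id, mfderivWithin_univ] at h
  obtain ⟨e, he⟩ := h
  rw [chartFrame]
  have : ((mfderiv 𝓘(ℝ, Euc n) (𝓡 n) (extChartAt (𝓡 n) q).symm y) :
      Euc n → TangentSpace (𝓡 n) ((extChartAt (𝓡 n) q).symm y)) = e := by
    ext w; exact (congrArg (fun L => L w) he).symm
  exact this ▸ e.bijective

lemma fderiv_inChart {V : Type*} [NormedAddCommGroup V] [NormedSpace ℝ V] {u : M → V}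
    (hy : y ∈ (extChartAt (𝓡 n) q).target)
    (hu : MDifferentiableAt (𝓡 n) 𝓘(ℝ, V) u ((extChartAt (𝓡 n) q).symm y)) (w : Euc n) :
    fderiv ℝ (inChart u q) y w =
      mfderiv (𝓡 n) 𝓘(ℝ, V) u ((extChartAt (𝓡 n) q).symm y) (chartFrame q y w) := by
  have h1 := mdifferentiableWithinAt_extChartAt_symm (I := 𝓡 n) hy
  simp only [modelWithCornersSelf_coe, Set.range_id, mdifferentiableWithinAt_univ] at h1
  rw [← mfderiv_eq_fderiv, inChart, mfderiv_comp y hu h1]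
  rfl

namespace IsTwoSidedProperImmersion

variable (hF : IsTwoSidedProperImmersion F N)
include hF

lemma isHypersurfaceOn (q : M) : Coord.IsHypersurfaceOn (inChart F q) (inChart N q)
    (extChartAt (𝓡 n) q).target where
  isOpen := isOpen_extChartAt_target q
  smooth := contDiffOn_inChart hF.smooth q
  smooth_normal := contDiffOn_inChart hF.smooth_normal q
  injective y hy := by
    intro v w hvw
    rw [fderiv_inChart hy (hF.smooth.mdifferentiable (by simp) _),
      fderiv_inChart hy (hF.smooth.mdifferentiable (by simp) _)] at hvw
    exact (chartFrame_bijective hy).1 (hF.immersion _ hvw)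
  unit y _ := hF.unit_normal _
  orthogonal y hy w := by
    rw [fderiv_inChart hy (hF.smooth.mdifferentiable (by simp) _)]
    exact hF.orthogonal _ _

omit [IsManifold (𝓡 n) ∞ M] in
lemma eq_of_inner {p : M} {z w : Euc (n + 1)}
    (h1 : ∀ v, inner ℝ z (mfderiv (𝓡 n) (𝓡 (n + 1)) F p v : Euc (n + 1)) =
      inner ℝ w (mfderiv (𝓡 n) (𝓡 (n + 1)) F p v : Euc (n + 1)))
    (h2 : inner ℝ z (N p) = inner ℝ w (N p)) : z = w := by
  refine sub_eq_zero.mp (Coord.eq_zero_of_orthogonal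
    (L := (mfderiv (𝓡 n) (𝓡 (n + 1)) F p : Euc n →L[ℝ] Euc (n + 1)))
    (hF.immersion p) (hF.unit_normal p) (hF.orthogonal p) (fun v => ?_) ?_)
  · rw [inner_sub_left, sub_eq_zero]; exact h1 v
  · rw [inner_sub_left, h2, sub_self]

/-- Products with dF(v) together with orthogonality to N determine an ambient vector, and the
right-hand side involves only the differential of u. This is what makes the gradient independent of
the chart. -/
lemma inner_grad_inChart {u : M → ℝ} (hy : y ∈ (extChartAt (𝓡 n) q).target)
    (hu : MDifferentiableAt (𝓡 n) 𝓘(ℝ, ℝ) u ((extChartAt (𝓡 n) q).symm y))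
    (v : TangentSpace (𝓡 n) ((extChartAt (𝓡 n) q).symm y)) :
    inner ℝ (Coord.grad (inChart F q) (inChart u q) y)
      (mfderiv (𝓡 n) (𝓡 (n + 1)) F ((extChartAt (𝓡 n) q).symm y) v : Euc (n + 1)) =
      (mfderiv (𝓡 n) 𝓘(ℝ, ℝ) u ((extChartAt (𝓡 n) q).symm y) v : ℝ) := by
  obtain ⟨w, rfl⟩ := (chartFrame_bijective hy).2 v
  have h1 := fderiv_inChart hy (hF.smooth.mdifferentiable (by simp) _) w
  have h2 := fderiv_inChart hy hu w
  have h3 := Coord.inner_grad_fderiv ((hF.isHypersurfaceOn q).injective y hy) (inChart u q) w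
  rw [h1, h2] at h3
  exact h3

lemma inner_gradient {u : M → ℝ} {p : M} (hu : MDifferentiableAt (𝓡 n) 𝓘(ℝ, ℝ) u p)
    (v : TangentSpace (𝓡 n) p) :
    inner ℝ (gradient F u p) (mfderiv (𝓡 n) (𝓡 (n + 1)) F p v : Euc (n + 1)) =
      (mfderiv (𝓡 n) 𝓘(ℝ, ℝ) u p v : ℝ) := by
  have hs : (extChartAt (𝓡 n) p).symm (extChartAt (𝓡 n) p p) = p := extChartAt_to_inv p
  have := hF.inner_grad_inChart (q := p) (mem_extChartAt_target p) (u := u) (by rwa [hs])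
  rw [hs] at this
  exact this v

lemma inner_gradient_normal (u : M → ℝ) (p : M) : inner ℝ (gradient F u p) (N p) = 0 := by
  have := Coord.inner_grad_normal
    ((hF.isHypersurfaceOn p).orthogonal _ (mem_extChartAt_target p)) (inChart u p)
  rwa [inChart_self] at this

/-- The gradient may be computed in any chart. -/
lemma grad_inChart {u : M → ℝ} (hy : y ∈ (extChartAt (𝓡 n) q).target)
    (hu : MDifferentiableAt (𝓡 n) 𝓘(ℝ, ℝ) u ((extChartAt (𝓡 n) q).symm y)) :
    Coord.grad (inChart F q) (inChart u q) y = gradient F u ((extChartAt (𝓡 n) q).symm y) := by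
  refine hF.eq_of_inner (p := (extChartAt (𝓡 n) q).symm y) (fun v => ?_) ?_
  · rw [hF.inner_grad_inChart hy hu, hF.inner_gradient hu]
  · rw [hF.inner_gradient_normal]
    exact Coord.inner_grad_normal ((hF.isHypersurfaceOn q).orthogonal _ hy) _

lemma contMDiff_gradient {u : M → ℝ} (hu : ContMDiff (𝓡 n) 𝓘(ℝ, ℝ) ∞ u) :
    ContMDiff (𝓡 n) (𝓡 (n + 1)) ∞ (gradient F u) := by
  intro p
  have h1 : ContDiffAt ℝ ∞ (Coord.grad (inChart F p) (inChart u p)) (extChartAt (𝓡 n) p p) :=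
    (hF.isHypersurfaceOn p).contDiffAt_grad (mem_extChartAt_target p)
      (contDiffAt_inChart hu (mem_extChartAt_target p))
  have h2 : ContMDiffAt (𝓡 n) (𝓡 (n + 1)) ∞
      (Coord.grad (inChart F p) (inChart u p) ∘ extChartAt (𝓡 n) p) p :=
    h1.contMDiffAt.comp p contMDiffAt_extChartAt
  refine h2.congr_of_eventuallyEq ?_
  filter_upwards [(isOpen_extChartAt_source p).mem_nhds (mem_extChartAt_source (I := 𝓡 n) p)]
    with x hx
  rw [Function.comp_apply, hF.grad_inChart ((extChartAt (𝓡 n) p).map_source hx)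
    (hu.mdifferentiable (by simp) _), (extChartAt (𝓡 n) p).left_inv hx]

end IsTwoSidedProperImmersion

omit [IsManifold (𝓡 n) ∞ M] in
lemma contMDiff_coord {Z : M → Euc (n + 1)} (hZ : ContMDiff (𝓡 n) (𝓡 (n + 1)) ∞ Z)
    (a : Fin (n + 1)) : ContMDiff (𝓡 n) 𝓘(ℝ, ℝ) ∞ (fun p => Z p a) :=
  (EuclideanSpace.proj a : Euc (n + 1) →L[ℝ] ℝ).contMDiff.comp hZ

/-- The divergence of an ambient vector field along the immersion. -/
def divergence (F Z : M → Euc (n + 1)) (p : M) : ℝ :=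
  ∑ a, gradient F (fun x => Z x a) p a

namespace IsTwoSidedProperImmersion

variable (hF : IsTwoSidedProperImmersion F N)
include hF

lemma continuous_divergence {Z : M → Euc (n + 1)} (hZ : ContMDiff (𝓡 n) (𝓡 (n + 1)) ∞ Z) :
    Continuous (divergence F Z) :=
  continuous_finsetSum _ fun a _ =>
    (contMDiff_coord (hF.contMDiff_gradient (contMDiff_coord hZ a)) a).continuous

/-- The trace over the tangent frame is rewritten as a sum over ambient coordinates, which mentions
no chart. The mean curvature and the Laplacian both become instances of `divergence` in this way. -/
lemma sum_dualFrame_inChart {Z : M → Euc (n + 1)} (hZ : ContMDiff (𝓡 n) (𝓡 (n + 1)) ∞ Z)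
    (hy : y ∈ (extChartAt (𝓡 n) q).target) :
    ∑ i, inner ℝ (Coord.dualFrame (inChart F q) i y) (Coord.pd i (inChart Z q) y) =
      divergence F Z ((extChartAt (𝓡 n) q).symm y) := by
  rw [← Coord.sum_grad_apply _ ((contDiffAt_inChart hZ hy).differentiableAt (by simp))]
  refine Finset.sum_congr rfl fun a _ => ?_
  rw [← hF.grad_inChart hy ((contMDiff_coord hZ a).mdifferentiable (by simp) _)]
  rfl

lemma coordLaplacian_inChart {u : M → ℝ} (hu : ContMDiff (𝓡 n) 𝓘(ℝ, ℝ) ∞ u)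
    (hy : y ∈ (extChartAt (𝓡 n) q).target) :
    Coord.laplacian (inChart F q) (inChart u q) y =
      divergence F (gradient F u) ((extChartAt (𝓡 n) q).symm y) := by
  rw [(hF.isHypersurfaceOn q).laplacian_eq_sum hy (contDiffAt_inChart hu hy),
    ← hF.sum_dualFrame_inChart (hF.contMDiff_gradient hu) hy]
  refine Finset.sum_congr rfl fun i _ => ?_
  congr 1
  refine Coord.pd_congr ?_ i
  filter_upwards [(isOpen_extChartAt_target q).mem_nhds hy] with z hz
  exact hF.grad_inChart hz (hu.mdifferentiable (by simp) _)

lemma laplacian_eq {u : M → ℝ} (hu : ContMDiff (𝓡 n) 𝓘(ℝ, ℝ) ∞ u) :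
    laplacian F u = divergence F (gradient F u) := by
  ext p
  rw [laplacian, hF.coordLaplacian_inChart hu (mem_extChartAt_target p), extChartAt_to_inv p]

lemma meanCurv_inChart (hy : y ∈ (extChartAt (𝓡 n) q).target) :
    Coord.meanCurv (inChart F q) (inChart N q) y =
      divergence F N ((extChartAt (𝓡 n) q).symm y) := by
  rw [Coord.meanCurv_eq_sum, hF.sum_dualFrame_inChart hF.smooth_normal hy]

lemma meanCurvature_eq : meanCurvature F N = divergence F N := by
  ext p
  rw [meanCurvature, hF.meanCurv_inChart (mem_extChartAt_target p), extChartAt_to_inv p]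

lemma normSqA_inChart (hy : y ∈ (extChartAt (𝓡 n) q).target) :
    Coord.normSqA (inChart F q) (inChart N q) y =
      ∑ a, ‖gradient F (fun x => N x a) ((extChartAt (𝓡 n) q).symm y)‖ ^ 2 := by
  rw [(hF.isHypersurfaceOn q).normSqA_eq_sum_norm_sq hy]
  refine Finset.sum_congr rfl fun a _ => ?_
  rw [← hF.grad_inChart hy ((contMDiff_coord hF.smooth_normal a).mdifferentiable (by simp) _)]
  rfl

lemma normSqSecondForm_eq (p : M) :
    normSqSecondForm F N p = ∑ a, ‖gradient F (fun x => N x a) p‖ ^ 2 := by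
  rw [normSqSecondForm, hF.normSqA_inChart (mem_extChartAt_target p), extChartAt_to_inv p]

lemma continuous_normSqSecondForm : Continuous (normSqSecondForm F N) := by
  rw [funext hF.normSqSecondForm_eq]
  exact continuous_finsetSum _ fun a _ =>
    (hF.contMDiff_gradient (contMDiff_coord hF.smooth_normal a)).continuous.norm.pow 2

omit hF [IsManifold (𝓡 n) ∞ M] in
lemma posDeriv_eq (u : M → ℝ) (p : M) : posDeriv F u p = inner ℝ (F p) (gradient F u p) := by
  rw [posDeriv, Coord.posDeriv_eq_inner, inChart_self]
  rfl

omit [IsManifold (𝓡 n) ∞ M] in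
lemma contMDiff_inner_normal (e : Euc (n + 1)) :
    ContMDiff (𝓡 n) 𝓘(ℝ, ℝ) ∞ (fun p => inner ℝ (N p) e) := by
  have : (fun p => inner ℝ (N p) e) = innerSL ℝ e ∘ N := by
    ext p; simp [real_inner_comm]
  rw [this]
  exact (innerSL ℝ e).contMDiff.comp hF.smooth_normal

/-- The functions `⟨N, e⟩` satisfy `Δu - ½ ∇_{xᵀ} u = - |A|² u`. -/
lemma driftLaplacian_inner_normal {C : ℝ} (hC : CurvatureCondition F N C) (e : Euc (n + 1))
    (p : M) :
    laplacian F (fun x => inner ℝ (N x) e) p -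
        (1 / 2) * posDeriv F (fun x => inner ℝ (N x) e) p =
      -(normSqSecondForm F N p * inner ℝ (N p) e) := by
  have h := (hF.isHypersurfaceOn p).driftLaplacian_inner_normal (mem_extChartAt_target p) (C := C)
    (fun z hz => ?_) e
  · rwa [inChart_self] at h
  · rw [hF.meanCurv_inChart hz, ← hF.meanCurvature_eq]
    exact hC _

end IsTwoSidedProperImmersion

end Gradient

open MeasureTheory

/-! ### The area measure and changes of chart. -/

namespace Coord

variable {n : ℕ}

/-- The area density under a change of coordinates with derivative `J`. -/
lemma density_comp {X X' : Euc n → Euc (n + 1)} {y z : Euc n} {J : Euc n →L[ℝ] Euc n}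
    (h : fderiv ℝ X' y = (fderiv ℝ X z).comp J) : density X' y = |J.det| * density X z := by
  set b := (EuclideanSpace.basisFun (Fin n) ℝ).toBasis with hb
  set A := LinearMap.toMatrix b b J.toLinearMap with hA
  have hAe : ∀ i j, A i j = J (EuclideanSpace.single j 1) i := by
    intro i j
    simp [hA, hb, LinearMap.toMatrix_apply]
  have hpd : ∀ i, pd i X' y = ∑ k, A k i • pd k X z := by
    intro i
    rw [pd, h, ContinuousLinearMap.comp_apply, fderiv_apply_eq_sum_pd]
    simp only [hAe]
  have hm : metric X' y = A.transpose * metric X z * A := by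
    ext i j
    simp only [metric, Matrix.of_apply, hpd, Matrix.mul_apply, Matrix.transpose_apply, sum_inner,
      inner_sum, real_inner_smul_left, real_inner_smul_right, Finset.sum_mul]
    refine Finset.sum_congr rfl fun k _ => Finset.sum_congr rfl fun l _ => by ring
  have hdet : A.det = J.det := by
    rw [hA, LinearMap.det_toMatrix]
  rw [density, hm, Matrix.det_mul, Matrix.det_mul, Matrix.det_transpose, hdet, density,
    show J.det * (metric X z).det * J.det = J.det ^ 2 * (metric X z).det by ring,
    Real.sqrt_mul (sq_nonneg _), Real.sqrt_sq_eq_abs]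

end Coord

section Measurability

lemma measurableSet_inter_preimage_of_continuousOn {α β : Type*} [TopologicalSpace α]
    [MeasurableSpace α] [BorelSpace α] [TopologicalSpace β] [MeasurableSpace β] [BorelSpace β]
    {f : α → β} {s : Set α} (hf : ContinuousOn f s) (hs : MeasurableSet s) {E : Set β}
    (hE : MeasurableSet E) : MeasurableSet (s ∩ f ⁻¹' E) := by
  have h1 := (continuousOn_iff_continuous_domRestrict.mp hf).measurable hE
  have h2 := hs.subtype_image h1
  convert h2 using 1
  ext x
  simp [and_comm]

end Measurability

section Area

variable {n : ℕ} {M : Type*} [TopologicalSpace M] [ChartedSpace (Euc n) M]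
  [MeasurableSpace M] [BorelSpace M]

lemma aemeasurable_extChartAt_symm (q : M) (μ : Measure (Euc n)) :
    AEMeasurable (extChartAt (𝓡 n) q).symm (μ.restrict (extChartAt (𝓡 n) q).target) :=
  (continuousOn_extChartAt_symm q).aemeasurable (isOpen_extChartAt_target q).measurableSet

variable [IsManifold (𝓡 n) ∞ M] {F N : M → Euc (n + 1)}

namespace IsTwoSidedProperImmersion

variable (hF : IsTwoSidedProperImmersion F N)
include hF

omit [MeasurableSpace M] [BorelSpace M] in
lemma continuousOn_density (q : M) :
    ContinuousOn (Coord.density (inChart F q)) (extChartAt (𝓡 n) q).target := fun _ hy =>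
  ((hF.isHypersurfaceOn q).contDiffAt_density hy).continuousAt.continuousWithinAt

omit [MeasurableSpace M] [BorelSpace M] in
lemma aemeasurable_density (q : M) :
    AEMeasurable (fun y => ENNReal.ofReal (Coord.density (inChart F q) y))
      (volume.restrict (extChartAt (𝓡 n) q).target) :=
  ((hF.continuousOn_density q).aemeasurable (isOpen_extChartAt_target q).measurableSet).ennreal_ofReal

omit hF [IsManifold (𝓡 n) ∞ M] in
-- The inverse chart is controlled only on its target, hence is merely almost everywhere measurable.
-- The target is inserted by hand, its complement being null.
lemma chartArea_apply (q : M) {E : Set M} (hE : MeasurableSet E) :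
    chartArea F q E = ∫⁻ y in (extChartAt (𝓡 n) q).target ∩ (extChartAt (𝓡 n) q).symm ⁻¹' E,
      ENNReal.ofReal (Coord.density (inChart F q) y) := by
  have hm := measurableSet_inter_preimage_of_continuousOn (continuousOn_extChartAt_symm (I := 𝓡 n) q)
    (isOpen_extChartAt_target q).measurableSet hE
  have hac := withDensity_absolutelyContinuous
    (volume.restrict (extChartAt (𝓡 n) q).target)
    (fun y => ENNReal.ofReal (Coord.density (inChart F q) y))
  rw [chartArea, Measure.map_apply_of_aemeasurable
    ((aemeasurable_extChartAt_symm q _).mono_ac hac) hE]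
  set T := (extChartAt (𝓡 n) q).target
  set S := (extChartAt (𝓡 n) q).symm ⁻¹' E
  have hT : MeasurableSet T := (isOpen_extChartAt_target q).measurableSet
  have hz : ((volume.restrict T).withDensity
      fun y => ENNReal.ofReal (Coord.density (inChart F q) y)) Tᶜ = 0 :=
    hac (by rw [Measure.restrict_apply hT.compl]; simp)
  have h1 : ((volume.restrict T).withDensity
      fun y => ENNReal.ofReal (Coord.density (inChart F q) y)) S =
      ((volume.restrict T).withDensity
      fun y => ENNReal.ofReal (Coord.density (inChart F q) y)) (T ∩ S) := by
    refine le_antisymm ?_ (measure_mono Set.inter_subset_right)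
    calc _ ≤ _ := measure_mono (t := (T ∩ S) ∪ Tᶜ) (fun x hx => by
            by_cases hxT : x ∈ T
            · exact Or.inl ⟨hxT, hx⟩
            · exact Or.inr hxT)
      _ ≤ _ := measure_union_le _ _
      _ = _ := by rw [hz, add_zero]
  rw [h1, withDensity_apply _ hm, Measure.restrict_restrict hm, Set.inter_assoc,
    Set.inter_comm S T, ← Set.inter_assoc, Set.inter_self]

/-- The area measures of two charts agree on the intersection of their domains. -/
lemma chartArea_restrict (p q : M) :
    (chartArea F p).restrict (extChartAt (𝓡 n) q).source =
      (chartArea F q).restrict (extChartAt (𝓡 n) p).source := by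
  ext E hE
  have hUp := (isOpen_extChartAt_source (I := 𝓡 n) p).measurableSet
  have hUq := (isOpen_extChartAt_source (I := 𝓡 n) q).measurableSet
  rw [Measure.restrict_apply hE, Measure.restrict_apply hE, chartArea_apply p (hE.inter hUq),
    chartArea_apply q (hE.inter hUp)]
  set ep := extChartAt (𝓡 n) p
  set eq := extChartAt (𝓡 n) q
  set S := ep.target ∩ ep.symm ⁻¹' (E ∩ eq.source) with hS
  have hSm : MeasurableSet S :=
    measurableSet_inter_preimage_of_continuousOn (continuousOn_extChartAt_symm (I := 𝓡 n) p)
      (isOpen_extChartAt_target p).measurableSet (hE.inter hUq)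
  have himg : (eq ∘ ep.symm) '' S = eq.target ∩ eq.symm ⁻¹' (E ∩ ep.source) := by
    ext z
    constructor
    · rintro ⟨y, ⟨hy1, hy2, hy3⟩, rfl⟩
      refine ⟨eq.map_source hy3, ?_, ?_⟩
      · simpa only [Set.mem_preimage, Function.comp_apply, eq.left_inv hy3] using hy2
      · simpa only [Set.mem_preimage, Function.comp_apply, eq.left_inv hy3] using ep.map_target hy1
    · rintro ⟨hz1, hz2, hz3⟩
      refine ⟨ep (eq.symm z), ⟨ep.map_source hz3, ?_⟩, ?_⟩
      · rw [Set.mem_preimage, ep.left_inv hz3]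
        exact ⟨hz2, eq.map_target hz1⟩
      · rw [Function.comp_apply, ep.left_inv hz3, eq.right_inv hz1]
  have hinj : Set.InjOn (eq ∘ ep.symm) S := by
    rintro y ⟨hy1, _, hy3⟩ z ⟨hz1, _, hz3⟩ hyz
    exact ep.symm.injOn hy1 hz1 (eq.injOn hy3 hz3 hyz)
  have hτ : ∀ y ∈ S, ContDiffAt ℝ ∞ (eq ∘ ep.symm) y := by
    rintro y ⟨hy1, _, hy3⟩
    have h1 : ContMDiffAt 𝓘(ℝ, Euc n) (𝓡 n) ∞ ep.symm y :=
      (contMDiffOn_extChartAt_symm p).contMDiffAt ((isOpen_extChartAt_target p).mem_nhds hy1)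
    have h2 : ContMDiffAt (𝓡 n) 𝓘(ℝ, Euc n) ∞ eq (ep.symm y) :=
      (contMDiffOn_extChartAt (x := q)).contMDiffAt
        ((chartAt (Euc n) q).open_source.mem_nhds (by
          simpa only [eq, extChartAt_source] using hy3))
    exact (h2.comp y h1).contDiffAt
  -- Change of variables by the transition map. Its Jacobian is precisely the factor by which √(det
  -- g) transforms, by `Coord.density_comp`.
  rw [← himg, lintegral_image_eq_lintegral_abs_det_fderiv_mul volume hSm
    (fun y hy => ((hτ y hy).differentiableAt (by simp)).hasFDerivAt.hasFDerivWithinAt) hinj]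
  refine setLIntegral_congr_fun hSm fun y hy => ?_
  have hy' := hy
  obtain ⟨hy1, _, hy3⟩ := hy'
  have hev : inChart F p =ᶠ[nhds y] inChart F q ∘ (eq ∘ ep.symm) := by
    have hc : ContinuousAt ep.symm y :=
      (continuousOn_extChartAt_symm p).continuousAt ((isOpen_extChartAt_target p).mem_nhds hy1)
    filter_upwards [hc.preimage_mem_nhds ((isOpen_extChartAt_source q).mem_nhds hy3)] with z hz
    simp only [inChart, Function.comp_apply]
    rw [eq.left_inv hz]
  have hX : DifferentiableAt ℝ (inChart F q) ((eq ∘ ep.symm) y) :=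
    (contDiffAt_inChart hF.smooth (eq.map_source hy3)).differentiableAt (by simp)
  have hd := Coord.density_comp (X' := inChart F p) (X := inChart F q) (y := y)
      (z := (eq ∘ ep.symm) y) (J := fderiv ℝ (eq ∘ ep.symm) y) (by
    rw [hev.fderiv_eq, fderiv_comp y hX ((hτ y hy).differentiableAt (by simp))])
  rw [hd, ENNReal.ofReal_mul (abs_nonneg _)]

/-- On the domain of a chart the area measure is the area measure of the chart. -/
lemma area_restrict (q : M) :
    (area F).restrict (extChartAt (𝓡 n) q).source = chartArea F q := by
  have hU := (isOpen_extChartAt_source (I := 𝓡 n) q).measurableSet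
  have hq : (chartArea F q).restrict (extChartAt (𝓡 n) q).source = chartArea F q := by
    refine Measure.restrict_eq_self_of_ae_mem ?_
    rw [ae_iff]
    change chartArea F q (extChartAt (𝓡 n) q).sourceᶜ = 0
    rw [chartArea_apply q hU.compl]
    have : (extChartAt (𝓡 n) q).target ∩
        (extChartAt (𝓡 n) q).symm ⁻¹' (extChartAt (𝓡 n) q).sourceᶜ = ∅ := by
      ext y
      simp only [Set.mem_inter_iff, Set.mem_preimage, Set.mem_compl_iff, Set.mem_empty_iff_false,
        iff_false, not_and, not_not]
      exact fun hy => (extChartAt (𝓡 n) q).map_target hy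
    rw [this]; simp
  refine le_antisymm ?_ ?_
  -- The supremum does not exceed the chart measure on the chart domain: every chart measure splits
  -- into a part inside the domain, dominated by `chartArea F q`, and a part outside, dominated by
  -- the restricted area.
  · have hle : area F ≤ chartArea F q + (area F).restrict (extChartAt (𝓡 n) q).sourceᶜ := by
      refine iSup_le fun p => ?_
      rw [← Measure.restrict_add_restrict_compl (μ := chartArea F p) hU, hF.chartArea_restrict p q]
      exact add_le_add Measure.restrict_le_self
        (Measure.restrict_mono_measure (le_iSup (chartArea F) p) _)
    calc (area F).restrict (extChartAt (𝓡 n) q).source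
        ≤ (chartArea F q + (area F).restrict (extChartAt (𝓡 n) q).sourceᶜ).restrict
          (extChartAt (𝓡 n) q).source := Measure.restrict_mono_measure hle _
      _ = chartArea F q := by
          rw [Measure.restrict_add, hq, Measure.restrict_restrict hU]; simp
  · calc chartArea F q = (chartArea F q).restrict (extChartAt (𝓡 n) q).source := hq.symm
      _ ≤ _ := Measure.restrict_mono_measure (le_iSup (chartArea F) q) _

omit [IsManifold (𝓡 n) ∞ M] in
lemma measurable_weight :
    Measurable (fun p => ENNReal.ofReal (Real.exp (-‖F p‖ ^ 2 / 4))) := by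
  have : Continuous F := hF.smooth.continuous
  exact (by fun_prop : Continuous fun p => Real.exp (-‖F p‖ ^ 2 / 4)).measurable.ennreal_ofReal

/-- Integration over the domain of a chart. -/
lemma setIntegral_gaussArea (q : M) {g : M → ℝ} (hg : Continuous g) :
    ∫ p in (extChartAt (𝓡 n) q).source, g p ∂(gaussArea F) =
      ∫ y in (extChartAt (𝓡 n) q).target, Coord.density (inChart F q) y *
        inChart (fun p => Real.exp (-‖F p‖ ^ 2 / 4) * g p) q y := by
  have hU := (isOpen_extChartAt_source (I := 𝓡 n) q).measurableSet
  have hT := (isOpen_extChartAt_target (I := 𝓡 n) q).measurableSet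
  have hFc : Continuous F := hF.smooth.continuous
  have hac := withDensity_absolutelyContinuous
    (volume.restrict (extChartAt (𝓡 n) q).target)
    (fun y => ENNReal.ofReal (Coord.density (inChart F q) y))
  rw [gaussArea, restrict_withDensity hU, hF.area_restrict q,
    integral_withDensity_eq_integral_toReal_smul₀ hF.measurable_weight.aemeasurable
      (by simp), chartArea,
    integral_map ((aemeasurable_extChartAt_symm q _).mono_ac hac),
    integral_withDensity_eq_integral_toReal_smul₀ (hF.aemeasurable_density q) (by simp)]
  · refine setIntegral_congr_fun hT fun y hy => ?_
    have h0 := (Coord.density_pos ((hF.isHypersurfaceOn q).injective y hy)).le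
    simp only [smul_eq_mul, ENNReal.toReal_ofReal h0, ENNReal.toReal_ofReal (Real.exp_pos _).le]
    rfl
  · have : Continuous fun p => (ENNReal.ofReal (Real.exp (-‖F p‖ ^ 2 / 4))).toReal • g p := by
      simp only [ENNReal.toReal_ofReal (Real.exp_pos _).le]
      fun_prop
    exact this.aestronglyMeasurable

end IsTwoSidedProperImmersion

end Area

/-! ### Gradient calculus and integration by parts in a chart. -/

namespace Coord

variable {n : ℕ}

lemma grad_mul (X : Euc n → Euc (n + 1)) {f g : Euc n → ℝ} {y : Euc n}
    (hf : DifferentiableAt ℝ f y) (hg : DifferentiableAt ℝ g y) :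
    grad X (fun z => f z * g z) y = f y • grad X g y + g y • grad X f y := by
  simp only [grad_eq_sum_dualFrame, pd_mul hf hg, Finset.smul_sum, ← Finset.sum_add_distrib,
    smul_smul, ← add_smul]
  refine Finset.sum_congr rfl fun i _ => ?_
  congr 1; ring

lemma grad_add (X : Euc n → Euc (n + 1)) {f g : Euc n → ℝ} {y : Euc n}
    (hf : DifferentiableAt ℝ f y) (hg : DifferentiableAt ℝ g y) :
    grad X (fun z => f z + g z) y = grad X f y + grad X g y := by
  simp only [grad_eq_sum_dualFrame, pd_add hf hg, add_smul, Finset.sum_add_distrib]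

lemma grad_eq_zero_of_eventuallyEq (X : Euc n → Euc (n + 1)) {f : Euc n → ℝ} {y : Euc n} {c : ℝ}
    (h : f =ᶠ[nhds y] fun _ => c) : grad X f y = 0 := by
  simp [grad_eq_sum_dualFrame, pd_congr h, pd_const]

/-- Chain rule: the gradient of h ∘ X is the tangential part of the ambient gradient of h, and z is
tangent. -/
lemma IsHypersurfaceOn.inner_grad_comp {X ν : Euc n → Euc (n + 1)} {Ω : Set (Euc n)} {y : Euc n}
    (hX : IsHypersurfaceOn X ν Ω) (hy : y ∈ Ω) {h : Euc (n + 1) → ℝ}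
    (hh : DifferentiableAt ℝ h (X y)) {z : Euc (n + 1)} (hz : inner ℝ z (ν y) = 0) :
    inner ℝ (grad X (h ∘ X) y) z = fderiv ℝ h (X y) z := by
  have hXd : DifferentiableAt ℝ X y := (hX.contDiffAt hy).differentiableAt (by simp)
  have hz' : z = ∑ i, inner ℝ (dualFrame X i y) z • pd i X y := by
    refine ext_inner_left ℝ fun w => ?_
    rw [hX.inner_eq_sum hy w z, real_inner_comm z, hz, mul_zero, add_zero, inner_sum]
    refine Finset.sum_congr rfl fun i _ => ?_
    rw [real_inner_smul_right, mul_comm]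
  have hp : ∀ i, pd i (h ∘ X) y = fderiv ℝ h (X y) (pd i X y) := by
    intro i
    rw [pd, fderiv_comp y hh hXd]; rfl
  conv_rhs => rw [hz']
  rw [grad_eq_sum_dualFrame, sum_inner, map_sum]
  refine Finset.sum_congr rfl fun i _ => ?_
  rw [real_inner_smul_left, hp, map_smul, smul_eq_mul, mul_comm]

lemma inner_grad_grad_eq_sum {X : Euc n → Euc (n + 1)} {y : Euc n}
    (h : Function.Injective (fderiv ℝ X y)) (f g : Euc n → ℝ) :
    inner ℝ (grad X f y) (grad X g y) = ∑ i, pd i f y * gradComp X g i y := by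
  nth_rewrite 2 [grad]
  rw [inner_sum]
  refine Finset.sum_congr rfl fun i _ => ?_
  rw [real_inner_smul_right, inner_grad_pd h, mul_comm]

lemma integral_pd_eq_zero {V : Euc n → ℝ} (hV : ContDiff ℝ ∞ V) (hc : HasCompactSupport V)
    (i : Fin n) : ∫ y, pd i V y = 0 := by
  have hd : Continuous fun y => pd i V y := (hV.continuous_fderiv (by simp)).clm_apply
    continuous_const
  have hcs : HasCompactSupport fun y => pd i V y := hc.fderiv_apply ℝ _
  have h := integral_mul_fderiv_eq_neg_fderiv_mul_of_integrable (μ := volume)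
    (f := fun _ : Euc n => (1 : ℝ)) (g := V) (v := EuclideanSpace.single i 1)
    (by simp) (by simpa [pd] using hd.integrable_of_hasCompactSupport hcs)
    (by simpa using hV.continuous.integrable_of_hasCompactSupport hc)
    (fun _ _ => by fun_prop) (fun x _ => (hV.differentiable (by simp)) x)
  simpa [pd] using h

end Coord

section Calculus

variable {n : ℕ} {M : Type*} [TopologicalSpace M] [ChartedSpace (Euc n) M]

lemma gradient_eq_zero_of_eventuallyEq (F : M → Euc (n + 1)) {u : M → ℝ} {p : M} {c : ℝ}
    (h : u =ᶠ[nhds p] fun _ => c) : gradient F u p = 0 := by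
  refine Coord.grad_eq_zero_of_eventuallyEq (c := c) _ ?_
  have hc : ContinuousAt (extChartAt (𝓡 n) p).symm (extChartAt (𝓡 n) p p) :=
    continuousAt_extChartAt_symm p
  have hs := extChartAt_to_inv (I := 𝓡 n) p
  have := hc.eventually (p := fun x => u x = c) (by rw [hs]; exact h)
  exact this

lemma gradient_eq_zero_of_notMem_tsupport (F : M → Euc (n + 1)) {u : M → ℝ} {p : M}
    (h : p ∉ tsupport u) : gradient F u p = 0 :=
  gradient_eq_zero_of_eventuallyEq F (c := 0) (notMem_tsupport_iff_eventuallyEq.mp h)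

variable [IsManifold (𝓡 n) ∞ M] {F N : M → Euc (n + 1)} {u v : M → ℝ}

lemma gradient_mul (F : M → Euc (n + 1)) (hu : ContMDiff (𝓡 n) 𝓘(ℝ, ℝ) ∞ u)
    (hv : ContMDiff (𝓡 n) 𝓘(ℝ, ℝ) ∞ v) (p : M) :
    gradient F (fun x => u x * v x) p = u p • gradient F v p + v p • gradient F u p := by
  have h := Coord.grad_mul (inChart F p)
    ((contDiffAt_inChart hu (mem_extChartAt_target p)).differentiableAt (by simp))
    ((contDiffAt_inChart hv (mem_extChartAt_target p)).differentiableAt (by simp))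
  rwa [inChart_self, inChart_self] at h

lemma gradient_add (F : M → Euc (n + 1)) (hu : ContMDiff (𝓡 n) 𝓘(ℝ, ℝ) ∞ u)
    (hv : ContMDiff (𝓡 n) 𝓘(ℝ, ℝ) ∞ v) (p : M) :
    gradient F (fun x => u x + v x) p = gradient F u p + gradient F v p :=
  Coord.grad_add (inChart F p)
    ((contDiffAt_inChart hu (mem_extChartAt_target p)).differentiableAt (by simp))
    ((contDiffAt_inChart hv (mem_extChartAt_target p)).differentiableAt (by simp))

/-- The function `e^{-|x|²/4}` on `M`. -/
def weight (F : M → Euc (n + 1)) (p : M) : ℝ := Real.exp (-‖F p‖ ^ 2 / 4)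

namespace IsTwoSidedProperImmersion

variable (hF : IsTwoSidedProperImmersion F N)
include hF

lemma inner_gradient_comp {h : Euc (n + 1) → ℝ} {p : M} (hh : DifferentiableAt ℝ h (F p))
    {z : Euc (n + 1)} (hz : inner ℝ z (N p) = 0) :
    inner ℝ (gradient F (h ∘ F) p) z = fderiv ℝ h (F p) z := by
  have := (hF.isHypersurfaceOn p).inner_grad_comp (mem_extChartAt_target p) (h := h)
    (by rwa [inChart_self]) (z := z) (by rwa [inChart_self])
  rw [inChart_self] at this
  exact this

omit [IsManifold (𝓡 n) ∞ M] in
lemma contMDiff_weight : ContMDiff (𝓡 n) 𝓘(ℝ, ℝ) ∞ (weight F) := by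
  have h : ContDiff ℝ ∞ fun x : Euc (n + 1) => Real.exp (-‖x‖ ^ 2 / 4) := by
    have := contDiff_norm_sq ℝ (E := Euc (n + 1)) (n := ∞)
    exact Real.contDiff_exp.comp (this.neg.div_const 4)
  exact h.contMDiff.comp hF.smooth

/-- The tangential gradient of the weight is -½xᵀ times the weight. This turns the Laplacian into
the drift Laplacian once the weight is absorbed into a test function. -/
lemma inner_gradient_weight (p : M) {z : Euc (n + 1)} (hz : inner ℝ z (N p) = 0) :
    inner ℝ (gradient F (weight F) p) z = -(1 / 2) * weight F p * inner ℝ (F p) z := by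
  have hd : HasFDerivAt (fun x : Euc (n + 1) => Real.exp (-‖x‖ ^ 2 / 4))
      (Real.exp (-‖F p‖ ^ 2 / 4) • (-(1 / 2) : ℝ) • innerSL ℝ (F p)) (F p) := by
    have h1 := ((hasStrictFDerivAt_norm_sq (F p)).hasFDerivAt.const_mul (-(1 / 4) : ℝ)).exp
    have e : ∀ x : Euc (n + 1), -(1 / 4) * ‖x‖ ^ 2 = -‖x‖ ^ 2 / 4 := fun x => by ring
    simp only [e] at h1
    refine h1.congr_fderiv ?_
    ext x
    simp only [smul_apply, smul_eq_mul, nsmul_eq_mul]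
    push_cast
    ring
  have := hF.inner_gradient_comp (p := p) hd.differentiableAt hz
  rw [hd.fderiv] at this
  rw [show weight F = (fun x : Euc (n + 1) => Real.exp (-‖x‖ ^ 2 / 4)) ∘ F from rfl, this]
  simp
  ring

/-- Integration by parts in a chart. -/
lemma integral_chart_eq_zero (q : M) {w : M → ℝ} (hu : ContMDiff (𝓡 n) 𝓘(ℝ, ℝ) ∞ u)
    (hc : HasCompactSupport u) (hs : tsupport u ⊆ (extChartAt (𝓡 n) q).source)
    (hw : ContMDiff (𝓡 n) 𝓘(ℝ, ℝ) ∞ w) :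
    ∫ y in (extChartAt (𝓡 n) q).target, Coord.density (inChart F q) y *
      inChart (n := n) (fun p => u p * laplacian F w p + inner ℝ (gradient F u p) (gradient F w p)) q y
        = 0 := by
  set T := (extChartAt (𝓡 n) q).target with hT
  set X := inChart (n := n) F q with hX
  have hTo : IsOpen T := isOpen_extChartAt_target q
  have hS := hF.isHypersurfaceOn q
  set K := extChartAt (𝓡 n) q '' tsupport u with hK
  have hKc : IsCompact K := hc.isCompact.image_of_continuousOn
    ((continuousOn_extChartAt q).mono hs)
  have hKT : K ⊆ T := by
    rintro _ ⟨p, hp, rfl⟩; exact (extChartAt (𝓡 n) q).map_source (hs hp)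
  have hK0 : ∀ y ∈ T, y ∉ K → inChart (n := n) u q y = 0 := by
    intro y hy hyK
    by_contra h0
    refine hyK ⟨(extChartAt (𝓡 n) q).symm y, subset_tsupport u h0, ?_⟩
    exact (extChartAt (𝓡 n) q).right_inv hy
  -- The components of u√g∇w, extended by zero outside the chart. The extension is smooth because
  -- the support of u is a compact subset of the chart domain, so its partial derivatives integrate
  -- to zero.
  set V : Fin n → Euc n → ℝ := fun i => T.indicator fun y =>
    inChart (n := n) u q y * (Coord.density X y * Coord.gradComp X (inChart (n := n) w q) i y) with hV
  have hV0 : ∀ i, ∀ y ∉ K, V i y = 0 := by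
    intro i y hyK
    by_cases hy : y ∈ T
    · simp only [hV, Set.indicator_of_mem hy, hK0 y hy hyK, zero_mul]
    · simp only [hV, Set.indicator_of_notMem hy]
  have hVev0 : ∀ i, ∀ y ∉ K, V i =ᶠ[nhds y] fun _ => 0 := fun i y hyK => by
    filter_upwards [hKc.isClosed.isOpen_compl.mem_nhds hyK] with z hz using hV0 i z hz
  have hVev : ∀ i, ∀ y ∈ T, V i =ᶠ[nhds y] fun y =>
      inChart (n := n) u q y * (Coord.density X y * Coord.gradComp X (inChart (n := n) w q) i y) := fun i y hy => by
    filter_upwards [hTo.mem_nhds hy] with z hz using Set.indicator_of_mem hz _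
  have hdg : ∀ i, ∀ y ∈ T, ContDiffAt ℝ ∞
      (fun y => Coord.density X y * Coord.gradComp X (inChart (n := n) w q) i y) y := fun i y hy =>
    (hS.contDiffAt_density hy).mul (hS.contDiffAt_gradComp hy (contDiffAt_inChart hw hy) i)
  have hVs : ∀ i, ContDiff ℝ ∞ (V i) := by
    intro i
    rw [contDiff_iff_contDiffAt]
    intro y
    by_cases hyK : y ∈ K
    · exact ((contDiffAt_inChart hu (hKT hyK)).mul (hdg i y (hKT hyK))).congr_of_eventuallyEq
        (hVev i y (hKT hyK))
    · exact contDiffAt_const.congr_of_eventuallyEq (hVev0 i y hyK)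
  have hVc : ∀ i, HasCompactSupport (V i) := fun i => HasCompactSupport.intro hKc (hV0 i)
  have hint : ∫ y, ∑ i, Coord.pd i (V i) y = 0 := by
    rw [integral_finsetSum]
    · exact Finset.sum_eq_zero fun i _ => Coord.integral_pd_eq_zero (hVs i) (hVc i) i
    · intro i _
      exact (((hVs i).continuous_fderiv (by simp)).clm_apply
        continuous_const).integrable_of_hasCompactSupport ((hVc i).fderiv_apply ℝ _)
  have hset : ∫ y in T, ∑ i, Coord.pd i (V i) y = ∫ y, ∑ i, Coord.pd i (V i) y := by
    refine setIntegral_eq_integral_of_forall_compl_eq_zero fun y hy => ?_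
    refine Finset.sum_eq_zero fun i _ => ?_
    rw [Coord.pd_congr (hVev0 i y fun h => hy (hKT h)), Coord.pd_const]
  rw [← hint, ← hset]
  refine setIntegral_congr_fun hTo.measurableSet fun y hy => ?_
  have hden := (Coord.density_pos (hS.injective y hy)).ne'
  have hd1 : DifferentiableAt ℝ (inChart (n := n) u q) y :=
    (contDiffAt_inChart hu hy).differentiableAt (by simp)
  have h1 : ∀ i, Coord.pd i (V i) y = Coord.density X y *
      (Coord.pd i (inChart (n := n) u q) y * Coord.gradComp X (inChart (n := n) w q) i y) + inChart (n := n) u q y *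
      Coord.pd i (fun y => Coord.density X y * Coord.gradComp X (inChart (n := n) w q) i y) y := by
    intro i
    rw [Coord.pd_congr (hVev i y hy), Coord.pd_mul hd1 ((hdg i y hy).differentiableAt (by simp))]
    ring
  have h2 : ∑ i, Coord.pd i
      (fun y => Coord.density X y * Coord.gradComp X (inChart (n := n) w q) i y) y =
      Coord.density X y * Coord.laplacian X (inChart (n := n) w q) y := by
    rw [Coord.laplacian, mul_inv_cancel_left₀ hden]
  rw [Finset.sum_congr rfl fun i _ => h1 i, Finset.sum_add_distrib, ← Finset.mul_sum,
    ← Finset.mul_sum, h2, ← Coord.inner_grad_grad_eq_sum (hS.injective y hy),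
    hF.grad_inChart hy (hu.mdifferentiable (by simp) _),
    hF.grad_inChart hy (hw.mdifferentiable (by simp) _), hF.coordLaplacian_inChart hw hy,
    ← hF.laplacian_eq hw]
  simp only [inChart, Function.comp_apply]
  ring

end IsTwoSidedProperImmersion

end Calculus

/-! ### Global integration by parts and the quadratic form on truncated functions. -/

section Integration

variable {n : ℕ} {M : Type*} [TopologicalSpace M] [ChartedSpace (Euc n) M]
  [IsManifold (𝓡 n) ∞ M] {F N : M → Euc (n + 1)} {u w : M → ℝ}

lemma gradient_sum (F : M → Euc (n + 1)) {ι : Type*} (s : Finset ι) {f : ι → M → ℝ}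
    (hf : ∀ i, ContMDiff (𝓡 n) 𝓘(ℝ, ℝ) ∞ (f i)) (p : M) :
    gradient F (fun x => ∑ i ∈ s, f i x) p = ∑ i ∈ s, gradient F (f i) p := by
  classical
  induction s using Finset.induction_on with
  | empty =>
    simpa using gradient_eq_zero_of_eventuallyEq F (u := fun _ : M => (0 : ℝ)) (c := 0) (p := p)
      (Filter.EventuallyEq.refl _ _)
  | insert i s hi ih =>
    have hs : ContMDiff (𝓡 n) 𝓘(ℝ, ℝ) ∞ fun x => ∑ i ∈ s, f i x :=
      contMDiff_finsetSum fun i _ => hf i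
    simp only [Finset.sum_insert hi]
    rw [gradient_add F (hf i) hs, ih]

/-- The drift Laplacian `Δw - ½ ∇_{xᵀ} w`. -/
def driftLaplacian (F : M → Euc (n + 1)) (w : M → ℝ) (p : M) : ℝ :=
  laplacian F w p - (1 / 2) * posDeriv F w p

namespace IsTwoSidedProperImmersion

variable (hF : IsTwoSidedProperImmersion F N)
include hF

lemma continuous_gradient (hu : ContMDiff (𝓡 n) 𝓘(ℝ, ℝ) ∞ u) : Continuous (gradient F u) :=
  (hF.contMDiff_gradient hu).continuous

lemma continuous_driftLaplacian (hw : ContMDiff (𝓡 n) 𝓘(ℝ, ℝ) ∞ w) :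
    Continuous (driftLaplacian F w) := by
  have h1 : Continuous (laplacian F w) := by
    rw [hF.laplacian_eq hw]; exact hF.continuous_divergence (hF.contMDiff_gradient hw)
  have h2 : Continuous (posDeriv F w) := by
    rw [funext (posDeriv_eq w)]
    exact hF.smooth.continuous.inner (hF.continuous_gradient hw)
  exact h1.sub (continuous_const.mul h2)

variable [MeasurableSpace M] [BorelSpace M]

lemma integral_ibp_of_tsupport_subset (q : M) (hu : ContMDiff (𝓡 n) 𝓘(ℝ, ℝ) ∞ u)
    (hc : HasCompactSupport u) (hs : tsupport u ⊆ (extChartAt (𝓡 n) q).source)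
    (hw : ContMDiff (𝓡 n) 𝓘(ℝ, ℝ) ∞ w) :
    ∫ p, (u p * driftLaplacian F w p + inner ℝ (gradient F u p) (gradient F w p))
      ∂(gaussArea F) = 0 := by
  have hcont : Continuous fun p =>
      u p * driftLaplacian F w p + inner ℝ (gradient F u p) (gradient F w p) :=
    (hu.continuous.mul (hF.continuous_driftLaplacian hw)).add
      ((hF.continuous_gradient hu).inner (hF.continuous_gradient hw))
  rw [← setIntegral_eq_integral_of_forall_compl_eq_zero (s := (extChartAt (𝓡 n) q).source),
    hF.setIntegral_gaussArea q hcont]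
  -- The unweighted identity in the chart is applied to u times the weight; the gradient of the
  -- weight produces the drift.
  · have hu' : ContMDiff (𝓡 n) 𝓘(ℝ, ℝ) ∞ fun x => u x * weight F x := hu.mul hF.contMDiff_weight
    have h := hF.integral_chart_eq_zero q hu' (hc.mul_right (f' := weight F))
      ((tsupport_mul_subset_left (f := u) (g := weight F)).trans hs) hw
    rw [← h]
    have hfun : (fun p => Real.exp (-‖F p‖ ^ 2 / 4) *
        (u p * driftLaplacian F w p + inner ℝ (gradient F u p) (gradient F w p))) =
        fun p => u p * weight F p * laplacian F w p +
          inner ℝ (gradient F (fun x => u x * weight F x) p) (gradient F w p) := by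
      ext p
      rw [gradient_mul F hu hF.contMDiff_weight, inner_add_left, real_inner_smul_left,
        real_inner_smul_left, hF.inner_gradient_weight p (hF.inner_gradient_normal w p),
        driftLaplacian, posDeriv_eq]
      change weight F p * _ = _
      ring
    rw [hfun]
  · intro p hp
    have hp' : p ∉ tsupport u := fun h => hp (hs h)
    rw [gradient_eq_zero_of_notMem_tsupport F hp', image_eq_zero_of_notMem_tsupport hp']
    simp

lemma integrable_ibp [IsFiniteMeasure (gaussArea F)] (hu : ContMDiff (𝓡 n) 𝓘(ℝ, ℝ) ∞ u)
    (hc : HasCompactSupport u) (hw : ContMDiff (𝓡 n) 𝓘(ℝ, ℝ) ∞ w) :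
    Integrable (fun p => u p * driftLaplacian F w p +
      inner ℝ (gradient F u p) (gradient F w p)) (gaussArea F) := by
  have hcont : Continuous fun p =>
      u p * driftLaplacian F w p + inner ℝ (gradient F u p) (gradient F w p) :=
    (hu.continuous.mul (hF.continuous_driftLaplacian hw)).add
      ((hF.continuous_gradient hu).inner (hF.continuous_gradient hw))
  refine hcont.integrable_of_hasCompactSupport ?_
  refine HasCompactSupport.intro' hc.isCompact (isClosed_tsupport u) fun p hp' => ?_
  rw [gradient_eq_zero_of_notMem_tsupport F hp', image_eq_zero_of_notMem_tsupport hp']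
  simp

/-- Integration by parts for the drift Laplacian. -/
theorem integral_ibp [T2Space M] [SecondCountableTopology M] [IsFiniteMeasure (gaussArea F)]
    (hu : ContMDiff (𝓡 n) 𝓘(ℝ, ℝ) ∞ u) (hc : HasCompactSupport u)
    (hw : ContMDiff (𝓡 n) 𝓘(ℝ, ℝ) ∞ w) :
    ∫ p, (u p * driftLaplacian F w p + inner ℝ (gradient F u p) (gradient F w p))
      ∂(gaussArea F) = 0 := by
  have : LocallyCompactSpace M := ChartedSpace.locallyCompactSpace (Euc n) M
  obtain ⟨f, hf⟩ := SmoothPartitionOfUnity.exists_isSubordinate (𝓡 n) (s := Set.univ)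
    isClosed_univ (fun q : M => (extChartAt (𝓡 n) q).source)
    (fun q => isOpen_extChartAt_source q)
    (fun q _ => Set.mem_iUnion.mpr ⟨q, mem_extChartAt_source q⟩)
  have hfin := f.locallyFinite.finite_nonempty_inter_compact hc.isCompact
  set S := hfin.toFinset with hS
  have hsum : ∀ x, u x = ∑ i ∈ S, f i x * u x := by
    intro x
    by_cases hx : x ∈ tsupport u
    · have h1 := f.sum_eq_one (Set.mem_univ x)
      rw [finsum_eq_sum_of_support_subset (s := S)] at h1
      · rw [← Finset.sum_mul, h1, one_mul]
      · intro i hi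
        simp only [hS, Set.Finite.coe_toFinset, Set.mem_ofPred_eq]
        exact ⟨x, hi, hx⟩
    · simp [image_eq_zero_of_notMem_tsupport hx]
  have hfi : ∀ i, ContMDiff (𝓡 n) 𝓘(ℝ, ℝ) ∞ fun x => f i x * u x := fun i =>
    (f i).contMDiff.mul hu
  have hfc : ∀ i, HasCompactSupport fun x => f i x * u x := fun i => hc.mul_left (f := f i)
  have hpt : ∀ p, u p * driftLaplacian F w p + inner ℝ (gradient F u p) (gradient F w p) =
      ∑ i ∈ S, ((f i p * u p) * driftLaplacian F w p +
        inner ℝ (gradient F (fun x => f i x * u x) p) (gradient F w p)) := by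
    intro p
    rw [Finset.sum_add_distrib, ← Finset.sum_mul, ← hsum p, ← sum_inner,
      ← gradient_sum F S hfi p, ← funext hsum]
  simp_rw [hpt]
  rw [integral_finsetSum S fun i _ => hF.integrable_ibp (hfi i) (hfc i) hw]
  refine Finset.sum_eq_zero fun i _ => ?_
  exact hF.integral_ibp_of_tsupport_subset i (hfi i) (hfc i)
    ((tsupport_mul_subset_left (f := f i) (g := u)).trans (hf i)) hw

/-- The quadratic form in terms of the gradient. -/
theorem Q_eq [T2Space M] [SecondCountableTopology M] [IsFiniteMeasure (gaussArea F)]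
    (hu : ContMDiff (𝓡 n) 𝓘(ℝ, ℝ) ∞ u) (hc : HasCompactSupport u) :
    Q F N u u = ∫ p, (‖gradient F u p‖ ^ 2 - (normSqSecondForm F N p + 1 / 2) * u p ^ 2)
      ∂(gaussArea F) := by
  have h1 := hF.integral_ibp hu hc hu
  have hcont : Continuous fun p =>
      ‖gradient F u p‖ ^ 2 - (normSqSecondForm F N p + 1 / 2) * u p ^ 2 :=
    ((hF.continuous_gradient hu).norm.pow 2).sub
      ((hF.continuous_normSqSecondForm.add continuous_const).mul (hu.continuous.pow 2))
  have hint : Integrable (fun p => ‖gradient F u p‖ ^ 2 -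
      (normSqSecondForm F N p + 1 / 2) * u p ^ 2) (gaussArea F) := by
    refine hcont.integrable_of_hasCompactSupport ?_
    refine HasCompactSupport.intro' hc.isCompact (isClosed_tsupport u) fun p hp' => ?_
    rw [gradient_eq_zero_of_notMem_tsupport F hp', image_eq_zero_of_notMem_tsupport hp']
    simp
  have hpt : ∀ p, u p * jacobi F N u p =
      (u p * driftLaplacian F u p + inner ℝ (gradient F u p) (gradient F u p)) -
      (‖gradient F u p‖ ^ 2 - (normSqSecondForm F N p + 1 / 2) * u p ^ 2) := by
    intro p
    rw [jacobi, driftLaplacian, real_inner_self_eq_norm_sq]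
    ring
  rw [Q, integral_congr_ae (Filter.Eventually.of_forall hpt),
    integral_sub (hF.integrable_ibp hu hc hu) hint, h1]
  ring

omit [MeasurableSpace M] [BorelSpace M] in
-- The gradient is linear in e, and |A|² is the sum of the squared gradients of the components of N,
-- so this is the Cauchy-Schwarz inequality.
lemma norm_gradient_inner_normal_sq_le (e : Euc (n + 1)) (p : M) :
    ‖gradient F (fun x => inner ℝ (N x) e) p‖ ^ 2 ≤ ‖e‖ ^ 2 * normSqSecondForm F N p := by
  have hf : (fun x => inner ℝ (N x) e) = fun x => ∑ a, e a * N x a := by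
    ext x; simp [PiLp.inner_apply]
  have hg : gradient F (fun x => inner ℝ (N x) e) p = ∑ a, e a • gradient F (fun x => N x a) p := by
    rw [hf, gradient_sum F _ (f := fun a x => e a * N x a)
      fun a => contMDiff_const.mul (contMDiff_coord hF.smooth_normal a)]
    refine Finset.sum_congr rfl fun a _ => ?_
    rw [gradient_mul F contMDiff_const (contMDiff_coord hF.smooth_normal a),
      gradient_eq_zero_of_eventuallyEq F (u := fun _ => e a) (Filter.EventuallyEq.refl _ _)]
    simp
  have h1 : ‖gradient F (fun x => inner ℝ (N x) e) p‖ ≤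
      ∑ a, |e a| * ‖gradient F (fun x => N x a) p‖ := by
    rw [hg]
    refine (norm_sum_le _ _).trans (le_of_eq ?_)
    simp [norm_smul]
  calc _ ≤ (∑ a, |e a| * ‖gradient F (fun x => N x a) p‖) ^ 2 := by gcongr
    _ ≤ (∑ a, |e a| ^ 2) * ∑ a, ‖gradient F (fun x => N x a) p‖ ^ 2 :=
        Finset.sum_mul_sq_le_sq_mul_sq _ _ _
    _ = _ := by
        rw [hF.normSqSecondForm_eq, EuclideanSpace.norm_sq_eq]
        simp

end IsTwoSidedProperImmersion

/-- In the application f = ⟨N, e⟩, s = |∇φ|, g = |∇f|, G = ⟨∇φ, ∇f⟩, A = |A|² and E = |e|. The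
subtracted bracket is the integrand of the integration by parts identity of f against φ²(f + 2c). It
removes every term in g² and f²A and leaves -2φcG - φ²c²A beside the terms on the right. Since
2|φcG| ≤ 2|φc|sE√A ≤ s²E² + φ²c²A, the curvature is absorbed, and only the gradient of φ remains as
an error. -/
lemma cutoff_pointwise_le {φ f c s g G A E : ℝ} (hs : 0 ≤ s) (hE : 0 ≤ E) (hA : 0 ≤ A)
    (hG : |G| ≤ s * g) (hgA : g ^ 2 ≤ E ^ 2 * A) :
    φ ^ 2 * g ^ 2 + 2 * (φ * (f + c)) * G + (f + c) ^ 2 * s ^ 2 -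
        (A + 1 / 2) * (φ * (f + c)) ^ 2 -
        (φ * (φ * (f + c + c)) * -(A * f) + (φ ^ 2 * g ^ 2 + 2 * φ * (f + c + c) * G)) ≤
      s ^ 2 * ((f + c) ^ 2 + E ^ 2) - 1 / 2 * (φ * (f + c)) ^ 2 := by
  have h2 : g ≤ E * √A := by
    refine le_of_sq_le_sq ?_ (by positivity)
    rw [mul_pow, Real.sq_sqrt hA]; exact hgA
  have h3 : |φ * c| * |G| ≤ |φ * c| * (s * (E * √A)) := by
    gcongr
    exact hG.trans (by gcongr)
  have h4 : -(φ * c * G) ≤ |φ * c| * |G| := by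
    rw [← abs_mul]
    have := neg_abs_le (φ * c * G)
    linarith
  have h6 := sq_nonneg (s * E - |φ * c| * √A)
  have h7 : (|φ * c| * √A) ^ 2 = φ ^ 2 * c ^ 2 * A := by
    rw [mul_pow, sq_abs, Real.sq_sqrt hA]; ring
  have h8 : (s * E - |φ * c| * √A) ^ 2 =
      s ^ 2 * E ^ 2 - 2 * (|φ * c| * (s * (E * √A))) + (|φ * c| * √A) ^ 2 := by ring
  rw [h8, h7] at h6
  have h9 : φ ^ 2 * g ^ 2 + 2 * (φ * (f + c)) * G + (f + c) ^ 2 * s ^ 2 -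
      (A + 1 / 2) * (φ * (f + c)) ^ 2 -
      (φ * (φ * (f + c + c)) * -(A * f) + (φ ^ 2 * g ^ 2 + 2 * φ * (f + c + c) * G)) =
      s ^ 2 * (f + c) ^ 2 - 2 * (φ * c * G) - φ ^ 2 * c ^ 2 * A -
        1 / 2 * (φ * (f + c)) ^ 2 := by ring
  rw [h9, mul_add]
  linarith

omit [IsManifold (𝓡 n) ∞ M] in
lemma contMDiff_of_isLocallyConstant {c : M → ℝ} (hc : IsLocallyConstant c) :
    ContMDiff (𝓡 n) 𝓘(ℝ, ℝ) ∞ c := fun p =>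
  (contMDiffAt_const (c := c p)).congr_of_eventuallyEq (hc.eventually_eq p)

namespace IsTwoSidedProperImmersion

variable (hF : IsTwoSidedProperImmersion F N)
include hF

variable [MeasurableSpace M] [BorelSpace M]

/-- The quadratic form on a truncation of `⟨N, e⟩ + c`, `c` locally constant. -/
theorem Q_cutoff_le [T2Space M] [SecondCountableTopology M] [IsFiniteMeasure (gaussArea F)]
    {C : ℝ} (hC : CurvatureCondition F N C) {φ c : M → ℝ}
    (hφ : ContMDiff (𝓡 n) 𝓘(ℝ, ℝ) ∞ φ) (hφc : HasCompactSupport φ) (hc : IsLocallyConstant c)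
    (e : Euc (n + 1)) :
    Q F N (fun p => φ p * (inner ℝ (N p) e + c p)) (fun p => φ p * (inner ℝ (N p) e + c p)) ≤
      ∫ p, (‖gradient F φ p‖ ^ 2 * ((inner ℝ (N p) e + c p) ^ 2 + ‖e‖ ^ 2) -
        1 / 2 * (φ p * (inner ℝ (N p) e + c p)) ^ 2) ∂(gaussArea F) := by
  set f : M → ℝ := fun p => inner ℝ (N p) e with hf_def
  have hf : ContMDiff (𝓡 n) 𝓘(ℝ, ℝ) ∞ f := hF.contMDiff_inner_normal e
  have hcs : ContMDiff (𝓡 n) 𝓘(ℝ, ℝ) ∞ c := contMDiff_of_isLocallyConstant hc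
  have hu : ContMDiff (𝓡 n) 𝓘(ℝ, ℝ) ∞ fun p => f p + c p := hf.add hcs
  have hw : ContMDiff (𝓡 n) 𝓘(ℝ, ℝ) ∞ fun p => φ p * (f p + c p) := hφ.mul hu
  have hwc : HasCompactSupport fun p => φ p * (f p + c p) :=
    hφc.mul_right (f' := fun p => f p + c p)
  have hk : ContMDiff (𝓡 n) 𝓘(ℝ, ℝ) ∞ fun p => (f p + c p) + c p := hu.add hcs
  have hφk : ContMDiff (𝓡 n) 𝓘(ℝ, ℝ) ∞ fun p => φ p * ((f p + c p) + c p) := hφ.mul hk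
  -- The choice comes from (f + c)² - f(f + 2c) = c²: testing the equation of f with φ²(f + 2c)
  -- leaves only c²|A|², which has the good sign in Q.
  have hψ : ContMDiff (𝓡 n) 𝓘(ℝ, ℝ) ∞ fun p => φ p * (φ p * ((f p + c p) + c p)) := hφ.mul hφk
  have hψc : HasCompactSupport fun p => φ p * (φ p * ((f p + c p) + c p)) :=
    hφc.mul_right (f' := fun p => φ p * ((f p + c p) + c p))
  have hgc : ∀ p, gradient F c p = 0 := fun p =>
    gradient_eq_zero_of_eventuallyEq F (hc.eventually_eq p)
  have hgw : ∀ p, gradient F (fun p => φ p * (f p + c p)) p =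
      φ p • gradient F f p + (f p + c p) • gradient F φ p := by
    intro p
    rw [gradient_mul F hφ hu, gradient_add F hf hcs, hgc, add_zero]
  have hgψ : ∀ p, gradient F (fun p => φ p * (φ p * ((f p + c p) + c p))) p =
      φ p ^ 2 • gradient F f p + (2 * φ p * ((f p + c p) + c p)) • gradient F φ p := by
    intro p
    rw [gradient_mul F hφ hφk, gradient_mul F hφ hk, gradient_add F hu hcs, gradient_add F hf hcs,
      hgc, add_zero, add_zero]
    module
  have hibp := hF.integral_ibp hψ hψc hf
  have hint1 := hF.integrable_ibp hψ hψc hf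
  have hcpt : ∀ g : M → ℝ, Continuous g → (∀ p, p ∉ tsupport φ → g p = 0) →
      Integrable g (gaussArea F) := fun g hg h0 =>
    hg.integrable_of_hasCompactSupport
      (HasCompactSupport.intro' hφc.isCompact (isClosed_tsupport φ) h0)
  have hcφ := hF.continuous_gradient hφ
  have hcf := hF.continuous_gradient hf
  have hcA := hF.continuous_normSqSecondForm
  have c1 := hφ.continuous
  have c2 := hf.continuous
  have c3 := hcs.continuous
  have hint2 : Integrable (fun p => ‖gradient F (fun p => φ p * (f p + c p)) p‖ ^ 2 -
      (normSqSecondForm F N p + 1 / 2) * (φ p * (f p + c p)) ^ 2) (gaussArea F) := by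
    refine hcpt _ ?_ fun p hp => ?_
    · have := hF.continuous_gradient hw
      fun_prop
    · rw [hgw, gradient_eq_zero_of_notMem_tsupport F hp, image_eq_zero_of_notMem_tsupport hp]
      simp
  rw [hF.Q_eq hw hwc, ← sub_zero (∫ p, (‖gradient F (fun p => φ p * (f p + c p)) p‖ ^ 2 -
      (normSqSecondForm F N p + 1 / 2) * (φ p * (f p + c p)) ^ 2) ∂(gaussArea F)), ← hibp,
    ← integral_sub hint2 hint1]
  have c4 : Continuous N := hF.smooth_normal.continuous
  refine integral_mono (hint2.sub hint1) (hcpt _ (by fun_prop) fun p hp => ?_) fun p => ?_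
  · rw [gradient_eq_zero_of_notMem_tsupport F hp, image_eq_zero_of_notMem_tsupport hp]
    simp
  · have hdrift : driftLaplacian F f p = -(normSqSecondForm F N p * f p) :=
      hF.driftLaplacian_inner_normal hC e p
    have hA := hF.norm_gradient_inner_normal_sq_le e p
    have hn : ‖φ p • gradient F f p + (f p + c p) • gradient F φ p‖ ^ 2 =
        φ p ^ 2 * ‖gradient F f p‖ ^ 2 +
          2 * (φ p * (f p + c p)) * inner ℝ (gradient F φ p) (gradient F f p) +
          (f p + c p) ^ 2 * ‖gradient F φ p‖ ^ 2 := by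
      rw [norm_add_sq_real, norm_smul, norm_smul, real_inner_smul_left, real_inner_smul_right,
        real_inner_comm, mul_pow, mul_pow, Real.norm_eq_abs, Real.norm_eq_abs, sq_abs, sq_abs]
      ring
    have hcs1 : |inner ℝ (gradient F φ p) (gradient F f p)| ≤
        ‖gradient F φ p‖ * ‖gradient F f p‖ := abs_real_inner_le_norm _ _
    beta_reduce
    rw [hgw, hgψ, hn, hdrift, inner_add_left, real_inner_smul_left,
      real_inner_smul_left, real_inner_self_eq_norm_sq]
    change _ ≤ ‖gradient F φ p‖ ^ 2 * ((f p + c p) ^ 2 + ‖e‖ ^ 2) - 1 / 2 * (φ p * (f p + c p)) ^ 2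
    refine cutoff_pointwise_le (norm_nonneg _) (norm_nonneg _) ?_ hcs1 hA
    rw [hF.normSqSecondForm_eq]
    exact Finset.sum_nonneg fun a _ => sq_nonneg _

end IsTwoSidedProperImmersion

end Integration

/-! ### Cutoff functions and positivity of the measure. -/

section TestSpace

variable {n : ℕ} {M : Type*} [TopologicalSpace M] [ChartedSpace (Euc n) M]
  [IsManifold (𝓡 n) ∞ M] {F N : M → Euc (n + 1)}

namespace IsTwoSidedProperImmersion

variable (hF : IsTwoSidedProperImmersion F N)
include hF

/-- The gradient is itself tangent, so it may be inserted as the vector z in `inner_gradient_comp`.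
-/
lemma norm_gradient_comp_le {h : Euc (n + 1) → ℝ} {p : M} (hh : DifferentiableAt ℝ h (F p)) :
    ‖gradient F (h ∘ F) p‖ ≤ ‖fderiv ℝ h (F p)‖ := by
  have h1 := hF.inner_gradient_comp hh (hF.inner_gradient_normal (h ∘ F) p)
  rw [real_inner_self_eq_norm_sq] at h1
  have h2 : ‖gradient F (h ∘ F) p‖ ^ 2 ≤ ‖fderiv ℝ h (F p)‖ * ‖gradient F (h ∘ F) p‖ := by
    rw [h1]
    exact (le_abs_self _).trans ((fderiv ℝ h (F p)).le_opNorm _)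
  by_contra! hlt
  have h3 : 0 < ‖gradient F (h ∘ F) p‖ := (norm_nonneg _).trans_lt hlt
  nlinarith

variable [MeasurableSpace M] [BorelSpace M]

/-- Cutoff functions with small gradient that are close to `1` in the mean. -/
lemma exists_cutoff [IsFiniteMeasure (gaussArea F)] {ε : ℝ} (hε : 0 < ε) :
    ∃ φ : M → ℝ, ContMDiff (𝓡 n) 𝓘(ℝ, ℝ) ∞ φ ∧ HasCompactSupport φ ∧ (∀ p, 0 ≤ φ p) ∧
      (∀ p, φ p ≤ 1) ∧ (∀ p, ‖gradient F φ p‖ ^ 2 ≤ ε) ∧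
      ∫ p, (1 - φ p ^ 2) ∂(gaussArea F) ≤ ε := by
  -- A fixed bump rescaled by m + 1 and composed with F. Its gradient is at most B/(m + 1),
  -- dominated convergence against the finite measure handles the mean, and properness of F makes
  -- the support compact.
  let χ : ContDiffBump (0 : Euc (n + 1)) := ⟨1, 2, one_pos, one_lt_two⟩
  have hχ : ContDiff ℝ ∞ χ := χ.contDiff
  obtain ⟨B, hB⟩ := (χ.hasCompactSupport.fderiv ℝ).exists_bound_of_continuous
    (hχ.continuous_fderiv (by simp))
  let h : ℕ → Euc (n + 1) → ℝ := fun m x => χ ((m + 1 : ℝ)⁻¹ • x)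
  have hh : ∀ m, ContDiff ℝ ∞ (h m) := fun m => hχ.comp (contDiff_const_smul _)
  have hpos : ∀ m : ℕ, (0 : ℝ) < m + 1 := fun m => by positivity
  have hgrad : ∀ (m : ℕ) (p : M), ‖gradient F (h m ∘ F) p‖ ≤ B * (m + 1 : ℝ)⁻¹ := by
    intro m p
    refine (hF.norm_gradient_comp_le ((hh m).differentiable (by simp) _)).trans ?_
    have hd : HasFDerivAt (h m) ((fderiv ℝ χ ((m + 1 : ℝ)⁻¹ • F p)).comp
        ((m + 1 : ℝ)⁻¹ • ContinuousLinearMap.id ℝ (Euc (n + 1)))) (F p) :=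
      ((hχ.differentiable (by simp)) _).hasFDerivAt.comp (F p)
        ((hasFDerivAt_id (F p)).const_smul ((m + 1 : ℝ)⁻¹))
    rw [hd.fderiv, ContinuousLinearMap.comp_smul, ContinuousLinearMap.comp_id, norm_smul,
      Real.norm_eq_abs, abs_of_pos (inv_pos.mpr (hpos m)), mul_comm]
    exact mul_le_mul_of_nonneg_right (hB _) (inv_pos.mpr (hpos m)).le
  have hlim1 : Filter.Tendsto (fun m : ℕ => (B * (m + 1 : ℝ)⁻¹) ^ 2) Filter.atTop (nhds 0) := by
    have h0 : Filter.Tendsto (fun m : ℕ => (m + 1 : ℝ)⁻¹) Filter.atTop (nhds 0) := by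
      simpa using tendsto_one_div_add_atTop_nhds_zero_nat (𝕜 := ℝ)
    simpa using (h0.const_mul B).pow 2
  have hc : ∀ m, Continuous fun p => 1 - (h m (F p)) ^ 2 := fun m =>
    continuous_const.sub (((hh m).continuous.comp hF.smooth.continuous).pow 2)
  have hlim2 : Filter.Tendsto (fun m : ℕ => ∫ p, (1 - (h m (F p)) ^ 2) ∂(gaussArea F))
      Filter.atTop (nhds 0) := by
    have := tendsto_integral_of_dominated_convergence (μ := gaussArea F)
      (F := fun m p => 1 - (h m (F p)) ^ 2) (f := fun _ => 0) (fun _ => 1)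
      (fun m => (hc m).aestronglyMeasurable) (integrable_const 1)
      (fun m => Filter.Eventually.of_forall fun p => ?_)
      (Filter.Eventually.of_forall fun p => ?_)
    · simpa using this
    · have h1 : 0 ≤ h m (F p) := χ.nonneg
      have h2 : h m (F p) ≤ 1 := χ.le_one
      rw [Real.norm_eq_abs, abs_le]
      constructor <;> nlinarith
    · refine tendsto_const_nhds.congr' ?_
      obtain ⟨k, hk⟩ := exists_nat_ge ‖F p‖
      filter_upwards [Filter.eventually_ge_atTop k] with m hm
      have hmk : (k : ℝ) ≤ m := by exact_mod_cast hm
      have : h m (F p) = 1 := by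
        refine χ.one_of_mem_closedBall ?_
        rw [mem_closedBall_zero_iff, norm_smul, Real.norm_eq_abs,
          abs_of_pos (inv_pos.mpr (hpos m)), inv_mul_le_iff₀ (hpos m)]
        change ‖F p‖ ≤ (m + 1) * 1
        linarith
      simp [this]
  obtain ⟨m, hm1, hm2⟩ := ((hlim1.eventually (gt_mem_nhds hε)).and
    (hlim2.eventually (gt_mem_nhds hε))).exists
  refine ⟨h m ∘ F, (hh m).contMDiff.comp hF.smooth, ?_, fun p => χ.nonneg, fun p => χ.le_one,
    fun p => ?_, hm2.le⟩
  · have hcs : HasCompactSupport (h m) :=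
      χ.hasCompactSupport.comp_smul (inv_ne_zero (hpos m).ne')
    refine HasCompactSupport.intro' (hF.proper.isCompact_preimage hcs.isCompact)
      ((isClosed_tsupport _).preimage hF.smooth.continuous) fun p hp => ?_
    exact image_eq_zero_of_notMem_tsupport (f := h m) hp
  · exact (pow_le_pow_left₀ (norm_nonneg _) (hgrad m p) 2).trans hm1.le

/-- The Gaussian area of a nonempty open set is positive. -/
lemma isOpenPosMeasure : (gaussArea F).IsOpenPosMeasure := by
  refine ⟨fun U hU ⟨q, hq⟩ h0 => ?_⟩
  have h1 : area F U = 0 := by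
    have hac : area F ≪ gaussArea F :=
      withDensity_absolutelyContinuous' hF.measurable_weight.aemeasurable
        (Filter.Eventually.of_forall fun p => by simp [Real.exp_pos])
    exact hac h0
  have h2 : chartArea F q U = 0 := by
    refine le_antisymm ?_ zero_le
    rw [← h1]
    exact le_iSup (chartArea F) q U
  rw [chartArea_apply q hU.measurableSet, lintegral_eq_zero_iff'] at h2
  · set S := (extChartAt (𝓡 n) q).target ∩ (extChartAt (𝓡 n) q).symm ⁻¹' U
    have hSo : IsOpen S := (continuousOn_extChartAt_symm q).isOpen_inter_preimage
      (isOpen_extChartAt_target q) hU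
    have hS : volume S = 0 := by
      have h3 : ∀ᵐ y ∂(volume.restrict S), False := by
        filter_upwards [h2, ae_restrict_mem hSo.measurableSet] with y hy hyS
        have := Coord.density_pos ((hF.isHypersurfaceOn q).injective y hyS.1)
        simp only [Pi.zero_apply, ENNReal.ofReal_eq_zero] at hy
        linarith
      rw [Filter.eventually_false_iff_eq_bot, ae_eq_bot, Measure.restrict_eq_zero] at h3
      exact h3
    have hne : S.Nonempty := ⟨extChartAt (𝓡 n) q q, mem_extChartAt_target q, by
      rw [Set.mem_preimage, extChartAt_to_inv q]; exact hq⟩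
    exact (hSo.measure_pos volume hne).ne' hS
  · exact (hF.aemeasurable_density q).mono_measure
      (Measure.restrict_mono_set _ Set.inter_subset_left)

end IsTwoSidedProperImmersion

end TestSpace

/-! ### The lower bound for the index. -/

section Index

variable {n : ℕ} {M : Type*} [TopologicalSpace M] [ChartedSpace (Euc n) M]
  {F N : M → Euc (n + 1)} [MeasurableSpace M]

lemma Q_zero (F N : M → Euc (n + 1)) : Q F N (fun _ => 0) (fun _ => 0) = 0 := by
  simp [Q]

lemma index_eq_zero_of_isStable (hs : IsStable F N) : index F N = 0 := by
  simp only [index, ENat.iSup_eq_zero]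
  intro W hW
  have : W = ⊥ := by
    rw [Submodule.eq_bot_iff]
    intro u hu
    by_contra hne
    exact absurd (hW.2 u hu hne) (not_lt.mpr (hs u (hW.1 u hu)))
  subst this
  simp

lemma finrank_le_index {W : Submodule ℝ (M → ℝ)} (hW : IsNegative F N W)
    [FiniteDimensional ℝ W] : (Module.finrank ℝ W : ℕ∞) ≤ index F N := by
  refine le_trans (le_of_eq ?_) (le_iSup₂ (f := fun (W : Submodule ℝ (M → ℝ))
    (_ : IsNegative F N W) => Cardinal.toENat (Module.rank ℝ W)) W hW)
  rw [← Module.finrank_eq_rank, Cardinal.toENat_nat]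

variable [IsManifold (𝓡 n) ∞ M] [BorelSpace M] [T2Space M] [SecondCountableTopology M]

namespace IsTwoSidedProperImmersion

variable (hF : IsTwoSidedProperImmersion F N)
include hF

/-- `k` linearly independent functions of the form `⟨N, e⟩ + c`, `c` locally constant and bounded,
give rise to a space of dimension `k - 1` on which the quadratic form is negative. -/
theorem card_le_index_add_one [IsFiniteMeasure (gaussArea F)] {C : ℝ}
    (hC : CurvatureCondition F N C) {ι : Type*} [Fintype ι] (e : ι → Euc (n + 1)) (c : ι → M → ℝ)
    (hc : ∀ i, IsLocallyConstant (c i)) (hb : ∀ i, ∃ B : ℝ, ∀ p, |c i p| ≤ B)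
    (hli : LinearIndependent ℝ fun (i : ι) (p : M) => inner ℝ (N p) (e i) + c i p) :
    (Fintype.card ι : ℕ∞) ≤ index F N + 1 := by
  classical
  set μ := gaussArea F
  choose B hB using hb
  set u : ι → M → ℝ := fun i p => inner ℝ (N p) (e i) + c i p with hu_def
  have hNc : Continuous N := hF.smooth_normal.continuous
  have hu_cont : ∀ i, Continuous (u i) := fun i =>
    (hNc.inner continuous_const).add (hc i).continuous
  set D : ℝ := ∑ i, (‖e i‖ + B i) with hD_def
  have hNe : ∀ p (x : Euc (n + 1)), |inner ℝ (N p) x| ≤ ‖x‖ := fun p x =>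
    (abs_real_inner_le_norm _ _).trans (by rw [hF.unit_normal p, one_mul])
  have hub : ∀ i p, |u i p| ≤ ‖e i‖ + B i := fun i p =>
    (abs_add_le _ _).trans (add_le_add (hNe p _) (hB i p))
  set U : (ι → ℝ) → M → ℝ := fun t p => ∑ i, t i * u i p with hU_def
  have hUc : ∀ t, Continuous (U t) := fun t =>
    continuous_finsetSum _ fun i _ => continuous_const.mul (hu_cont i)
  have hUb : ∀ t p, |U t p| ≤ ‖t‖ * D := by
    intro t p
    rw [hD_def, Finset.mul_sum]
    refine (Finset.abs_sum_le_sum_abs _ _).trans (Finset.sum_le_sum fun i _ => ?_)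
    rw [abs_mul]
    exact mul_le_mul (norm_le_pi_norm t i) (hub i p) (abs_nonneg _) (norm_nonneg _)
  set E : (ι → ℝ) → Euc (n + 1) := fun t => ∑ i, t i • e i with hE_def
  set c' : (ι → ℝ) → M → ℝ := fun t p => ∑ i, t i * c i p with hc'_def
  have hUE : ∀ t p, U t p = inner ℝ (N p) (E t) + c' t p := by
    intro t p
    simp only [hU_def, hu_def, hE_def, hc'_def, inner_sum, real_inner_smul_right, mul_add,
      Finset.sum_add_distrib]
  have hE : ∀ t, ‖E t‖ ≤ ‖t‖ * D := by
    intro t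
    rw [hD_def, Finset.mul_sum]
    refine (norm_sum_le _ _).trans (Finset.sum_le_sum fun i _ => ?_)
    rw [norm_smul]
    -- If M is empty the bounds `B i` may be negative; but then all the functions vanish, against
    -- linear independence.
    have hB0 : ‖e i‖ ≤ ‖e i‖ + B i ∨ IsEmpty M := by
      rcases isEmpty_or_nonempty M with h | ⟨⟨p⟩⟩
      · exact Or.inr h
      · left; linarith [(abs_nonneg _).trans (hB i p)]
    rcases hB0 with h | h
    · exact mul_le_mul (norm_le_pi_norm t i) h (norm_nonneg _) (norm_nonneg _)
    · exfalso
      have := hli.ne_zero i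
      exact this (funext fun p => h.elim p)
  have hc't : ∀ t, IsLocallyConstant (c' t) := by
    intro t
    rw [IsLocallyConstant.iff_eventually_eq]
    intro p
    have : ∀ᶠ x in nhds p, ∀ i, c i x = c i p :=
      Filter.eventually_all.mpr fun i => (hc i).eventually_eq p
    filter_upwards [this] with x hx
    simp [hc'_def, hx]
  have hbi : ∀ g : M → ℝ, Continuous g → (∃ K, ∀ p, |g p| ≤ K) → Integrable g μ :=
    fun g hg ⟨K, hK⟩ => Integrable.of_bound hg.aestronglyMeasurable K
      (Filter.Eventually.of_forall hK)
  set G : (ι → ℝ) → ℝ := fun t => ∫ p, U t p ^ 2 ∂μ with hG_def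
  have hU2i : ∀ t, Integrable (fun p => U t p ^ 2) μ := fun t =>
    hbi _ ((hUc t).pow 2) ⟨(‖t‖ * D) ^ 2, fun p => by
      rw [abs_pow]; exact pow_le_pow_left₀ (abs_nonneg _) (hUb t p) 2⟩
  have hG_cont : Continuous G := by
    have : G = fun t => ∑ i, ∑ j, t i * t j * ∫ p, u i p * u j p ∂μ := by
      ext t
      have hij : ∀ i j, Integrable (fun p => t i * t j * (u i p * u j p)) μ := fun i j =>
        (hbi _ ((hu_cont i).mul (hu_cont j)) ⟨(‖e i‖ + B i) * (‖e j‖ + B j), fun p => by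
          rw [Pi.mul_apply, abs_mul]
          exact mul_le_mul (hub i p) (hub j p) (abs_nonneg _)
            ((abs_nonneg _).trans (hub i p))⟩).const_mul _
      have hpt : ∀ p, U t p ^ 2 = ∑ i, ∑ j, t i * t j * (u i p * u j p) := by
        intro p
        rw [sq, hU_def, Finset.sum_mul_sum]
        exact Finset.sum_congr rfl fun i _ => Finset.sum_congr rfl fun j _ => by ring
      simp only [hG_def, hpt]
      rw [integral_finsetSum _ fun i _ => integrable_finsetSum _ fun j _ => hij i j]
      refine Finset.sum_congr rfl fun i _ => ?_
      rw [integral_finsetSum _ fun j _ => hij i j]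
      exact Finset.sum_congr rfl fun j _ => integral_const_mul _ _
    rw [this]
    fun_prop
  have hG_pos : ∀ t, t ≠ 0 → 0 < G t := by
    intro t ht
    -- A continuous function with vanishing L² norm is zero everywhere because open sets have
    -- positive measure.
    have hop := hF.isOpenPosMeasure
    refine lt_of_le_of_ne (integral_nonneg fun p => sq_nonneg _) fun h0 => ht ?_
    have h1 := (integral_eq_zero_iff_of_nonneg (fun p => sq_nonneg (U t p)) (hU2i t)).mp h0.symm
    have h2 : (fun p => U t p ^ 2) = fun _ => 0 :=
      (((hUc t).pow 2).ae_eq_iff_eq μ continuous_const).mp h1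
    have h3 : ∑ i, t i • u i = 0 := by
      ext p
      have := congrFun h2 p
      simpa [hU_def] using this
    exact funext (Fintype.linearIndependent_iff.mp hli t h3)
  -- The positive definite form G is bounded below on the compact unit sphere of coefficients. This
  -- uniformity allows one cutoff to serve all t.
  obtain ⟨δ, hδ, hδG⟩ : ∃ δ > 0, ∀ t, δ * ‖t‖ ^ 2 ≤ G t := by
    obtain ⟨δ, hδ, h⟩ : ∃ δ > 0, ∀ t ∈ Metric.sphere (0 : ι → ℝ) 1, δ ≤ G t := by
      rcases (Metric.sphere (0 : ι → ℝ) 1).eq_empty_or_nonempty with h | h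
      · exact ⟨1, one_pos, fun t ht => by simp [h] at ht⟩
      · obtain ⟨t₀, ht₀, hmin⟩ := (isCompact_sphere (0 : ι → ℝ) 1).exists_isMinOn h
          hG_cont.continuousOn
        refine ⟨G t₀, hG_pos t₀ ?_, fun t ht => hmin ht⟩
        rintro rfl
        simp at ht₀
    refine ⟨δ, hδ, fun t => ?_⟩
    rcases eq_or_ne t 0 with rfl | ht
    · simpa using integral_nonneg fun p => sq_nonneg (U 0 p)
    · have hn : ‖t‖ ≠ 0 := norm_ne_zero_iff.mpr ht
      have h1 := h (‖t‖⁻¹ • t) (by simp [norm_smul, hn])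
      have h2 : G (‖t‖⁻¹ • t) = (‖t‖⁻¹) ^ 2 * G t := by
        simp only [hG_def]
        rw [← integral_const_mul]
        congr 1; ext p
        rw [← mul_pow]
        congr 1
        simp only [hU_def, Pi.smul_apply, smul_eq_mul, Finset.mul_sum, mul_assoc]
      rw [h2] at h1
      calc δ * ‖t‖ ^ 2 ≤ (‖t‖⁻¹ ^ 2 * G t) * ‖t‖ ^ 2 := by gcongr
        _ = G t := by field_simp
  set m := μ.real Set.univ with hm
  have hm0 : 0 ≤ m := measureReal_nonneg
  -- Per unit of ‖t‖², the gradient term of `Q_cutoff_le` costs at most 2εD²m and the replacement of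
  -- φ²U² by U² at most εD²/2. Together they must stay below ½G(t), that is, below δ/2.
  obtain ⟨ε, hε, hεδ⟩ : ∃ ε > 0, ε * (2 * D ^ 2 * m + D ^ 2 / 2) < δ / 2 := by
    have hK : 0 ≤ 2 * D ^ 2 * m + D ^ 2 / 2 := by positivity
    refine ⟨δ / 2 / (2 * D ^ 2 * m + D ^ 2 / 2 + 1), by positivity, ?_⟩
    rw [div_mul_eq_mul_div, div_lt_iff₀ (by positivity)]
    nlinarith
  obtain ⟨φ, hφ, hφc, hφ0, hφ1, hφg, hφi⟩ := hF.exists_cutoff hε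
  have hneg : ∀ t, t ≠ 0 → Q F N (fun p => φ p * U t p) (fun p => φ p * U t p) < 0 := by
    intro t ht
    have h1 := hF.Q_cutoff_le hC hφ hφc (hc't t) (E t)
    simp only [← hUE] at h1
    refine h1.trans_lt ?_
    have hφcont := hφ.continuous
    have hUct := hUc t
    have hgc := hF.continuous_gradient hφ
    have hi1 : Integrable (fun p => 1 - φ p ^ 2) μ := hbi _ (by fun_prop) ⟨1, fun p => by
      rw [abs_le]; constructor <;> nlinarith [hφ0 p, hφ1 p]⟩
    have hUsq : ∀ p, U t p ^ 2 ≤ ‖t‖ ^ 2 * D ^ 2 := fun p => by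
      rw [← sq_abs, ← mul_pow]; exact pow_le_pow_left₀ (abs_nonneg _) (hUb t p) 2
    have hEsq : ‖E t‖ ^ 2 ≤ ‖t‖ ^ 2 * D ^ 2 := by
      rw [← mul_pow]; exact pow_le_pow_left₀ (norm_nonneg _) (hE t) 2
    have hcpt : ∀ g : M → ℝ, Continuous g → (∀ p, p ∉ tsupport φ → g p = 0) → Integrable g μ :=
      fun g hg h0 => hg.integrable_of_hasCompactSupport
        (HasCompactSupport.intro' hφc.isCompact (isClosed_tsupport φ) h0)
    have hle : ∫ p, (‖gradient F φ p‖ ^ 2 * (U t p ^ 2 + ‖E t‖ ^ 2) -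
        1 / 2 * (φ p * U t p) ^ 2) ∂μ ≤ ∫ p, ((ε * (2 * (‖t‖ ^ 2 * D ^ 2)) +
          (‖t‖ ^ 2 * D ^ 2 / 2) * (1 - φ p ^ 2)) - 1 / 2 * U t p ^ 2) ∂μ := by
      refine integral_mono (hcpt _ (by fun_prop) fun p hp => ?_)
        (((integrable_const _).add (hi1.const_mul _)).sub ((hU2i t).const_mul _)) fun p => ?_
      · rw [gradient_eq_zero_of_notMem_tsupport F hp, image_eq_zero_of_notMem_tsupport hp]
        simp
      · have a1 : ‖gradient F φ p‖ ^ 2 * (U t p ^ 2 + ‖E t‖ ^ 2) ≤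
            ε * (2 * (‖t‖ ^ 2 * D ^ 2)) :=
          mul_le_mul (hφg p) (by linarith [hUsq p]) (by positivity) hε.le
        have a2 : (1 - φ p ^ 2) * U t p ^ 2 ≤ (1 - φ p ^ 2) * (‖t‖ ^ 2 * D ^ 2) :=
          mul_le_mul_of_nonneg_left (hUsq p) (by nlinarith [hφ0 p, hφ1 p])
        have a3 : (φ p * U t p) ^ 2 = U t p ^ 2 - (1 - φ p ^ 2) * U t p ^ 2 := by ring
        simp only [a3]
        linarith
    refine hle.trans_lt ?_
    have hi2 : Integrable (fun p => ε * (2 * (‖t‖ ^ 2 * D ^ 2)) +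
        (‖t‖ ^ 2 * D ^ 2 / 2) * (1 - φ p ^ 2)) μ := (integrable_const _).add (hi1.const_mul _)
    rw [integral_sub hi2 ((hU2i t).const_mul _),
      integral_add (integrable_const _) (hi1.const_mul _), integral_const, integral_const_mul,
      integral_const_mul, smul_eq_mul, ← hm]
    have b1 : (‖t‖ ^ 2 * D ^ 2 / 2) * ∫ p, (1 - φ p ^ 2) ∂μ ≤ (‖t‖ ^ 2 * D ^ 2 / 2) * ε := by
      gcongr
    have b2 := hδG t
    have b3 : 0 < ‖t‖ ^ 2 := by
      have := norm_pos_iff.mpr ht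
      positivity
    have b4 := mul_lt_mul_of_pos_left hεδ b3
    change _ - 1 / 2 * G t < 0
    nlinarith
  set Λ : (ι → ℝ) →ₗ[ℝ] (M → ℝ) := Fintype.linearCombination ℝ fun i p => φ p * u i p with hΛ
  have hΛa : ∀ t, Λ t = fun p => φ p * U t p := by
    intro t
    ext p
    simp only [hΛ, Fintype.linearCombination_apply, Finset.sum_apply, Pi.smul_apply, smul_eq_mul,
      hU_def, Finset.mul_sum]
    exact Finset.sum_congr rfl fun i _ => by ring
  have hiu : ∀ i, Integrable (fun p => φ p * u i p) μ := fun i =>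
    (hφ.continuous.mul (hu_cont i)).integrable_of_hasCompactSupport (hφc.mul_right (f' := u i))
  set ℓ : (ι → ℝ) →ₗ[ℝ] ℝ := Fintype.linearCombination ℝ fun i => ∫ p, φ p * u i p ∂μ with hℓ
  have hℓa : ∀ t, ∫ p, Λ t p ∂μ = ℓ t := by
    intro t
    simp only [hΛ, hℓ, Fintype.linearCombination_apply, Finset.sum_apply, Pi.smul_apply,
      smul_eq_mul]
    rw [integral_finsetSum _ fun i _ => (hiu i).const_mul _]
    exact Finset.sum_congr rfl fun i _ => integral_const_mul _ _
  -- Truncation loses no dimension: a nonzero t gives a negative value of Q, so its image is not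
  -- zero.
  have hΛinj : Function.Injective Λ := by
    rw [← LinearMap.ker_eq_bot, LinearMap.ker_eq_bot']
    intro t ht
    by_contra hne
    have h1 := hneg t hne
    rw [← hΛa, ht] at h1
    exact h1.ne (Q_zero F N)
  -- The mean value condition is a single linear equation in t, so its kernel has codimension at
  -- most one. This is the source of the + 1.
  set W := (LinearMap.ker ℓ).map Λ with hW
  have hWneg : IsNegative F N W := by
    constructor
    · rintro _ ⟨t, ht, rfl⟩
      refine ⟨⟨?_, ?_⟩, ?_⟩
      · rw [hΛa]
        have : U t = fun p => inner ℝ (N p) (E t) + c' t p := funext (hUE t)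
        rw [this]
        exact hφ.mul ((hF.contMDiff_inner_normal _).add
          (contMDiff_of_isLocallyConstant (hc't t)))
      · rw [hΛa]; exact hφc.mul_right (f' := U t)
      · rw [hℓa]; exact ht
    · rintro _ ⟨t, _, rfl⟩ hne
      rw [hΛa]
      refine hneg t ?_
      rintro rfl
      exact hne (map_zero Λ)
  have hrank : Fintype.card ι ≤ Module.finrank ℝ W + 1 := by
    have h1 := ℓ.finrank_range_add_finrank_ker
    have h2 : Module.finrank ℝ (LinearMap.range ℓ) ≤ 1 := by
      simpa using (LinearMap.range ℓ).finrank_le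
    have h3 : Module.finrank ℝ W = Module.finrank ℝ (LinearMap.ker ℓ) :=
      (LinearEquiv.finrank_eq (Submodule.equivMapOfInjective Λ hΛinj _)).symm
    rw [Module.finrank_fintype_fun_eq_card] at h1
    omega
  calc (Fintype.card ι : ℕ∞) ≤ ((Module.finrank ℝ W + 1 : ℕ) : ℕ∞) := by exact_mod_cast hrank
    _ = (Module.finrank ℝ W : ℕ∞) + 1 := by push_cast; rfl
    _ ≤ _ := by gcongr; exact finrank_le_index hWneg

end IsTwoSidedProperImmersion

end Index

/-! ### Hypersurfaces with constant normal. -/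

section Plane

variable {n : ℕ}

/-- Isometric coordinates on the hyperplane orthogonal to a unit vector. -/
lemma exists_plane_coordinates {v : Euc (n + 1)} (hv : ‖v‖ = 1) :
    ∃ (T : Euc n →ₗᵢ[ℝ] Euc (n + 1)) (π : Euc (n + 1) →L[ℝ] Euc n),
      (∀ y, π (T y) = y) ∧ (∀ x, T (π x) = x - inner ℝ v x • v) ∧ ∀ y, inner ℝ v (T y) = 0 := by
  have hv0 : v ≠ 0 := fun h => by simp [h] at hv
  have hfr : Fact (Module.finrank ℝ (Euc (n + 1)) = n + 1) := ⟨by simp⟩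
  let b := OrthonormalBasis.fromOrthogonalSpanSingleton (𝕜 := ℝ) n hv0
  let S := (Submodule.span ℝ {v})ᗮ
  refine ⟨S.subtypeₗᵢ.comp b.repr.symm.toLinearIsometry,
    b.repr.toContinuousLinearEquiv.toContinuousLinearMap.comp S.orthogonalProjectionOnto, ?_, ?_, ?_⟩
  · intro y
    simp [S]
  · intro x
    simp only [LinearIsometry.coe_comp, Function.comp_apply, ContinuousLinearMap.comp_apply]
    change ((b.repr.symm (b.repr (S.orthogonalProjectionOnto x)) : S) : Euc (n + 1)) = _
    rw [LinearIsometryEquiv.symm_apply_apply]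
    have h1 : ((S.orthogonalProjectionOnto x : S) : Euc (n + 1)) =
        x - (Submodule.span ℝ {v}).starProjection x :=
      Submodule.starProjection_orthogonal_val (K := Submodule.span ℝ {v}) x
    rw [h1, Submodule.starProjection_unit_singleton ℝ hv]
  · intro y
    exact Submodule.mem_orthogonal_singleton_iff_inner_right.mp (b.repr.symm y).2

end Plane

section Covering

/-- A proper local homeomorphism from a nonempty connected Hausdorff space to a simply connected
space is bijective. -/
lemma bijective_of_isProperMap_of_isLocalHomeomorph {E X : Type*} [TopologicalSpace E]
    [TopologicalSpace X] [T2Space E] [T1Space X] [ConnectedSpace E] [SimplyConnectedSpace X]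
    [LocallyPathConnectedSpace X] {f : E → X} (hp : IsProperMap f) (hl : IsLocalHomeomorph f) :
    Function.Bijective f := by
  -- Fibres are compact by properness and discrete by local injectivity, hence finite, and a closed
  -- local homeomorphism with finite fibres is a covering. Simple connectedness gives a section s
  -- with s (f e₀) = e₀; then s ∘ f and the identity are lifts of f that agree at e₀, so they
  -- coincide.
  have hfin : ∀ x, (f ⁻¹' {x}).Finite := by
    intro x
    refine (hp.isCompact_preimage isCompact_singleton).finite ?_
    refine IsDiscrete.of_openPartialHomeomorph (x := x) f subset_rfl fun e _ => ?_
    obtain ⟨φ, hφ, rfl⟩ := hl e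
    exact ⟨φ, hφ, rfl⟩
  have hcov : IsCoveringMap f := by
    rw [isCoveringMap_iff_isCoveringMapOn_univ]
    refine hp.isClosedMap.isCoveringMapOn_of_isLocalHomeomorphOn (fun x _ => hfin x) ?_
    simpa using hl.isLocalHomeomorphOn
  obtain ⟨e₀⟩ : Nonempty E := inferInstance
  obtain ⟨s, ⟨hs0, hs⟩, _⟩ := hcov.existsUnique_continuousMap_lifts (ContinuousMap.id X) (f e₀) e₀
    rfl
  have hsf : (s ∘ f : E → E) = id := by
    refine hcov.eq_of_comp_eq (s.continuous.comp hp.continuous) continuous_id ?_ e₀ hs0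
    ext x
    exact congrFun hs (f x)
  exact ⟨Function.LeftInverse.injective (g := s) fun x => congrFun hsf x,
    fun x => ⟨s x, congrFun hs x⟩⟩

end Covering

section ConstantNormal

variable {n : ℕ} {M : Type*} [TopologicalSpace M] [ChartedSpace (Euc n) M]
  [IsManifold (𝓡 n) ∞ M] {F N : M → Euc (n + 1)}

lemma eventually_eq_of_mfderiv_eq_zero {u : M → ℝ} (hu : ContMDiff (𝓡 n) 𝓘(ℝ, ℝ) ∞ u) {U : Set M}
    (hU : IsOpen U) (h0 : ∀ x ∈ U, mfderiv (𝓡 n) 𝓘(ℝ, ℝ) u x = 0) {p : M} (hp : p ∈ U) :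
    ∀ᶠ x in nhds p, u x = u p := by
  set e := extChartAt (𝓡 n) p
  have hS : IsOpen (e.target ∩ e.symm ⁻¹' U) :=
    (continuousOn_extChartAt_symm p).isOpen_inter_preimage (isOpen_extChartAt_target p) hU
  have hpS : e p ∈ e.target ∩ e.symm ⁻¹' U :=
    ⟨mem_extChartAt_target p, by rw [Set.mem_preimage, extChartAt_to_inv p]; exact hp⟩
  obtain ⟨r, hr, hball⟩ := Metric.isOpen_iff.mp hS _ hpS
  have hd : DifferentiableOn ℝ (inChart (n := n) u p) (Metric.ball (e p) r) := fun y hy =>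
    ((contDiffAt_inChart hu (hball hy).1).differentiableAt (by simp)).differentiableWithinAt
  have hd0 : Set.EqOn (fderiv ℝ (inChart (n := n) u p)) 0 (Metric.ball (e p) r) := by
    intro y hy
    ext w
    rw [fderiv_inChart (hball hy).1 (hu.mdifferentiable (by simp) _), h0 _ (hball hy).2]
    rfl
  have hsrc : e.source ∈ nhds p := extChartAt_source_mem_nhds p
  have hcont : ContinuousAt e p := continuousAt_extChartAt p
  filter_upwards [hsrc, hcont.preimage_mem_nhds (Metric.ball_mem_nhds _ hr)] with x hx hxb
  have h1 := Metric.isOpen_ball.is_const_of_fderiv_eq_zero (convex_ball (e p) r).isPreconnected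
    hd hd0 hxb (Metric.mem_ball_self hr)
  simp only [inChart, Function.comp_apply] at h1
  rwa [e.left_inv hx, extChartAt_to_inv p] at h1

namespace IsTwoSidedProperImmersion

variable (hF : IsTwoSidedProperImmersion F N)
include hF

omit [IsManifold (𝓡 n) ∞ M] in
lemma contMDiff_inner_position (v : Euc (n + 1)) :
    ContMDiff (𝓡 n) 𝓘(ℝ, ℝ) ∞ (fun p => inner ℝ v (F p)) :=
  (innerSL ℝ v).contMDiff.comp hF.smooth

omit [IsManifold (𝓡 n) ∞ M] in
lemma mfderiv_inner_position (v : Euc (n + 1)) (p : M) (w : TangentSpace (𝓡 n) p) :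
    (mfderiv (𝓡 n) 𝓘(ℝ, ℝ) (fun p => inner ℝ v (F p)) p w : ℝ) =
      inner ℝ v (mfderiv (𝓡 n) (𝓡 (n + 1)) F p w : Euc (n + 1)) := by
  have h := mfderiv_comp p (I := 𝓡 n) (I' := 𝓡 (n + 1)) (I'' := 𝓘(ℝ, ℝ)) (g := innerSL ℝ v) (f := F)
    (innerSL ℝ v).mdifferentiableAt
    (hF.smooth.mdifferentiable (by simp) p)
  have h' : (fun p => inner ℝ v (F p)) = innerSL ℝ v ∘ F := rfl
  rw [h', h, mfderiv_eq_fderiv, (innerSL ℝ v).fderiv]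
  rfl

/-- Orthogonal projection along the normal is a local homeomorphism. -/
lemma exists_openPartialHomeomorph {p : M} {T : Euc n →ₗᵢ[ℝ] Euc (n + 1)}
    {π : Euc (n + 1) →L[ℝ] Euc n} (hT : ∀ x, T (π x) = x - inner ℝ (N p) x • N p) :
    ∃ e : OpenPartialHomeomorph M (Euc n), p ∈ e.source ∧ Set.EqOn (π ∘ F) e e.source ∧
      ContMDiffAt 𝓘(ℝ, Euc n) (𝓡 n) ∞ e.symm (e p) := by
  have hS := hF.isHypersurfaceOn p
  set y := extChartAt (𝓡 n) p p with hy
  have hyT : y ∈ (extChartAt (𝓡 n) p).target := mem_extChartAt_target p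
  have hNp : inChart N p y = N p := inChart_self N p
  set L : Euc n →L[ℝ] Euc n := π.comp (fderiv ℝ (inChart F p) y) with hL
  have hinj : Function.Injective L := by
    intro v w hvw
    refine hS.injective y hyT ?_
    -- Tangent vectors at p are orthogonal to N p, so projection followed by `T` returns them
    -- unchanged.
    have h1 : ∀ v, T (L v) = fderiv ℝ (inChart F p) y v := by
      intro v
      rw [hL, ContinuousLinearMap.comp_apply, hT, real_inner_comm, ← hNp, hS.orthogonal y hyT,
        zero_smul, sub_zero]
    rw [← h1, ← h1, hvw]
  let L' : Euc n ≃L[ℝ] Euc n :=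
    (LinearEquiv.ofInjectiveEndo L.toLinearMap hinj).toContinuousLinearEquiv
  have hL' : (L' : Euc n →L[ℝ] Euc n) = L := by ext1 v; rfl
  have hcd : ContDiffAt ℝ ∞ (π ∘ inChart F p) y :=
    π.contDiff.contDiffAt.comp y (hS.contDiffAt hyT)
  have hfd : HasFDerivAt (π ∘ inChart F p) (L' : Euc n →L[ℝ] Euc n) y := by
    rw [hL']
    exact π.hasFDerivAt.comp y ((hS.contDiffAt hyT).differentiableAt (by simp)).hasFDerivAt
  let e₂ := hcd.toOpenPartialHomeomorph _ hfd (by simp)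
  let e₁ := chartAt (Euc n) p
  have hcoe : ∀ x, extChartAt (𝓡 n) p x = e₁ x := fun x => rfl
  have hcoe' : ∀ x, (extChartAt (𝓡 n) p).symm x = e₁.symm x := fun x => rfl
  have hmem : p ∈ (e₁.trans e₂).source := by
    rw [OpenPartialHomeomorph.trans_source]
    refine ⟨mem_chart_source _ p, ?_⟩
    exact hcd.mem_toOpenPartialHomeomorph_source hfd (by simp)
  refine ⟨e₁.trans e₂, hmem, ?_, ?_⟩
  · intro x hx
    rw [OpenPartialHomeomorph.trans_source] at hx
    change π (F x) = π (F (e₁.symm (e₁ x)))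
    rw [e₁.left_inv hx.1]
  · have h2 : ContDiffAt ℝ ∞ e₂.symm ((π ∘ inChart F p) y) := hcd.to_localInverse hfd (by simp)
    have h3 : e₂.symm ((π ∘ inChart F p) y) = y :=
      e₂.left_inv (hcd.mem_toOpenPartialHomeomorph_source hfd (by simp))
    have h1 : ContMDiffAt 𝓘(ℝ, Euc n) (𝓡 n) ∞ (extChartAt (𝓡 n) p).symm
        (e₂.symm ((π ∘ inChart F p) y)) := by
      rw [h3]
      exact (contMDiffOn_extChartAt_symm p).contMDiffAt ((isOpen_extChartAt_target p).mem_nhds hyT)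
    exact h1.comp _ h2.contMDiffAt

/-- A connected component on which the normal is constant is a hyperplane. -/
theorem isHyperplaneOn_of_normal_eq [T2Space M] {U : Set M} (hU : IsClopen U)
    (hUc : IsConnected U) {v : Euc (n + 1)} (hN : ∀ p ∈ U, N p = v) : IsHyperplaneOn F U := by
  obtain ⟨p₀, hp₀⟩ := hUc.nonempty
  have hv : ‖v‖ = 1 := by rw [← hN p₀ hp₀]; exact hF.unit_normal p₀
  obtain ⟨T, π, hπT, hTπ, hvT⟩ := exists_plane_coordinates hv
  have hconn : ConnectedSpace U := isConnected_iff_connectedSpace.mp hUc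
  set c := inner ℝ v (F p₀) with hc
  -- The height ⟨v, F⟩ has differential ⟨N, dF⟩ = 0 on U, and U is connected.
  have hconst : ∀ p ∈ U, inner ℝ v (F p) = c := by
    have hloc : IsLocallyConstant (fun p : U => inner ℝ v (F p)) := by
      rw [IsLocallyConstant.iff_eventually_eq]
      intro p
      have h := eventually_eq_of_mfderiv_eq_zero (hF.contMDiff_inner_position v) hU.isOpen
        (fun x hx => by
          ext w
          have := hF.mfderiv_inner_position v x w
          refine this.trans ?_
          rw [← hN x hx]
          exact (real_inner_comm _ _).trans (hF.orthogonal x w)) p.2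
      exact continuous_subtype_val.continuousAt.eventually h
    intro p hp
    exact hloc.apply_eq_of_preconnectedSpace ⟨p, hp⟩ ⟨p₀, hp₀⟩
  have hFeq : ∀ p ∈ U, F p = T (π (F p)) + c • v := by
    intro p hp
    rw [hTπ, hconst p hp, sub_add_cancel]
  -- F on U in Euclidean coordinates of the hyperplane. It is proper because U is closed, and a
  -- local homeomorphism because U is open and the projection is along the normal.
  set g : U → Euc n := fun p => π (F p) with hg
  have hgc : Continuous g := π.continuous.comp (hF.smooth.continuous.comp continuous_subtype_val)
  have hgp : IsProperMap g := by
    refine isProperMap_of_comp_of_inj (g := fun y => T y + c • v) hgc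
      (T.continuous.add continuous_const) ?_ ?_
    · have : (fun y => T y + c • v) ∘ g = F ∘ Subtype.val := by
        ext1 p; exact (hFeq p p.2).symm
      rw [this]
      exact hF.proper.comp hU.isClosed.isClosedEmbedding_subtypeVal.isProperMap
    · intro y z hyz
      exact T.injective (add_right_cancel hyz)
  have hgl : IsLocalHomeomorph g := by
    have h1 : IsLocalHomeomorphOn (π ∘ F) U := by
      refine IsLocalHomeomorphOn.mk _ _ fun p hp => ?_
      obtain ⟨e, he1, he2, _⟩ := hF.exists_openPartialHomeomorph (p := p) (T := T) (π := π)
        (by rw [hN p hp]; exact hTπ)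
      exact ⟨e, he1, he2⟩
    rw [isLocalHomeomorph_iff_isLocalHomeomorphOn_univ]
    exact h1.comp hU.isOpen.isOpenEmbedding_subtypeVal.isLocalHomeomorph.isLocalHomeomorphOn
      (fun p _ => p.2)
  obtain ⟨hinj, hsurj⟩ := bijective_of_isProperMap_of_isLocalHomeomorph hgp hgl
  refine ⟨fun p hp q hq hpq => ?_, v, c, fun h => by simp [h] at hv, ?_⟩
  · have := @hinj ⟨p, hp⟩ ⟨q, hq⟩ (by simp only [hg, hpq])
    exact congrArg Subtype.val this
  · ext x
    constructor
    · rintro ⟨p, hp, rfl⟩; exact hconst p hp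
    · intro hx
      obtain ⟨⟨p, hp⟩, hgx⟩ := hsurj (π x)
      refine ⟨p, hp, ?_⟩
      have hgx' : π (F p) = π x := hgx
      have hx' : inner ℝ v x = c := hx
      rw [hFeq p hp, hgx', hTπ, hx', sub_add_cancel]

end IsTwoSidedProperImmersion

end ConstantNormal

/-! ### The Gaussian measure and its Poincaré inequality. -/

section GaussianPoincare

variable {n : ℕ}

/-- The measure `e^{-|y|²/4} dy` on `ℝⁿ`. -/
def gaussMeasure (n : ℕ) : Measure (Euc n) :=
  volume.withDensity fun y => ENNReal.ofReal (Real.exp (-‖y‖ ^ 2 / 4))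

lemma integrable_exp_neg_mul_sq_norm {b : ℝ} (hb : 0 < b) :
    Integrable fun y : Euc n => Real.exp (-b * ‖y‖ ^ 2) := by
  have h := (GaussianFourier.integrable_cexp_neg_mul_sq_norm_add (V := Euc n)
    (b := (b : ℂ)) (by simpa using hb) 0 0).re
  refine h.congr (Filter.Eventually.of_forall fun y => ?_)
  simp only [zero_mul, add_zero]
  rw [show -(b : ℂ) * (‖y‖ : ℂ) ^ 2 = ((-b * ‖y‖ ^ 2 : ℝ) : ℂ) by push_cast; ring,
    ← Complex.ofReal_exp]
  rfl

lemma measurable_gaussWeight :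
    Measurable fun y : Euc n => ENNReal.ofReal (Real.exp (-‖y‖ ^ 2 / 4)) := by
  fun_prop

lemma integrable_gaussMeasure_iff {g : Euc n → ℝ} :
    Integrable g (gaussMeasure n) ↔ Integrable fun y => g y * Real.exp (-‖y‖ ^ 2 / 4) := by
  rw [gaussMeasure, integrable_withDensity_iff measurable_gaussWeight
    (Filter.Eventually.of_forall fun _ => ENNReal.ofReal_lt_top)]
  simp only [ENNReal.toReal_ofReal (Real.exp_pos _).le]

lemma integral_gaussMeasure (g : Euc n → ℝ) :
    ∫ y, g y ∂gaussMeasure n = ∫ y, g y * Real.exp (-‖y‖ ^ 2 / 4) := by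
  rw [gaussMeasure, integral_withDensity_eq_integral_toReal_smul measurable_gaussWeight
    (Filter.Eventually.of_forall fun _ => ENNReal.ofReal_lt_top)]
  simp only [ENNReal.toReal_ofReal (Real.exp_pos _).le, smul_eq_mul, mul_comm]

instance : IsFiniteMeasure (gaussMeasure n) := by
  have h : Integrable (fun _ : Euc n => (1 : ℝ)) (gaussMeasure n) := by
    rw [integrable_gaussMeasure_iff]
    refine (integrable_exp_neg_mul_sq_norm (n := n) (b := 1 / 4) (by norm_num)).congr
      (Filter.Eventually.of_forall fun y => ?_)
    simp only [one_mul]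
    ring_nf
  rcases integrable_const_iff.1 h with h | h
  · exact absurd h one_ne_zero
  · exact h

lemma integrable_norm_gaussMeasure : Integrable (fun y : Euc n => ‖y‖) (gaussMeasure n) := by
  rw [integrable_gaussMeasure_iff]
  refine ((integrable_exp_neg_mul_sq_norm (n := n) (b := 1 / 8) (by norm_num)).const_mul 2).mono'
    (by fun_prop) (Filter.Eventually.of_forall fun y => ?_)
  rw [Real.norm_of_nonneg (mul_nonneg (norm_nonneg _) (Real.exp_pos _).le)]
  -- Half of the Gaussian exponent absorbs the factor ‖y‖.
  have h1 : ‖y‖ ≤ 2 * Real.exp (‖y‖ ^ 2 / 8) := by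
    nlinarith [Real.add_one_le_exp (‖y‖ ^ 2 / 8), sq_nonneg (‖y‖ - 4)]
  calc ‖y‖ * Real.exp (-‖y‖ ^ 2 / 4)
      ≤ 2 * Real.exp (‖y‖ ^ 2 / 8) * Real.exp (-‖y‖ ^ 2 / 4) :=
        mul_le_mul_of_nonneg_right h1 (Real.exp_pos _).le
    _ = 2 * Real.exp (-(1 / 8) * ‖y‖ ^ 2) := by
        rw [mul_assoc, ← Real.exp_add]
        ring_nf

lemma gaussMeasure_univ_ne_zero : gaussMeasure n Set.univ ≠ 0 := by
  rw [gaussMeasure, withDensity_apply _ MeasurableSet.univ, Measure.restrict_univ]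
  intro h
  rw [lintegral_eq_zero_iff measurable_gaussWeight] at h
  have h2 : ∀ᵐ _ : Euc n, False := by
    filter_upwards [h] with y hy
    simp only [Pi.zero_apply, ENNReal.ofReal_eq_zero] at hy
    exact absurd hy (not_le.2 (Real.exp_pos _))
  rw [Filter.eventually_false_iff_eq_bot, ae_eq_bot] at h2
  exact NeZero.ne (volume : Measure (Euc n)) h2

lemma gaussMeasure_prod : (gaussMeasure n).prod (gaussMeasure n) =
    (volume.prod volume : Measure (Euc n × Euc n)).withDensity
      fun z => ENNReal.ofReal (Real.exp (-(‖z.1‖ ^ 2 + ‖z.2‖ ^ 2) / 4)) := by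
  rw [gaussMeasure, prod_withDensity measurable_gaussWeight measurable_gaussWeight]
  congr 1
  funext z
  rw [← ENNReal.ofReal_mul (Real.exp_pos _).le, ← Real.exp_add]
  ring_nf

lemma rotation_neg_rotation (θ : ℝ) (z : Euc n × Euc n) :
    ContinuousLinearMap.rotation (-θ) (ContinuousLinearMap.rotation θ z) = z := by
  have h := Real.sin_sq_add_cos_sq θ
  simp only [ContinuousLinearMap.rotation_apply, Real.cos_neg, Real.sin_neg]
  ext i
  · simp only [PiLp.add_apply, PiLp.smul_apply, smul_eq_mul]
    linear_combination z.1 i * h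
  · simp only [PiLp.add_apply, PiLp.smul_apply, smul_eq_mul]
    linear_combination z.2 i * h

lemma norm_sq_rotation (θ : ℝ) (z : Euc n × Euc n) :
    ‖(ContinuousLinearMap.rotation θ z).1‖ ^ 2 + ‖(ContinuousLinearMap.rotation θ z).2‖ ^ 2 =
      ‖z.1‖ ^ 2 + ‖z.2‖ ^ 2 := by
  have h := Real.sin_sq_add_cos_sq θ
  simp only [ContinuousLinearMap.rotation_apply, norm_add_sq_real, norm_smul, inner_smul_left,
    inner_smul_right, mul_pow, Real.norm_eq_abs, sq_abs, abs_neg]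
  simp only [conj_trivial]
  linear_combination (‖z.1‖ ^ 2 + ‖z.2‖ ^ 2) * h

/-- The product of two Gaussian measures is invariant under rotations. -/
lemma measurePreserving_rotation (θ : ℝ) :
    MeasurePreserving (ContinuousLinearMap.rotation (E := Euc n) θ)
      ((gaussMeasure n).prod (gaussMeasure n)) ((gaussMeasure n).prod (gaussMeasure n)) := by
  set R := ContinuousLinearMap.rotation (E := Euc n) θ with hR
  have hRm : Measurable R := R.continuous.measurable
  refine ⟨hRm, ?_⟩
  have hbij : Function.Bijective R :=
    ⟨Function.LeftInverse.injective (g := ContinuousLinearMap.rotation (-θ))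
      (rotation_neg_rotation θ),
     Function.RightInverse.surjective (g := ContinuousLinearMap.rotation (-θ))
      fun z => by simpa using rotation_neg_rotation (-θ) z⟩
  have hdet : LinearMap.det (R : (Euc n × Euc n) →ₗ[ℝ] Euc n × Euc n) ≠ 0 :=
    ((LinearEquiv.ofBijective (R : (Euc n × Euc n) →ₗ[ℝ] Euc n × Euc n) hbij).isUnit_det').ne_zero
  have hmap := Measure.map_linearMap_addHaar_eq_smul_addHaar
    (volume.prod volume : Measure (Euc n × Euc n)) hdet
  set c : ENNReal := ENNReal.ofReal
    |(LinearMap.det (R : (Euc n × Euc n) →ₗ[ℝ] Euc n × Euc n))⁻¹| with hc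
  have hg : Measurable fun z : Euc n × Euc n =>
      ENNReal.ofReal (Real.exp (-(‖z.1‖ ^ 2 + ‖z.2‖ ^ 2) / 4)) := by fun_prop
  have hmain : (((gaussMeasure n).prod (gaussMeasure n)).map R) =
      c • (gaussMeasure n).prod (gaussMeasure n) := by
    rw [gaussMeasure_prod]
    ext s hs
    rw [Measure.map_apply hRm hs, withDensity_apply _ (hRm hs), Measure.smul_apply,
      withDensity_apply _ hs, smul_eq_mul]
    calc _ = ∫⁻ z in R ⁻¹' s, ENNReal.ofReal
            (Real.exp (-(‖(R z).1‖ ^ 2 + ‖(R z).2‖ ^ 2) / 4)) ∂(volume.prod volume) := by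
          simp only [hR, norm_sq_rotation]
      _ = ∫⁻ z in s, ENNReal.ofReal (Real.exp (-(‖z.1‖ ^ 2 + ‖z.2‖ ^ 2) / 4))
            ∂((volume.prod volume).map R) := (setLIntegral_map hs hg hRm).symm
      _ = _ := by
          erw [hmap]
          rw [Measure.restrict_smul, lintegral_smul_measure, smul_eq_mul]
  -- Push-forward preserves the total mass, which is finite and nonzero. Hence the factor c is one,
  -- and the determinant of the rotation need not be computed.
  have hu := congrArg (fun μ => μ Set.univ) hmain
  simp only [Measure.map_apply hRm MeasurableSet.univ, Set.preimage_univ, Measure.smul_apply,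
    smul_eq_mul] at hu
  have hpos : ((gaussMeasure n).prod (gaussMeasure n)) Set.univ ≠ 0 := by
    rw [← Set.univ_prod_univ, Measure.prod_prod]
    exact mul_ne_zero gaussMeasure_univ_ne_zero gaussMeasure_univ_ne_zero
  have hc1 : c = 1 := by
    have := (ENNReal.mul_left_inj hpos (measure_ne_top _ _)).1 (hu.symm.trans (one_mul _).symm)
    exact this
  rw [hmain, hc1, one_smul]

/-- Integration by parts against the Gaussian measure. -/
lemma integral_mul_inner_gaussMeasure {h : Euc n → ℝ} (hh : ContDiff ℝ 1 h) {B K : ℝ}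
    (hB : ∀ y, |h y| ≤ B) (hK : ∀ y, ‖fderiv ℝ h y‖ ≤ K) (v : Euc n) :
    ∫ y, h y * inner ℝ v y ∂gaussMeasure n = 2 * ∫ y, fderiv ℝ h y v ∂gaussMeasure n := by
  have hw : ∀ y : Euc n, HasFDerivAt (fun y : Euc n => Real.exp (-‖y‖ ^ 2 / 4))
      (Real.exp (-‖y‖ ^ 2 / 4) • ((-1 / 4 : ℝ) • ((2 : ℝ) • (innerSL ℝ y)))) y := fun y => by
    have h1 := ((hasStrictFDerivAt_norm_sq y).hasFDerivAt.const_mul (-1 / 4 : ℝ)).exp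
    convert! h1 using 1
    · funext z; ring_nf
    · congr 2; ring_nf
      simp [two_smul]
  have hw' : ∀ y : Euc n, fderiv ℝ (fun y : Euc n => Real.exp (-‖y‖ ^ 2 / 4)) y v =
      -(1 / 2) * (inner ℝ v y * Real.exp (-‖y‖ ^ 2 / 4)) := fun y => by
    rw [(hw y).fderiv]
    simp [real_inner_comm]
    ring
  have hdc : Continuous (fderiv ℝ h) := hh.continuous_fderiv one_ne_zero
  have hi1 : Integrable (fun y => h y * inner ℝ v y) (gaussMeasure n) := by
    refine (integrable_norm_gaussMeasure.const_mul (B * ‖v‖)).mono'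
      (by have := hh.continuous; exact (by fun_prop : Continuous _).aestronglyMeasurable)
      (Filter.Eventually.of_forall fun y => ?_)
    rw [norm_mul, mul_assoc]
    exact mul_le_mul (hB y) (norm_inner_le_norm v y) (norm_nonneg _)
      ((abs_nonneg _).trans (hB y))
  have hi2 : Integrable (fun y => fderiv ℝ h y v) (gaussMeasure n) := by
    refine (integrable_const (K * ‖v‖)).mono'
      ((by fun_prop : Continuous _).aestronglyMeasurable)
      (Filter.Eventually.of_forall fun y => ?_)
    exact ((fderiv ℝ h y).le_opNorm v).trans (by gcongr; exact hK y)
  have hi3 : Integrable h (gaussMeasure n) :=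
    (integrable_const B).mono' hh.continuous.aestronglyMeasurable (Filter.Eventually.of_forall hB)
  have key := integral_mul_fderiv_eq_neg_fderiv_mul_of_integrable (μ := volume) (f := h)
    (g := fun y : Euc n => Real.exp (-‖y‖ ^ 2 / 4)) (v := v)
    (integrable_gaussMeasure_iff.1 hi2)
    (by
      simp only [hw']
      refine ((integrable_gaussMeasure_iff.1 hi1).const_mul (-(1 / 2))).congr
        (Filter.Eventually.of_forall fun y => ?_)
      simp only
      ring)
    (integrable_gaussMeasure_iff.1 hi3)
    (fun y _ => hh.differentiable one_ne_zero y) (fun y _ => (hw y).differentiableAt)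
  simp only [hw'] at key
  rw [integral_gaussMeasure, integral_gaussMeasure]
  have e : (fun y => h y * (-(1 / 2) * (inner ℝ v y * Real.exp (-‖y‖ ^ 2 / 4)))) =
      fun y => -(1 / 2) * (h y * inner ℝ v y * Real.exp (-‖y‖ ^ 2 / 4)) := by
    funext y; ring
  rw [e, integral_const_mul] at key
  linarith

end GaussianPoincare

section GaussianPoincare

variable {n : ℕ}

lemma integrable_gaussMeasure_prod {g : Euc n × Euc n → ℝ} (hg : Continuous g) {C : ℝ}
    (hC : ∀ z, |g z| ≤ C * (1 + ‖z.1‖ + ‖z.2‖)) :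
    Integrable g ((gaussMeasure n).prod (gaussMeasure n)) := by
  have h1 : Integrable (fun z : Euc n × Euc n => 1 + ‖z.1‖ + ‖z.2‖)
      ((gaussMeasure n).prod (gaussMeasure n)) :=
    ((integrable_const 1).add (integrable_norm_gaussMeasure.comp_fst _)).add
      (integrable_norm_gaussMeasure.comp_snd _)
  exact (h1.const_mul C).mono' hg.aestronglyMeasurable (Filter.Eventually.of_forall hC)

/-- The derivative of `θ ↦ ∫∫ f(x) f(x cos θ + y sin θ)`, bounded below by the Dirichlet energy. -/
lemma exists_hasDerivAt_integral_rotation {f : Euc n → ℝ} (hf : ContDiff ℝ 1 f)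
    (hs : HasCompactSupport f) (θ : ℝ) (hθ : 0 ≤ Real.sin θ) :
    ∃ D, HasDerivAt (fun t => ∫ z, f z.1 * f (Real.cos t • z.1 + Real.sin t • z.2)
        ∂(gaussMeasure n).prod (gaussMeasure n)) D θ ∧
      -(2 * Real.sin θ * ((gaussMeasure n).real Set.univ *
        ∫ y, ‖fderiv ℝ f y‖ ^ 2 ∂gaussMeasure n)) ≤ D := by
  obtain ⟨B, hB⟩ := hs.exists_bound_of_continuous hf.continuous
  have hdc : Continuous (fderiv ℝ f) := hf.continuous_fderiv one_ne_zero
  obtain ⟨K, hK⟩ := (hs.fderiv ℝ).exists_bound_of_continuous hdc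
  have hfc := hf.continuous
  have hB0 : 0 ≤ B := (norm_nonneg _).trans (hB 0)
  have hK0 : 0 ≤ K := (norm_nonneg _).trans (hK 0)
  set γ := gaussMeasure n with hγ
  set c := Real.cos θ with hcdef
  set s := Real.sin θ with hsdef
  have hcs : s ^ 2 + c ^ 2 = 1 := Real.sin_sq_add_cos_sq θ
  have hnorm : ∀ (t : ℝ) (z : Euc n × Euc n),
      ‖-Real.sin t • z.1 + Real.cos t • z.2‖ ≤ 1 + ‖z.1‖ + ‖z.2‖ := fun t z => by
    refine (norm_add_le _ _).trans ?_
    rw [norm_smul, norm_smul, norm_neg, Real.norm_eq_abs, Real.norm_eq_abs]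
    have h1 := mul_le_mul_of_nonneg_right (Real.abs_sin_le_one t) (norm_nonneg z.1)
    have h2 := mul_le_mul_of_nonneg_right (Real.abs_cos_le_one t) (norm_nonneg z.2)
    linarith
  have hder := hasDerivAt_integral_of_dominated_loc_of_deriv_le
    (μ := γ.prod γ) (x₀ := θ) (s := Set.univ)
    (F := fun t z => f z.1 * f (Real.cos t • z.1 + Real.sin t • z.2))
    (F' := fun t z => f z.1 * fderiv ℝ f (Real.cos t • z.1 + Real.sin t • z.2)
      (-Real.sin t • z.1 + Real.cos t • z.2))
    (bound := fun z => B * K * (1 + ‖z.1‖ + ‖z.2‖)) Filter.univ_mem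
    (Filter.Eventually.of_forall fun t => (by fun_prop : Continuous _).aestronglyMeasurable)
    (by
      refine integrable_gaussMeasure_prod (by fun_prop) (C := B * B) fun z => ?_
      rw [abs_mul]
      have h1 := mul_le_mul (hB z.1) (hB (Real.cos θ • z.1 + Real.sin θ • z.2))
        (norm_nonneg _) hB0
      refine h1.trans ?_
      nlinarith [norm_nonneg z.1, norm_nonneg z.2, mul_nonneg hB0 hB0,
        mul_nonneg (mul_nonneg hB0 hB0) (norm_nonneg z.1),
        mul_nonneg (mul_nonneg hB0 hB0) (norm_nonneg z.2)])
    ((by fun_prop : Continuous _).aestronglyMeasurable)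
    (Filter.Eventually.of_forall fun z t _ => by
      rw [norm_mul, mul_assoc]
      exact mul_le_mul (hB _) (((fderiv ℝ f _).le_opNorm _).trans
        (mul_le_mul (hK _) (hnorm t z) (norm_nonneg _) hK0)) (norm_nonneg _) hB0)
    (by
      refine integrable_gaussMeasure_prod (by fun_prop) (C := B * K) fun z => ?_
      rw [abs_of_nonneg (by positivity)])
    (Filter.Eventually.of_forall fun z t _ => by
      have h1 : HasDerivAt (fun t => Real.cos t • z.1 + Real.sin t • z.2)
          (-Real.sin t • z.1 + Real.cos t • z.2) t :=
        ((Real.hasDerivAt_cos t).smul_const z.1).add ((Real.hasDerivAt_sin t).smul_const z.2)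
      exact ((hf.differentiable one_ne_zero _).hasFDerivAt.comp_hasDerivAt t h1).const_mul _)
  refine ⟨_, hder.2, ?_⟩
  set v : Euc n → Euc n := fun a => (InnerProductSpace.toDual ℝ (Euc n)).symm (fderiv ℝ f a)
    with hv
  have hvc : Continuous v := (InnerProductSpace.toDual ℝ (Euc n)).symm.continuous.comp hdc
  have hvn : ∀ a, ‖v a‖ = ‖fderiv ℝ f a‖ := fun a => LinearIsometryEquiv.norm_map _ _
  have hvi : ∀ a b, fderiv ℝ f a b = inner ℝ (v a) b := fun a b => by
    rw [hv, InnerProductSpace.toDual_symm_apply]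
  have hrot : ∀ g : Euc n × Euc n → ℝ, Continuous g →
      ∫ z, g (ContinuousLinearMap.rotation θ z) ∂γ.prod γ = ∫ z, g z ∂γ.prod γ := fun g hg => by
    have h := measurePreserving_rotation (n := n) θ
    rw [← h.map_eq, integral_map h.measurable.aemeasurable hg.aestronglyMeasurable, h.map_eq]
  have hrot' : ∀ g : Euc n × Euc n → ℝ, Continuous g →
      ∫ z, g (ContinuousLinearMap.rotation (-θ) z) ∂γ.prod γ = ∫ z, g z ∂γ.prod γ :=
    fun g hg => by
    have h := measurePreserving_rotation (n := n) (-θ)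
    rw [← h.map_eq, integral_map h.measurable.aemeasurable hg.aestronglyMeasurable, h.map_eq]
  -- The rotation turns the argument of ∇f and the direction of differentiation into the two
  -- independent variables of the product.
  have e1 : ∫ z, f z.1 * fderiv ℝ f (c • z.1 + s • z.2) (-s • z.1 + c • z.2) ∂γ.prod γ =
      ∫ z, f (c • z.1 - s • z.2) * inner ℝ (v z.1) z.2 ∂γ.prod γ := by
    rw [← hrot (fun z => f (c • z.1 - s • z.2) * inner ℝ (v z.1) z.2) (by fun_prop)]
    refine integral_congr_ae (Filter.Eventually.of_forall fun z => ?_)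
    have h3 : c • (c • z.1 + s • z.2) - s • (-s • z.1 + c • z.2) = z.1 := by
      ext i
      simp only [PiLp.add_apply, PiLp.sub_apply, PiLp.smul_apply, smul_eq_mul]
      linear_combination z.1 i * hcs
    simp only [ContinuousLinearMap.rotation_apply, ← hcdef, ← hsdef, h3, hvi]
  have hcomp : ∀ a b : Euc n, HasFDerivAt (fun b => f (c • a - s • b))
      (-s • fderiv ℝ f (c • a - s • b)) b := fun a b => by
    have h1 : HasFDerivAt (fun b : Euc n => c • a - s • b)
        (-(s • ContinuousLinearMap.id ℝ (Euc n))) b :=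
      ((hasFDerivAt_id b).const_smul s).const_sub _
    have h2 := (hf.differentiable one_ne_zero (c • a - s • b)).hasFDerivAt.comp b h1
    convert! h2 using 1
    ext w
    simp
  have hint2 : Integrable (fun z : Euc n × Euc n => fderiv ℝ f (c • z.1 - s • z.2) (v z.1))
      (γ.prod γ) := by
    refine integrable_gaussMeasure_prod (by fun_prop) (C := K * K) fun z => ?_
    have h1 : |fderiv ℝ f (c • z.1 - s • z.2) (v z.1)| ≤ K * K :=
      ((fderiv ℝ f _).le_opNorm _).trans
        (mul_le_mul (hK _) ((hvn _).trans_le (hK _)) (norm_nonneg _) hK0)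
    nlinarith [mul_nonneg (mul_nonneg hK0 hK0) (norm_nonneg z.1),
        mul_nonneg (mul_nonneg hK0 hK0) (norm_nonneg z.2)]
  -- For fixed z.1 this is Gaussian integration by parts in z.2: the 2 comes from the weight
  -- e^{-|y|²/4} and the -s from the chain rule.
  have e2 : ∫ z, f (c • z.1 - s • z.2) * inner ℝ (v z.1) z.2 ∂γ.prod γ =
      -(2 * s) * ∫ z, fderiv ℝ f (c • z.1 - s • z.2) (v z.1) ∂γ.prod γ := by
    rw [integral_prod _ (integrable_gaussMeasure_prod (by fun_prop) (C := B * K) fun z => by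
        rw [abs_mul, mul_assoc]
        refine mul_le_mul (hB _) ((abs_real_inner_le_norm _ _).trans
          (mul_le_mul ((hvn _).trans_le (hK _)) ?_ (norm_nonneg _) hK0)) (abs_nonneg _) hB0
        linarith [norm_nonneg z.1]),
      integral_prod _ hint2, ← integral_const_mul]
    refine integral_congr_ae (Filter.Eventually.of_forall fun a => ?_)
    have h1 := integral_mul_inner_gaussMeasure (h := fun b => f (c • a - s • b))
      (hf.comp (by fun_prop)) (B := B) (K := K) (fun b => hB _) (fun b => by
        rw [(hcomp a b).fderiv, norm_smul, norm_neg, Real.norm_eq_abs]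
        exact (mul_le_mul (Real.abs_sin_le_one θ) (hK _) (norm_nonneg _) zero_le_one).trans_eq
          (one_mul K)) (v a)
    simp only
    rw [h1]
    simp only [fun b => (hcomp a b).fderiv]
    simp only [smul_apply, smul_eq_mul]
    rw [integral_const_mul]
    ring
  have hI1 : Integrable (fun z : Euc n × Euc n => ‖fderiv ℝ f (c • z.1 - s • z.2)‖ ^ 2)
      (γ.prod γ) := by
    refine integrable_gaussMeasure_prod (by fun_prop) (C := K ^ 2) fun z => ?_
    rw [abs_of_nonneg (sq_nonneg _)]
    have h1 := pow_le_pow_left₀ (norm_nonneg _) (hK (c • z.1 - s • z.2)) 2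
    nlinarith [mul_nonneg (sq_nonneg K) (norm_nonneg z.1),
        mul_nonneg (sq_nonneg K) (norm_nonneg z.2)]
  have hI2 : Integrable (fun z : Euc n × Euc n => ‖fderiv ℝ f z.1‖ ^ 2) (γ.prod γ) := by
    refine integrable_gaussMeasure_prod (by fun_prop) (C := K ^ 2) fun z => ?_
    rw [abs_of_nonneg (sq_nonneg _)]
    have h1 := pow_le_pow_left₀ (norm_nonneg _) (hK z.1) 2
    nlinarith [mul_nonneg (sq_nonneg K) (norm_nonneg z.1),
        mul_nonneg (sq_nonneg K) (norm_nonneg z.2)]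
  have e3 : ∫ z, ‖fderiv ℝ f (c • z.1 - s • z.2)‖ ^ 2 ∂γ.prod γ =
      ∫ z : Euc n × Euc n, ‖fderiv ℝ f z.1‖ ^ 2 ∂γ.prod γ := by
    rw [← hrot' (fun z => ‖fderiv ℝ f z.1‖ ^ 2) (by fun_prop)]
    simp only [ContinuousLinearMap.rotation_apply, Real.cos_neg, Real.sin_neg, neg_smul,
      ← sub_eq_add_neg, ← hcdef, ← hsdef]
  have e4 : ∫ z : Euc n × Euc n, ‖fderiv ℝ f z.1‖ ^ 2 ∂γ.prod γ =
      γ.real Set.univ * ∫ y, ‖fderiv ℝ f y‖ ^ 2 ∂γ := by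
    rw [integral_fun_fst (μ := γ) (ν := γ) (fun y => ‖fderiv ℝ f y‖ ^ 2), smul_eq_mul]
  -- Pointwise ab ≤ ½a² + ½b²; rotation invariance gives both squares the same integral.
  have e5 : ∫ z, fderiv ℝ f (c • z.1 - s • z.2) (v z.1) ∂γ.prod γ ≤
      γ.real Set.univ * ∫ y, ‖fderiv ℝ f y‖ ^ 2 ∂γ := by
    calc _ ≤ ∫ z, (1 / 2 * ‖fderiv ℝ f (c • z.1 - s • z.2)‖ ^ 2 + 1 / 2 * ‖fderiv ℝ f z.1‖ ^ 2)
          ∂γ.prod γ := by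
          refine integral_mono hint2 ((hI1.const_mul _).add (hI2.const_mul _)) fun z => ?_
          have h1 := (le_abs_self _).trans ((fderiv ℝ f (c • z.1 - s • z.2)).le_opNorm (v z.1))
          rw [hvn] at h1
          nlinarith [sq_nonneg (‖fderiv ℝ f (c • z.1 - s • z.2)‖ - ‖fderiv ℝ f z.1‖)]
      _ = _ := by
          rw [integral_add (hI1.const_mul _) (hI2.const_mul _), integral_const_mul,
            integral_const_mul, e3, e4]
          ring
  rw [e1, e2]
  nlinarith [mul_le_mul_of_nonneg_left e5 hθ]

/-- The Poincaré inequality for the Gaussian measure `e^{-|y|²/4} dy`. -/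
theorem gaussian_poincare {f : Euc n → ℝ} (hf : ContDiff ℝ 1 f) (hs : HasCompactSupport f)
    (h0 : ∫ y, f y ∂gaussMeasure n = 0) :
    1 / 2 * ∫ y, f y ^ 2 ∂gaussMeasure n ≤ ∫ y, ‖fderiv ℝ f y‖ ^ 2 ∂gaussMeasure n := by
  set γ := gaussMeasure n
  set m := γ.real Set.univ
  set I := ∫ y, ‖fderiv ℝ f y‖ ^ 2 ∂γ
  have hm : 0 < m :=
    ENNReal.toReal_pos gaussMeasure_univ_ne_zero (measure_ne_top _ _)
  -- The correlation of f with its rotated copy. At 0 it is m∫f², at π/2 it is (∫f)² = 0, and ψ' ≥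
  -- -2mI sin t on the interval between, so ψ - 2mI cos is monotone there. Comparing the endpoints
  -- gives m∫f² ≤ 2mI.
  set ψ := fun t : ℝ => ∫ z, f z.1 * f (Real.cos t • z.1 + Real.sin t • z.2) ∂γ.prod γ with hψ
  have hmem : ∀ t ∈ Set.Icc 0 (Real.pi / 2), 0 ≤ Real.sin t := fun t ht =>
    Real.sin_nonneg_of_nonneg_of_le_pi ht.1 (ht.2.trans (by linarith [Real.pi_pos]))
  have hD : ∀ t ∈ Set.Icc 0 (Real.pi / 2), ∃ D,
      HasDerivAt (fun t => ψ t - 2 * (m * I) * Real.cos t) D t ∧ 0 ≤ D := fun t ht => by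
    obtain ⟨D, h1, h2⟩ := exists_hasDerivAt_integral_rotation hf hs t (hmem t ht)
    refine ⟨_, h1.sub ((Real.hasDerivAt_cos t).const_mul (2 * (m * I))), ?_⟩
    linarith
  have hmono : MonotoneOn (fun t => ψ t - 2 * (m * I) * Real.cos t)
      (Set.Icc 0 (Real.pi / 2)) := by
    refine monotoneOn_of_deriv_nonneg (convex_Icc _ _) (fun t ht => ?_) (fun t ht => ?_)
      fun t ht => ?_
    · obtain ⟨D, h, -⟩ := hD t ht
      exact h.continuousAt.continuousWithinAt
    · obtain ⟨D, h, -⟩ := hD t (interior_subset ht)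
      exact h.differentiableAt.differentiableWithinAt
    · obtain ⟨D, h, h2⟩ := hD t (interior_subset ht)
      rw [h.deriv]
      exact h2
  have hpi : (0 : ℝ) ≤ Real.pi / 2 := by linarith [Real.pi_pos]
  have key := hmono (Set.left_mem_Icc.2 hpi) (Set.right_mem_Icc.2 hpi) hpi
  have h1 : ψ 0 = m * ∫ y, f y ^ 2 ∂γ := by
    simp only [hψ, Real.cos_zero, Real.sin_zero, one_smul, zero_smul, add_zero, ← pow_two]
    rw [integral_fun_fst (μ := γ) (ν := γ) (fun y => f y ^ 2), smul_eq_mul]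
  have h2 : ψ (Real.pi / 2) = 0 := by
    simp only [hψ, Real.cos_pi_div_two, Real.sin_pi_div_two, one_smul, zero_smul, zero_add]
    rw [integral_prod_mul (μ := γ) (ν := γ) f f, h0, zero_mul]
  simp only [h1, h2, Real.cos_zero, Real.cos_pi_div_two, mul_one, mul_zero, sub_zero] at key
  have : m * (∫ y, f y ^ 2 ∂γ) ≤ m * (2 * I) := by linarith
  linarith [le_of_mul_le_mul_left this hm]

end GaussianPoincare

/-! ### Hyperplanes: constant normal, Gaussian area and stability. -/

section Hyperplane

variable {n : ℕ}

lemma Coord.density_affine_isometry (T : Euc n →ₗᵢ[ℝ] Euc (n + 1)) (b : Euc (n + 1)) (y : Euc n) :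
    Coord.density (fun y => T y + b) y = 1 := by
  have hd : fderiv ℝ (fun y => T y + b) y = T.toContinuousLinearMap := by
    rw [fderiv_add_const]
    exact T.toContinuousLinearMap.fderiv
  have hm : Coord.metric (fun y => T y + b) y = 1 := by
    ext i j
    simp only [Coord.metric, Coord.pd, hd, Matrix.of_apply, LinearIsometry.coe_toContinuousLinearMap,
      LinearIsometry.inner_map_map, Matrix.one_apply]
    simp [EuclideanSpace.inner_single_left]
  rw [Coord.density, hm, Matrix.det_one, Real.sqrt_one]

variable {M : Type*} [TopologicalSpace M] [ChartedSpace (Euc n) M]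
  [IsManifold (𝓡 n) ∞ M] {F N : M → Euc (n + 1)}

namespace IsTwoSidedProperImmersion

variable (hF : IsTwoSidedProperImmersion F N)
include hF

omit [IsManifold (𝓡 n) ∞ M] in
/-- A hypersurface that is a hyperplane has constant normal. -/
lemma exists_normal_eq_of_isHyperplaneOn [Nonempty M] (hH : IsHyperplaneOn F Set.univ) :
    ∃ (ν : Euc (n + 1)) (c : ℝ), ‖ν‖ = 1 ∧ (∀ p, N p = ν) ∧ Set.range F = {x | inner ℝ ν x = c} := by
  obtain ⟨hinj, v, c, hv0, hrange⟩ := hH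
  rw [Set.image_univ] at hrange
  rw [Set.injOn_univ] at hinj
  have hFv : ∀ p, inner ℝ v (F p) = c := fun p => by
    have : F p ∈ Set.range F := ⟨p, rfl⟩
    rw [hrange] at this
    exact this
  -- ⟨v, F⟩ is constant, so v is orthogonal to every tangent space and therefore proportional to N
  -- p.
  have hvN : ∀ p, v = inner ℝ v (N p) • N p := fun p => by
    refine hF.eq_of_inner (p := p) (fun w => ?_) ?_
    · have hconst : ∀ g : M → ℝ, g = (fun _ => c) → (mfderiv (𝓡 n) 𝓘(ℝ, ℝ) g p w : ℝ) = 0 := by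
        rintro g rfl
        rw [mfderiv_const]
        rfl
      refine ((hF.mfderiv_inner_position v p w).symm.trans (hconst _ (funext hFv))).trans
        (Eq.symm ?_)
      exact (real_inner_smul_left (N p) _ _).trans
        ((congrArg _ ((real_inner_comm _ _).trans (hF.orthogonal p w))).trans (mul_zero _))
    · rw [real_inner_smul_left, real_inner_self_eq_norm_sq, hF.unit_normal p]
      ring
  have hemb := Topology.IsClosedEmbedding.of_continuous_injective_isClosedMap
    hF.smooth.continuous hinj hF.proper.isClosedMap
  -- F is a closed embedding, so M inherits connectedness from its convex image. This prevents the
  -- sign of ⟨v, N⟩ = ±‖v‖ from changing.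
  have hpre : IsPreconnected (Set.univ : Set M) := by
    rw [← hemb.isInducing.isPreconnected_image, Set.image_univ, hrange]
    have hcx : Convex ℝ {x : Euc (n + 1) | inner ℝ v x = c} :=
      convex_hyperplane (innerSL ℝ v).toLinearMap.isLinear c
    exact hcx.isPreconnected
  have hsq : ∀ p, inner ℝ v (N p) ^ 2 = ‖v‖ ^ 2 := fun p => by
    conv_rhs => rw [hvN p]
    rw [norm_smul, hF.unit_normal p, mul_one, Real.norm_eq_abs, sq_abs]
  have hNc := hF.smooth_normal.continuous
  obtain ⟨p₀⟩ : Nonempty M := inferInstance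
  have hv : 0 < ‖v‖ := norm_pos_iff.2 hv0
  have hconst : ∀ p, inner ℝ v (N p) = inner ℝ v (N p₀) := by
    have := hpre.eq_or_eq_neg_of_sq_eq (f := fun p => inner ℝ v (N p)) (g := fun _ => ‖v‖)
      (by fun_prop) (by fun_prop) (fun p _ => hsq p) (fun _ => hv.ne')
    rcases this with h | h
    · exact fun p => (h (Set.mem_univ p)).trans (h (Set.mem_univ p₀)).symm
    · exact fun p => (h (Set.mem_univ p)).trans (h (Set.mem_univ p₀)).symm
  set a := inner ℝ v (N p₀) with ha
  have ha0 : a ≠ 0 := fun h => hv0 (by rw [hvN p₀, ← ha, h, zero_smul])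
  have hN : ∀ p, N p = a⁻¹ • v := fun p => by
    conv_rhs => rw [hvN p, hconst p]
    rw [smul_smul, inv_mul_cancel₀ ha0, one_smul]
  refine ⟨a⁻¹ • v, a⁻¹ * c, by rw [← hN p₀]; exact hF.unit_normal p₀, hN, ?_⟩
  rw [hrange]
  ext x
  simp only [Set.mem_ofPred_eq, real_inner_smul_left]
  exact ⟨fun h => by rw [h], fun h => mul_left_cancel₀ (inv_ne_zero ha0) h⟩

lemma normSqSecondForm_eq_zero {ν : Euc (n + 1)} (hN : ∀ p, N p = ν) (p : M) :
    normSqSecondForm F N p = 0 := by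
  rw [hF.normSqSecondForm_eq]
  refine Finset.sum_eq_zero fun a _ => ?_
  rw [gradient_eq_zero_of_eventuallyEq F (c := ν a)
    (Filter.Eventually.of_forall fun x => by simp only [hN x]), norm_zero, zero_pow two_ne_zero]

lemma curvatureCondition_of_isHyperplaneOn [Nonempty M] (hH : IsHyperplaneOn F Set.univ) :
    ∃ C, CurvatureCondition F N C := by
  obtain ⟨ν, c, -, hN, hrange⟩ := hF.exists_normal_eq_of_isHyperplaneOn hH
  -- H = 0 and ⟨x, ν⟩ = c force this constant.
  refine ⟨-c / 2, fun p => ?_⟩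
  have hp : F p ∈ Set.range F := ⟨p, rfl⟩
  rw [hrange] at hp
  have hp' : inner ℝ ν (F p) = c := hp
  rw [hF.meanCurvature_eq, divergence, Finset.sum_eq_zero, hN p, real_inner_comm, hp']
  · ring
  · intro a _
    rw [gradient_eq_zero_of_eventuallyEq F (c := ν a)
      (Filter.Eventually.of_forall fun x => by simp only [hN x])]
    rfl

/-- Euclidean coordinates on a hypersurface that is a hyperplane. -/
lemma exists_homeomorph_of_isHyperplaneOn [Nonempty M] (hH : IsHyperplaneOn F Set.univ) :
    ∃ (ν : Euc (n + 1)) (c : ℝ) (T : Euc n →ₗᵢ[ℝ] Euc (n + 1)) (π : Euc (n + 1) →L[ℝ] Euc n)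
      (h : M ≃ₜ Euc n), (∀ p, N p = ν) ∧ (∀ y, π (T y) = y) ∧ (∀ y, inner ℝ ν (T y) = 0) ∧
        (∀ p, h p = π (F p)) ∧ (∀ p, F p = T (h p) + c • ν) ∧
        (∀ p, ‖F p‖ ^ 2 = ‖h p‖ ^ 2 + c ^ 2) ∧
        ContMDiff 𝓘(ℝ, Euc n) (𝓡 n) ∞ h.symm := by
  obtain ⟨ν, c, hν, hN, hrange⟩ := hF.exists_normal_eq_of_isHyperplaneOn hH
  obtain ⟨T, π, hπT, hTπ, hνT⟩ := exists_plane_coordinates hν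
  have hinj := Set.injOn_univ.1 hH.1
  have hFc : ∀ p, inner ℝ ν (F p) = c := fun p => by
    have : F p ∈ Set.range F := ⟨p, rfl⟩
    rw [hrange] at this
    exact this
  have hFeq : ∀ p, F p = T (π (F p)) + c • ν := fun p => by
    rw [hTπ, hFc p, sub_add_cancel]
  set g : M → Euc n := fun p => π (F p) with hg
  have hgc : Continuous g := π.continuous.comp hF.smooth.continuous
  have hgp : IsProperMap g := by
    refine isProperMap_of_comp_of_inj (g := fun y => T y + c • ν) hgc
      (T.continuous.add continuous_const) ?_ fun y z hyz => T.injective (add_right_cancel hyz)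
    rw [show (fun y => T y + c • ν) ∘ g = F from funext fun p => (hFeq p).symm]
    exact hF.proper
  have hgb : Function.Bijective g := by
    refine ⟨fun p q hpq => hinj ?_, fun y => ?_⟩
    · rw [hFeq p, hFeq q]
      exact congrArg (fun y => T y + c • ν) hpq
    · have hy : T y + c • ν ∈ Set.range F := by
        rw [hrange]
        change inner ℝ ν (T y + c • ν) = c
        rw [inner_add_right, hνT, real_inner_smul_right, real_inner_self_eq_norm_sq, hν]
        ring
      obtain ⟨p, hp⟩ := hy
      refine ⟨p, T.injective ?_⟩
      exact add_right_cancel ((hFeq p).symm.trans hp)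
  set h : M ≃ₜ Euc n :=
    (Equiv.ofBijective g hgb).toHomeomorphOfContinuousClosed hgc hgp.isClosedMap with hh
  have hhg : ∀ p, h p = g p := fun p => rfl
  refine ⟨ν, c, T, π, h, hN, hπT, hνT, fun p => rfl, hFeq, fun p => ?_, fun y => ?_⟩
  · rw [hFeq p, norm_add_sq_real, LinearIsometry.norm_map, real_inner_smul_right, real_inner_comm,
      hνT, norm_smul, hν, mul_one, Real.norm_eq_abs, sq_abs, hhg]
    ring
  -- Smoothness is local: near h p the inverse of `h` agrees with the inverse of the local
  -- projection, which is smooth there.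
  · obtain ⟨p, rfl⟩ := h.surjective y
    obtain ⟨e, hpe, hEq, hsm⟩ := hF.exists_openPartialHomeomorph (p := p) (T := T) (π := π)
      (by rw [hN p]; exact hTπ)
    have hep : e p = h p := (hEq hpe).symm
    rw [hep] at hsm
    refine hsm.congr_of_eventuallyEq ?_
    have hnh : e.target ∈ nhds (h p) := by
      rw [← hep]
      exact e.open_target.mem_nhds (e.map_source hpe)
    filter_upwards [hnh] with z hz
    rw [Homeomorph.symm_apply_eq, hhg]
    exact ((hEq (e.map_target hz)).trans (e.right_inv hz)).symm

variable [MeasurableSpace M] [BorelSpace M]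

/-- The area measure of a hyperplane is Lebesgue measure. -/
lemma area_eq_map [SecondCountableTopology M] {T : Euc n →ₗᵢ[ℝ] Euc (n + 1)} {b : Euc (n + 1)}
    {π : Euc (n + 1) →L[ℝ] Euc n} {h : M ≃ₜ Euc n} (hπ : ∀ p, h p = π (F p))
    (hT : ∀ p, F p = T (h p) + b) :
    area F = volume.map h.symm := by
  have hhs : ContMDiff (𝓡 n) 𝓘(ℝ, Euc n) ∞ h := by
    rw [show (h : M → Euc n) = π ∘ F from funext hπ]
    exact π.contMDiff.comp hF.smooth
  -- Countably many chart domains cover M, so it suffices to compare the two measures on each of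
  -- them.
  obtain ⟨s, hs, hcov⟩ := TopologicalSpace.countable_cover_nhds
    (f := fun q : M => (extChartAt (𝓡 n) q).source) fun q => extChartAt_source_mem_nhds q
  rw [← Measure.restrict_univ (μ := area F), ← Measure.restrict_univ (μ := volume.map h.symm),
    ← hcov, Measure.restrict_biUnion_congr hs]
  intro q _
  set e := extChartAt (𝓡 n) q
  rw [hF.area_restrict q]
  ext S hS
  have hU := (isOpen_extChartAt_source (I := 𝓡 n) q).measurableSet
  have hSm := measurableSet_inter_preimage_of_continuousOn (continuousOn_extChartAt_symm (I := 𝓡 n) q)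
    (isOpen_extChartAt_target q).measurableSet hS
  rw [Measure.restrict_apply hS, Measure.map_apply h.symm.continuous.measurable (hS.inter hU),
    chartArea_apply q hS]
  have himg : h.symm ⁻¹' (S ∩ e.source) = inChart (n := n) h q '' (e.target ∩ e.symm ⁻¹' S) := by
    ext y
    constructor
    · rintro ⟨h1, h2⟩
      refine ⟨e (h.symm y), ⟨e.map_source h2, ?_⟩, ?_⟩
      · rw [Set.mem_preimage, e.left_inv h2]; exact h1
      · simp only [inChart, Function.comp_apply]
        rw [e.left_inv h2, h.apply_symm_apply]
    · rintro ⟨z, ⟨hz1, hz2⟩, rfl⟩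
      simp only [inChart, Set.mem_preimage, Function.comp_apply, h.symm_apply_apply]
      exact ⟨hz2, e.map_target hz1⟩
  have hd : ∀ y ∈ e.target, DifferentiableAt ℝ (inChart (n := n) h q) y := fun y hy =>
    (contDiffAt_inChart hhs hy).differentiableAt (by simp)
  have hinj : Set.InjOn (inChart (n := n) h q) (e.target ∩ e.symm ⁻¹' S) := fun y hy z hz hyz =>
    e.symm.injOn hy.1 hz.1 (h.injective hyz)
  -- An affine isometry has area density one, so the density in the chart is the Jacobian of `h`
  -- read in that chart.
  rw [himg, ← lintegral_abs_det_fderiv_eq_addHaar_image volume hSm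
    (fun y hy => (hd y hy.1).hasFDerivAt.hasFDerivWithinAt) hinj]
  refine setLIntegral_congr_fun hSm fun y hy => ?_
  have hX : inChart F q = (fun z => T z + b) ∘ inChart (n := n) h q := funext fun y => hT _
  have hdc := Coord.density_comp (X' := inChart F q) (X := fun z => T z + b) (y := y)
    (z := inChart (n := n) h q y) (J := fderiv ℝ (inChart (n := n) h q) y) (by
      rw [hX, fderiv_comp y _ (hd y hy.1)]
      exact (T.toContinuousLinearMap.differentiableAt).add_const b)
  rw [hdc, Coord.density_affine_isometry, mul_one]

/-- By Pythagoras the weight factors into the constant e^{-c²/4} and the Gaussian weight of the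
coordinates on the hyperplane. -/
lemma gaussArea_eq_map [SecondCountableTopology M] {T : Euc n →ₗᵢ[ℝ] Euc (n + 1)} {b : Euc (n + 1)}
    {π : Euc (n + 1) →L[ℝ] Euc n} {h : M ≃ₜ Euc n} {c : ℝ} (hπ : ∀ p, h p = π (F p))
    (hT : ∀ p, F p = T (h p) + b) (hc : ∀ p, ‖F p‖ ^ 2 = ‖h p‖ ^ 2 + c ^ 2) :
    gaussArea F = ENNReal.ofReal (Real.exp (-c ^ 2 / 4)) • (gaussMeasure n).map h.symm := by
  have hm := h.symm.continuous.measurable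
  ext S hS
  rw [gaussArea, hF.area_eq_map hπ hT, withDensity_apply _ hS, Measure.smul_apply,
    Measure.map_apply hm hS, gaussMeasure, withDensity_apply _ (hm hS), smul_eq_mul,
    setLIntegral_map hS hF.measurable_weight hm, ← lintegral_const_mul _ measurable_gaussWeight]
  refine lintegral_congr fun y => ?_
  rw [← ENNReal.ofReal_mul (Real.exp_pos _).le, ← Real.exp_add, hc, h.apply_symm_apply]
  ring_nf

theorem gaussArea_lt_top_of_isHyperplaneOn [SecondCountableTopology M] [Nonempty M]
    (hH : IsHyperplaneOn F Set.univ) : gaussArea F Set.univ < ⊤ := by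
  obtain ⟨ν, c, T, π, h, -, -, -, hπ, hT, hc, -⟩ := hF.exists_homeomorph_of_isHyperplaneOn hH
  rw [hF.gaussArea_eq_map hπ hT hc, Measure.smul_apply, smul_eq_mul,
    Measure.map_apply h.symm.continuous.measurable MeasurableSet.univ]
  exact ENNReal.mul_lt_top ENNReal.ofReal_lt_top (measure_lt_top _ _)

end IsTwoSidedProperImmersion

end Hyperplane

section Hyperplane

lemma integrable_sq_of_hasCompactSupport {α : Type*} [TopologicalSpace α] [MeasurableSpace α]
    [OpensMeasurableSpace α] {μ : Measure α} [IsFiniteMeasureOnCompacts μ] {f : α → ℝ}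
    (hf : Continuous f) (hs : HasCompactSupport f) : Integrable (fun y => f y ^ 2) μ :=
  (hf.pow 2).integrable_of_hasCompactSupport (hs.mono fun y hy h0 => hy (by simp [h0]))

variable {n : ℕ} {M : Type*} [TopologicalSpace M] [ChartedSpace (Euc n) M]
  [IsManifold (𝓡 n) ∞ M] {F N : M → Euc (n + 1)} [MeasurableSpace M] [BorelSpace M]

namespace IsTwoSidedProperImmersion

variable (hF : IsTwoSidedProperImmersion F N)
include hF

/-- Hyperplanes are stable. -/
theorem isStable_of_isHyperplaneOn [T2Space M] [SecondCountableTopology M] [Nonempty M]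
    (hH : IsHyperplaneOn F Set.univ) : IsStable F N := by
  have hfin : IsFiniteMeasure (gaussArea F) := ⟨hF.gaussArea_lt_top_of_isHyperplaneOn hH⟩
  obtain ⟨ν, c, T, π, h, hN, hπT, hνT, hπ, hT, hc, hsm⟩ :=
    hF.exists_homeomorph_of_isHyperplaneOn hH
  have hμ := hF.gaussArea_eq_map hπ hT hc
  have hint : ∀ g : M → ℝ, ∫ p, g p ∂gaussArea F =
      Real.exp (-c ^ 2 / 4) * ∫ y, g (h.symm y) ∂gaussMeasure n := fun g => by
    rw [hμ, integral_smul_measure, ENNReal.toReal_ofReal (Real.exp_pos _).le, smul_eq_mul,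
      h.symm.measurableEmbedding.integral_map]
  rintro u ⟨⟨hu, hus⟩, hu0⟩
  rw [hF.Q_eq hu hus]
  -- With A = 0 the form is ∫(|∇u|² - ½u²), so only the Poincaré inequality for u in Euclidean
  -- coordinates is needed.
  simp only [hF.normSqSecondForm_eq_zero hN, zero_add]
  set f : Euc n → ℝ := u ∘ h.symm with hf
  have hfs : ContDiff ℝ ∞ f := contMDiff_iff_contDiff.1 (hu.comp hsm)
  have hf1 : ContDiff ℝ 1 f := hfs.of_le (by simp)
  have hfc : HasCompactSupport f := hus.comp_isClosedEmbedding h.symm.isClosedEmbedding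
  have hfd := hf1.continuous_fderiv one_ne_zero
  have hf0 : ∫ y, f y ∂gaussMeasure n = 0 := by
    rw [hint] at hu0
    exact (mul_eq_zero.1 hu0).resolve_left (Real.exp_pos _).ne'
  have hu' : u = (f ∘ π) ∘ F := funext fun p => by
    simp only [hf, Function.comp_apply, ← hπ, h.symm_apply_apply]
  -- Testing ∇u against the tangent vectors T w bounds df(w). Only this inequality between the two
  -- gradient norms is needed.
  have hgrad : ∀ y, ‖fderiv ℝ f y‖ ≤ ‖gradient F u (h.symm y)‖ := fun y => by
    refine ContinuousLinearMap.opNorm_le_bound _ (norm_nonneg _) fun w => ?_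
    have hFy : π (F (h.symm y)) = y := by rw [← hπ, h.apply_symm_apply]
    have hdf : DifferentiableAt ℝ f (π (F (h.symm y))) := hf1.differentiable one_ne_zero _
    have h1 := hF.inner_gradient_comp (h := f ∘ π) (p := h.symm y) (z := T w)
      (hdf.comp _ π.differentiableAt) (by rw [hN, real_inner_comm, hνT])
    rw [fderiv_comp _ hdf π.differentiableAt, π.fderiv, ContinuousLinearMap.comp_apply, hπT, hFy,
      ← hu'] at h1
    rw [← h1, Real.norm_eq_abs, ← T.norm_map w]
    exact abs_real_inner_le_norm _ _
  have hgc : Continuous fun y => gradient F u (h.symm y) :=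
    (hF.continuous_gradient hu).comp h.symm.continuous
  have hgs : HasCompactSupport fun y => gradient F u (h.symm y) := by
    refine hfc.mono' fun y hy => ?_
    have h1 : h.symm y ∈ tsupport u := by
      by_contra hn
      exact hy (gradient_eq_zero_of_notMem_tsupport F hn)
    have h2 : tsupport f = h.symm ⁻¹' tsupport u := by
      simp only [tsupport, hf, Function.support_comp_eq_preimage, h.symm.preimage_closure]
    rw [h2]
    exact h1
  have hi1 := integrable_sq_of_hasCompactSupport (μ := gaussMeasure n) hgc.norm hgs.norm
  have hi2 := integrable_sq_of_hasCompactSupport (μ := gaussMeasure n) hf1.continuous hfc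
  have hi3 := integrable_sq_of_hasCompactSupport (μ := gaussMeasure n) hfd.norm
    (hfc.fderiv ℝ).norm
  rw [hint]
  refine mul_nonneg (Real.exp_pos _).le ?_
  have e : ∫ y, (‖gradient F u (h.symm y)‖ ^ 2 - 1 / 2 * u (h.symm y) ^ 2) ∂gaussMeasure n =
      (∫ y, ‖gradient F u (h.symm y)‖ ^ 2 ∂gaussMeasure n) -
        1 / 2 * ∫ y, f y ^ 2 ∂gaussMeasure n := by
    rw [← integral_const_mul, ← integral_sub hi1 (hi2.const_mul _)]
    rfl
  rw [e]
  have h1 := gaussian_poincare hf1 hfc hf0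
  have h2 := integral_mono hi3 hi1 fun y => pow_le_pow_left₀ (norm_nonneg _) (hgrad y) 2
  linarith

end IsTwoSidedProperImmersion

end Hyperplane

/-! ### Clopen decompositions and the classification for index zero and one. -/

section Topology

variable {X : Type*} [TopologicalSpace X]

lemma exists_isClopen_of_not_preconnectedSpace (h : ¬PreconnectedSpace X) :
    ∃ U : Set X, IsClopen U ∧ U.Nonempty ∧ Uᶜ.Nonempty := by
  rw [preconnectedSpace_iff_clopen] at h
  push Not at h
  obtain ⟨U, hU, h1, h2⟩ := h
  exact ⟨U, hU, h1, Set.nonempty_compl.2 h2⟩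

lemma exists_isClopen_of_not_isPreconnected {V : Set X} (hV : IsClopen V)
    (h : ¬IsPreconnected V) :
    ∃ A : Set X, IsClopen A ∧ A ⊆ V ∧ A.Nonempty ∧ (V \ A).Nonempty := by
  rw [isPreconnected_iff_preconnectedSpace] at h
  obtain ⟨U, hU, ⟨x, hx⟩, ⟨y, hy⟩⟩ := exists_isClopen_of_not_preconnectedSpace h
  refine ⟨Subtype.val '' U, ⟨hV.isClosed.isClosedMap_subtype_val _ hU.isClosed,
    hV.isOpen.isOpenMap_subtype_val _ hU.isOpen⟩, ?_, ⟨x, x, hx, rfl⟩, ⟨y, y.2, ?_⟩⟩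
  · rintro _ ⟨z, -, rfl⟩
    exact z.2
  · rintro ⟨z, hz, hzy⟩
    exact hy (Subtype.val_injective hzy ▸ hz)

end Topology

section Classification

variable {n : ℕ} {M : Type*} [TopologicalSpace M] [ChartedSpace (Euc n) M]
  [IsManifold (𝓡 n) ∞ M] [T2Space M] [SecondCountableTopology M]
  [MeasurableSpace M] [BorelSpace M] {F N : M → Euc (n + 1)}

namespace IsTwoSidedProperImmersion

variable (hF : IsTwoSidedProperImmersion F N)
include hF

open Classical in
/-- A lower bound for the index in terms of translations and of the indicator functions of
clopen sets. -/
lemma le_index_add_one_of_isClopen [IsFiniteMeasure (gaussArea F)] {C : ℝ}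
    (hC : CurvatureCondition F N C) {k : ℕ} (e : Fin k → Euc (n + 1)) (U : Fin k → Set M)
    (hU : ∀ i, IsClopen (U i))
    (hli : ∀ g : Fin k → ℝ, (∀ p, ∑ i, g i * (inner ℝ (N p) (e i) + if p ∈ U i then 1 else 0) = 0) →
      ∀ i, g i = 0) :
    (k : ℕ∞) ≤ index F N + 1 := by
  have h := hF.card_le_index_add_one hC e (fun i p => if p ∈ U i then 1 else 0) (fun i => ?_)
    (fun i => ⟨1, fun p => by split_ifs <;> simp⟩) ?_
  · simpa using h
  · rw [IsLocallyConstant.iff_eventually_eq]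
    intro p
    by_cases hp : p ∈ U i
    · filter_upwards [(hU i).isOpen.mem_nhds hp] with x hx
      rw [if_pos hx, if_pos hp]
    · filter_upwards [(hU i).compl.isOpen.mem_nhds hp] with x hx
      rw [if_neg hx, if_neg hp]
  · rw [Fintype.linearIndependent_iff]
    intro g hg
    refine hli g fun p => ?_
    have := congrFun hg p
    simpa using this

/-- The indicators of a nontrivial clopen set and of its complement would be two independent
functions, whereas index zero permits one. -/
lemma preconnectedSpace_of_index_eq_zero [IsFiniteMeasure (gaussArea F)] {C : ℝ}
    (hC : CurvatureCondition F N C) (h0 : index F N = 0) : PreconnectedSpace M := by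
  by_contra hn
  obtain ⟨U, hU, ⟨p, hp⟩, ⟨q, hq⟩⟩ := exists_isClopen_of_not_preconnectedSpace hn
  have hq' : q ∉ U := hq
  have := hF.le_index_add_one_of_isClopen hC (k := 2) (fun _ => 0) ![U, Uᶜ]
    (by intro i; fin_cases i; exacts [hU, hU.compl]) fun g hg => by
      have hp1 := hg p
      have hq1 := hg q
      simp [Fin.sum_univ_two, hp, hq'] at hp1 hq1
      intro i
      fin_cases i
      exacts [hp1, hq1]
  rw [h0] at this
  norm_num at this

/-- With d = N q - N p nonzero, ⟨N, d⟩ differs at q and p by ‖d‖², so it is independent of the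
constant 1. -/
lemma normal_eq_of_index_eq_zero [IsFiniteMeasure (gaussArea F)] {C : ℝ}
    (hC : CurvatureCondition F N C) (h0 : index F N = 0) (p q : M) : N p = N q := by
  by_contra hne
  have hd : N q - N p ≠ 0 := sub_ne_zero.2 (Ne.symm hne)
  have := hF.le_index_add_one_of_isClopen hC (k := 2) ![0, N q - N p] ![Set.univ, ∅]
    (by intro i; fin_cases i; exacts [isClopen_univ, isClopen_empty]) fun g hg => by
      have hp1 := hg p
      have hq1 := hg q
      simp only [Fin.sum_univ_two, Matrix.cons_val_zero, Matrix.cons_val_one, inner_zero_right,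
        Set.mem_univ, if_true, Set.mem_empty_iff_false, if_false, add_zero, zero_add,
        mul_one] at hp1 hq1
      have h1 : g 1 * inner ℝ (N q - N p) (N q - N p) = 0 := by
        rw [inner_sub_left]
        linarith
      have h2 : g 1 = 0 := (mul_eq_zero.1 h1).resolve_right (inner_self_ne_zero.2 hd)
      rw [h2, zero_mul, add_zero] at hp1
      intro i
      fin_cases i
      exacts [hp1, h2]
  rw [h0] at this
  norm_num at this

/-- Stable hypersurfaces are hyperplanes. -/
theorem isHyperplaneOn_of_index_eq_zero [Nonempty M] [IsFiniteMeasure (gaussArea F)] {C : ℝ}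
    (hC : CurvatureCondition F N C) (h0 : index F N = 0) : IsHyperplaneOn F Set.univ := by
  have hpre := hF.preconnectedSpace_of_index_eq_zero hC h0
  obtain ⟨p₀⟩ : Nonempty M := inferInstance
  exact hF.isHyperplaneOn_of_normal_eq isClopen_univ
    ⟨⟨p₀, Set.mem_univ _⟩, hpre.isPreconnected_univ⟩ (v := N p₀)
    fun p _ => hF.normal_eq_of_index_eq_zero hC h0 p p₀

omit [IsManifold (𝓡 n) ∞ M] [T2Space M] [SecondCountableTopology M] [MeasurableSpace M]
  [BorelSpace M] in
/-- If the normal of a connected hypersurface is not constant, its image is not contained in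
a line. -/
lemma exists_linearIndependent_normal [PreconnectedSpace M] {p q : M} (hpq : N p ≠ N q) :
    ∃ r, LinearIndependent ℝ ![N q - N p, N r - N p] := by
  set d := N q - N p with hd
  have hd0 : d ≠ 0 := sub_ne_zero.2 (Ne.symm hpq)
  have hdn : 0 < ‖d‖ ^ 2 := by positivity
  have hNc := hF.smooth_normal.continuous
  -- The intermediate value theorem gives r with N r halfway between N p and N q in the direction d.
  -- If N r were on the line through them it would be the midpoint of a chord, which is not on the
  -- unit sphere.
  obtain ⟨r, hr⟩ := mem_range_of_exists_le_of_exists_ge (c := ‖d‖ ^ 2 / 2)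
    (f := fun r => inner ℝ (N r - N p) d) (by fun_prop)
    ⟨p, by simp only [sub_self, inner_zero_left]; positivity⟩
    ⟨q, by simp only [← hd, real_inner_self_eq_norm_sq]; linarith⟩
  refine ⟨r, (LinearIndependent.pair_iff' hd0).2 fun a ha => ?_⟩
  simp only [← ha, real_inner_smul_left, real_inner_self_eq_norm_sq] at hr
  have ha2 : a = 1 / 2 := by
    have : (a - 1 / 2) * ‖d‖ ^ 2 = 0 := by linarith
    linarith [(mul_eq_zero.1 this).resolve_right hdn.ne']
  have hq1 : ‖N p + d‖ ^ 2 = 1 := by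
    rw [hd, add_sub_cancel, hF.unit_normal, one_pow]
  have hr1 : ‖N p + a • d‖ ^ 2 = 1 := by
    rw [ha, add_sub_cancel, hF.unit_normal, one_pow]
  rw [norm_add_sq_real, hF.unit_normal] at hq1 hr1
  rw [real_inner_smul_right, norm_smul, mul_pow, Real.norm_eq_abs, sq_abs, ha2] at hr1
  linarith

/-- A connected hypersurface does not have index one. -/
theorem index_ne_one [ConnectedSpace M] [IsFiniteMeasure (gaussArea F)] {C : ℝ}
    (hC : CurvatureCondition F N C) : index F N ≠ 1 := by
  intro h1
  by_cases hN : ∃ p q, N p ≠ N q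
  · obtain ⟨p, q, hpq⟩ := hN
    obtain ⟨r, hr⟩ := hF.exists_linearIndependent_normal hpq
    -- The three functions are 1 and the components of N along the two independent differences;
    -- index one would permit only two.
    have := hF.le_index_add_one_of_isClopen hC (k := 3) ![0, N q - N p, N r - N p]
      ![Set.univ, ∅, ∅] (by intro i; fin_cases i; exacts [isClopen_univ, isClopen_empty,
        isClopen_empty]) fun g hg => by
        have hp1 := hg p
        have hq1 := hg q
        have hr1 := hg r
        simp only [Fin.sum_univ_three, Matrix.cons_val_zero, Matrix.cons_val_one, Matrix.cons_val,
          inner_zero_right, Set.mem_univ, if_true, Set.mem_empty_iff_false, if_false, add_zero,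
          zero_add, mul_one] at hp1 hq1 hr1
        -- Subtracting the relation at p from those at q and r shows that this combination is
        -- orthogonal to both differences, hence to itself.
        have h0 : g 1 • (N q - N p) + g 2 • (N r - N p) = 0 := by
          rw [← inner_self_eq_zero (𝕜 := ℝ)]
          nth_rewrite 1 [inner_add_left]
          simp only [real_inner_smul_left, inner_sub_left, inner_add_right, real_inner_smul_right]
          linear_combination g 1 * (hq1 - hp1) + g 2 * (hr1 - hp1)
        obtain ⟨h2, h3⟩ := LinearIndependent.pair_iff.1 hr _ _ h0
        rw [h2, h3, zero_mul, zero_mul, add_zero, add_zero] at hp1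
        intro i
        fin_cases i
        exacts [hp1, h2, h3]
    rw [h1] at this
    norm_num at this
  · push Not at hN
    obtain ⟨p₀⟩ : Nonempty M := inferInstance
    have hH := hF.isHyperplaneOn_of_normal_eq isClopen_univ isConnected_univ (v := N p₀)
      fun p _ => hN p p₀
    rw [index_eq_zero_of_isStable (hF.isStable_of_isHyperplaneOn hH)] at h1
    exact zero_ne_one h1

/-- A further clopen splitting of U, together with the complement of U, would give three independent
indicators, one more than index one permits. -/
lemma isPreconnected_of_index_eq_one [IsFiniteMeasure (gaussArea F)] {C : ℝ}
    (hC : CurvatureCondition F N C) (h1 : index F N = 1) {U : Set M} (hU : IsClopen U)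
    (hUc : Uᶜ.Nonempty) : IsPreconnected U := by
  by_contra hn
  obtain ⟨A, hA, hAU, ⟨p, hp⟩, ⟨q, hqU, hqA⟩⟩ := exists_isClopen_of_not_isPreconnected hU hn
  obtain ⟨r, hr⟩ := hUc
  have hr' : r ∉ U := hr
  have hpU := hAU hp
  have hrA : r ∉ A := fun h => hr' (hAU h)
  have := hF.le_index_add_one_of_isClopen hC (k := 3) (fun _ => 0) ![A, U \ A, Uᶜ]
    (by intro i; fin_cases i; exacts [hA, hU.diff hA, hU.compl]) fun g hg => by
      have hp1 := hg p
      have hq1 := hg q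
      have hr1 := hg r
      simp [Fin.sum_univ_three, hp, hpU, hqU, hqA, hrA, hr'] at hp1 hq1 hr1
      intro i
      fin_cases i
      exacts [hp1, hq1, hr1]
  rw [h1] at this
  norm_num at this

/-- The indicators of U and its complement already use both permitted dimensions. A component of N
that takes two values on U would be independent of them. -/
lemma normal_eq_of_index_eq_one [IsFiniteMeasure (gaussArea F)] {C : ℝ}
    (hC : CurvatureCondition F N C) (h1 : index F N = 1) {U : Set M} (hU : IsClopen U)
    (hUc : Uᶜ.Nonempty) {p q : M} (hp : p ∈ U) (hq : q ∈ U) : N p = N q := by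
  by_contra hne
  have hd : N q - N p ≠ 0 := sub_ne_zero.2 (Ne.symm hne)
  obtain ⟨r, hr⟩ := hUc
  have hr' : r ∉ U := hr
  have := hF.le_index_add_one_of_isClopen hC (k := 3) ![0, 0, N q - N p] ![U, Uᶜ, ∅]
    (by intro i; fin_cases i; exacts [hU, hU.compl, isClopen_empty]) fun g hg => by
      have hp1 := hg p
      have hq1 := hg q
      have hr1 := hg r
      simp [Fin.sum_univ_three, hp, hq, hr'] at hp1 hq1 hr1
      have h2 : g 2 * inner ℝ (N q - N p) (N q - N p) = 0 := by
        rw [inner_sub_left]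
        linarith
      have h3 : g 2 = 0 := (mul_eq_zero.1 h2).resolve_right (inner_self_ne_zero.2 hd)
      rw [h3, zero_mul, add_zero] at hp1 hr1
      intro i
      fin_cases i
      exacts [hp1, hr1, h3]
  rw [h1] at this
  norm_num at this

lemma isHyperplaneOn_of_index_eq_one [IsFiniteMeasure (gaussArea F)] {C : ℝ}
    (hC : CurvatureCondition F N C) (h1 : index F N = 1) {U : Set M} (hU : IsClopen U)
    (hUn : U.Nonempty) (hUc : Uᶜ.Nonempty) : IsHyperplaneOn F U := by
  obtain ⟨p₀, hp₀⟩ := hUn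
  exact hF.isHyperplaneOn_of_normal_eq hU
    ⟨⟨p₀, hp₀⟩, hF.isPreconnected_of_index_eq_one hC h1 hU hUc⟩ (v := N p₀)
    fun p hp => hF.normal_eq_of_index_eq_one hC h1 hU hUc hp hp₀

end IsTwoSidedProperImmersion

end Classification

end GaussIsop

end

theorem corollary4p7 {n : ℕ} {M : Type*} [TopologicalSpace M] [ChartedSpace (Euc n) M]
    [IsManifold (𝓡 n) ∞ M] [T2Space M] [SecondCountableTopology M] [Nonempty M]
    [MeasurableSpace M] [BorelSpace M]
    (F N : M → Euc (n + 1)) (hF : GaussIsop.IsTwoSidedProperImmersion F N) :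
    -- the hyperplanes are exactly the stable solutions
    ((GaussIsop.gaussArea F Set.univ < ⊤ ∧ (∃ C : ℝ, GaussIsop.CurvatureCondition F N C) ∧
        GaussIsop.IsStable F N) ↔ GaussIsop.IsHyperplaneOn F Set.univ) ∧
    -- no connected solution has index one
    (GaussIsop.gaussArea F Set.univ < ⊤ → (∃ C : ℝ, GaussIsop.CurvatureCondition F N C) →
      ConnectedSpace M → GaussIsop.index F N ≠ 1) ∧
    -- a solution of index one can only be a disjoint union of two hyperplanes
    (GaussIsop.gaussArea F Set.univ < ⊤ → (∃ C : ℝ, GaussIsop.CurvatureCondition F N C) →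
      GaussIsop.index F N = 1 →
      ∃ U : Set M, IsClopen U ∧ GaussIsop.IsHyperplaneOn F U ∧ GaussIsop.IsHyperplaneOn F Uᶜ) := by
  refine ⟨⟨fun ⟨hfin, ⟨C, hC⟩, hs⟩ => ?_, fun hH => ?_⟩, fun hfin ⟨C, hC⟩ hconn => ?_,
    fun hfin ⟨C, hC⟩ h1 => ?_⟩
  · have : MeasureTheory.IsFiniteMeasure (GaussIsop.gaussArea F) := ⟨hfin⟩
    exact hF.isHyperplaneOn_of_index_eq_zero hC (GaussIsop.index_eq_zero_of_isStable hs)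
  · exact ⟨hF.gaussArea_lt_top_of_isHyperplaneOn hH, hF.curvatureCondition_of_isHyperplaneOn hH,
      hF.isStable_of_isHyperplaneOn hH⟩
  · have : MeasureTheory.IsFiniteMeasure (GaussIsop.gaussArea F) := ⟨hfin⟩
    exact hF.index_ne_one hC
  · have : MeasureTheory.IsFiniteMeasure (GaussIsop.gaussArea F) := ⟨hfin⟩
    -- A connected hypersurface cannot have index one, so there is a nontrivial clopen set to split
    -- along.
    have hn : ¬PreconnectedSpace M := fun h =>
      have : ConnectedSpace M := { h with toNonempty := inferInstance }
      hF.index_ne_one hC h1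
    obtain ⟨U, hU, hUn, hUc⟩ := GaussIsop.exists_isClopen_of_not_preconnectedSpace hn
    exact ⟨U, hU, hF.isHyperplaneOn_of_index_eq_one hC h1 hU hUn hUc,
      hF.isHyperplaneOn_of_index_eq_one hC h1 hU.compl hUc (by rwa [compl_compl])⟩
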